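/- **Setting.** The plane $\mathbb R^2$ is equipped with its Euclidean norm. A planar non-smooth vector field (NSVF) $Z$ consists of finitely many pairwise disjoint open regions $R_i\subset\mathbb R^2$, each with a vector field $X_i$ that is smooth on a neighbourhood of $\overline{R_i}$, such that the switching set $\Sigma=\mathbb R^2\setminus\bigcup_i R_i$ is, except at finitely many corner points, locally a regular level curve $\{f=0\}$ of a smooth function with one region $R_i=\{f>0\}$ and another region $R_j=\{f<0\}$ on its two sides. With $Xf=\langle\nabla f,X\rangle$, a point of $\Sigma$ with such a chart is sliding or escaping if $X_if\cdot X_jf<0$; there the sliding field is $Z^s=\frac{X_jf\,X_i-X_if\,X_j}{X_jf-X_if}$. It is a singular tangency if $X_if=X_jf=0$, $X_i^2f<0<X_j^2f$ (an invisible fold for both fields). A global trajectory is either constant at a singular tangency, or a continuous curve $\gamma:\mathbb R\to\mathbb R^2$ avoiding singular tangencies for which there are times $\dots<s_k<s_{k+1}<\dots$ with $s_k\to\pm\infty$ as $k\to\pm\infty$ such that on each $[s_k,s_{k+1}]$ it is an integral curve of some $X_i$ inside $\overline{R_i}$, or an integral curve of $Z^s$ (extended to the closure of the sliding and escaping regions).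 A set is $Z$-invariant if it contains every global trajectory that meets it. For a compact set $K$ let $\Omega_K$ be the set of global trajectories contained in $K$, with the metric $$\rho(\gamma_1,\gamma_2)=\sum_{i\in\mathbb Z}2^{-|i|}\int_i^{i+1}|\gamma_1(t)-\gamma_2(t)|\,dt ,$$ let $F_1:\Omega_K\to\Omega_K$, $F_1(\gamma)(t)=\gamma(t+1)$, and let $h(Z|_K)$ be the topological entropy of $F_1$ (defined with minimal $(n,\varepsilon)$-dense sets). **Theorem.** For every integer $\alpha\ge2$ there are $c>0$, with $c=1$ if $\alpha\le4$, and an NSVF $Z$ on $\mathbb R^2$ with the following properties. 1. $Z$ is a rosette of $2\alpha$ sectors: for $0\le j<\alpha$ let $\mathcal R_j$ be the rotation about the origin by $2\pi j/\alpha$; the regions are the sectors $\mathcal R_j\{0<\arg<\pi/\alpha\}$ and $\mathcal R_j\{-\pi/\alpha<\arg<0\}$, and on them $Z$ equals, respectively, $4\,\mathcal R_j\circ X\circ\mathcal R_j^{-1}$ and $4\,\mathcal R_j\circ Y\circ\mathcal R_j^{-1}$, where $X(x,y)=(1,c(1-x))$ and $Y(x,y)=(-1,c(1-x))$. 2. $h(Z)=\log\alpha$: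 for every compact $Z$-invariant set $K$ containing the origin, $h(Z|_K)=\log\alpha$. Every bounded set is contained in a compact $Z$-invariant set. 3. Let $I_j:[0,1]\to\mathbb R^2$ be the closed arc through the origin obtained by applying $\mathcal R_j$ to the curve that runs, with horizontal speed $4$, along $y=c(x-x^2/2)$ from $(0,0)$ to $(2,0)$ for $t\in[0,\frac12]$ and back along $y=-c(x-x^2/2)$ for $t\in[\frac12,1]$. The union $\Lambda=\bigcup_j I_j([0,1])$ is compact and $Z$-invariant, and every global trajectory in $\Lambda$ is at the origin at some time $\tau\in[0,1)$. 4. Let $\Omega^*=\{\gamma\in\Omega_\Lambda:\gamma(0)=0\}$. There is a homeomorphism $\Phi:\{0,\dots,\alpha-1\}^{\mathbb Z}\to\Omega^*$ with $\Phi(s)(n+u)=I_{s_n}(u)$ for all $n\in\mathbb Z$, $u\in[0,1]$, so that the elements of $\Omega^*$ are exactly the arbitrary concatenations of the arcs $I_j$, each of duration $1$; and $\Phi\circ\sigma=F_1\circ\Phi$, where $\sigma(s)_n=s_{n+1}$ is the full shift. -/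

import Mathlib

open Set Filter Topology
open scoped ContDiff

noncomputable section

/-- `f` is a local defining function of the switching curve at `p` for a family of regions of the
plane: `p` lies on the regular level curve `f = 0`, and near `p` the regions `i` and `j` are the two
sides `f > 0` and `f < 0` of that curve. -/
structure IsSwitchChart {ι : Type} (region : ι → Set ℂ) (i j : ι) (f : ℂ → ℝ) (p : ℂ) : Prop where
  ne : i ≠ j
  smooth : ContDiff ℝ ∞ f
  zero : f p = 0
  regular : fderiv ℝ f p ≠ 0
  sides : ∀ᶠ q in 𝓝 p, (q ∈ region i ↔ 0 < f q) ∧ (q ∈ region j ↔ f q < 0)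

/-- A planar non-smooth (piecewise smooth) vector field with regions indexed by `ι`; the plane
`ℝ²` is `ℂ` with its Euclidean norm. The switching set, which is the complement of the
regions, is a smooth curve separating two regions except at finitely many corner points. On each
region the field is smooth up to the boundary, i.e. on an open set containing the closure. -/
structure NSVF (ι : Type) where
  region : ι → Set ℂ
  field : ι → ℂ → ℂ
  isOpen_region : ∀ i, IsOpen (region i)
  disjoint_region : ∀ i j, i ≠ j → Disjoint (region i) (region j)
  finite_corners : {p : ℂ | (∀ i, p ∉ region i) ∧
    ¬ ∃ i j f, IsSwitchChart region i j f p}.Finite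
  smooth_field : ∀ i, ∃ V : Set ℂ, IsOpen V ∧ closure (region i) ⊆ V ∧ ContDiffOn ℝ ∞ (field i) V

/-- The Lie derivative `Xf = ⟨∇f, X⟩`. -/
def lieDer (X : ℂ → ℂ) (f : ℂ → ℝ) (q : ℂ) : ℝ := fderiv ℝ f q (X q)

namespace NSVF

variable {ι : Type} (Z : NSVF ι)

/-- The graph of the sliding vector field on the sliding and escaping regions, where the two
one-sided fields `X`, `Y` satisfy `Xf · Yf < 0`. -/
def slidingGraph : Set (ℂ × ℂ) :=
  {w | ∃ i j f, IsSwitchChart Z.region i j f w.1 ∧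
    lieDer (Z.field i) f w.1 * lieDer (Z.field j) f w.1 < 0 ∧
    w.2 = (lieDer (Z.field j) f w.1 - lieDer (Z.field i) f w.1)⁻¹ •
      (lieDer (Z.field j) f w.1 • Z.field i w.1 - lieDer (Z.field i) f w.1 • Z.field j w.1)}

/-- A singular tangency: an invisible fold for the fields on both sides of the switching curve. -/
def IsSingularTangency (p : ℂ) : Prop :=
  ∃ i j f, IsSwitchChart Z.region i j f p ∧
    lieDer (Z.field i) f p = 0 ∧ lieDer (Z.field i) (lieDer (Z.field i) f) p < 0 ∧
    lieDer (Z.field j) f p = 0 ∧ 0 < lieDer (Z.field j) (lieDer (Z.field j) f) p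

/-- On `[a, b]`, `γ` follows the field of region `i` inside the closed region. -/
def IsRegionArc (i : ι) (γ : ℝ → ℂ) (a b : ℝ) : Prop :=
  (∀ t ∈ Icc a b, γ t ∈ closure (Z.region i)) ∧
    ∀ t ∈ Ioo a b, HasDerivAt γ (Z.field i (γ t)) t

/-- On `[a, b]`, `γ` follows the sliding vector field (extended to the closure of the sliding and
escaping regions). -/
def IsSlidingArc (γ : ℝ → ℂ) (a b : ℝ) : Prop :=
  ∀ t ∈ Ioo a b, ∃ v, (γ t, v) ∈ closure Z.slidingGraph ∧ HasDerivAt γ v t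

/-- Global trajectories. Either a constant at a singular tangency, or a concatenation of region
arcs and sliding arcs that avoids singular tangencies, with a bi-infinite sequence of switching
times going to `±∞`. At crossing, sliding and escaping points the admissible
successions of arcs are forced by the condition that region arcs stay in their closed region; at
regular tangencies and at corners any arriving arc may be followed by any departing arc. -/
def IsTrajectory (γ : ℝ → ℂ) : Prop :=
  (∃ p, Z.IsSingularTangency p ∧ ∀ t, γ t = p) ∨
  (Continuous γ ∧ (∀ t, ¬ Z.IsSingularTangency (γ t)) ∧
    ∃ s : ℤ → ℝ, StrictMono s ∧ Tendsto s atTop atTop ∧ Tendsto s atBot atBot ∧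
      ∀ k, (∃ i, Z.IsRegionArc i γ (s k) (s (k + 1))) ∨ Z.IsSlidingArc γ (s k) (s (k + 1)))

/-- `A` contains every global trajectory that passes through a point of `A`. -/
def IsInvariant (A : Set ℂ) : Prop :=
  ∀ γ, Z.IsTrajectory γ → (∃ t, γ t ∈ A) → ∀ t, γ t ∈ A

/-- The space `Ω` of global trajectories of `Z` in the compact set `K`. -/
def Omega (K : TopologicalSpace.Compacts ℂ) : Type :=
  {γ : ℝ → ℂ // Z.IsTrajectory γ ∧ ∀ t, γ t ∈ K}

variable {Z}

theorem IsTrajectory.continuous {γ : ℝ → ℂ} (h : Z.IsTrajectory γ) : Continuous γ := by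
  rcases h with ⟨p, -, h⟩ | h
  · have : γ = fun _ => p := funext h
    rw [this]; exact continuous_const
  · exact h.1

theorem IsRegionArc.shift {i : ι} {γ : ℝ → ℂ} {a b : ℝ} (h : Z.IsRegionArc i γ a b) (τ : ℝ) :
    Z.IsRegionArc i (fun t => γ (t + τ)) (a - τ) (b - τ) := by
  refine ⟨fun t ht => h.1 _ ⟨by linarith [ht.1], by linarith [ht.2]⟩, fun t ht => ?_⟩
  exact (h.2 (t + τ) ⟨by linarith [ht.1], by linarith [ht.2]⟩).comp_add_const t τ

theorem IsSlidingArc.shift {γ : ℝ → ℂ} {a b : ℝ} (h : Z.IsSlidingArc γ a b) (τ : ℝ) :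
    Z.IsSlidingArc (fun t => γ (t + τ)) (a - τ) (b - τ) := by
  intro t ht
  obtain ⟨v, hv, hd⟩ := h (t + τ) ⟨by linarith [ht.1], by linarith [ht.2]⟩
  exact ⟨v, hv, hd.comp_add_const t τ⟩

theorem IsTrajectory.shift {γ : ℝ → ℂ} (h : Z.IsTrajectory γ) (τ : ℝ) :
    Z.IsTrajectory (fun t => γ (t + τ)) := by
  rcases h with ⟨p, hp, h⟩ | ⟨hc, hs, s, hm, h1, h2, h3⟩
  · exact Or.inl ⟨p, hp, fun t => h _⟩
  · refine Or.inr ⟨hc.comp (continuous_add_const τ), fun t => hs _, fun k => s k - τ,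
      fun a b hab => sub_lt_sub_right (hm hab) τ, ?_, ?_, fun k => ?_⟩
    · exact tendsto_atTop_add_const_right _ (-τ) h1
    · exact tendsto_atBot_add_const_right _ (-τ) h2
    · exact (h3 k).imp (fun ⟨i, hi⟩ => ⟨i, hi.shift τ⟩) (fun h => h.shift τ)

variable {K : TopologicalSpace.Compacts ℂ}

variable (Z K) in
/-- The time-one map `F₁(γ)(·) = γ(· + 1)` on the space of trajectories. -/
def timeOne (γ : Z.Omega K) : Z.Omega K :=
  ⟨fun t => γ.1 (t + 1), γ.2.1.shift 1, fun t => γ.2.2 (t + 1)⟩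

/-- The distance `ρ` on the space of trajectories. -/
def rho (γ₁ γ₂ : Z.Omega K) : ℝ :=
  ∑' i : ℤ, 1 / 2 ^ i.natAbs * ∫ t in (i : ℝ)..(i + 1), dist (γ₁.1 t) (γ₂.1 t)

theorem continuous_dist_omega (γ₁ γ₂ : Z.Omega K) :
    Continuous fun t => dist (γ₁.1 t) (γ₂.1 t) :=
  γ₁.2.1.continuous.dist γ₂.2.1.continuous

theorem integral_dist_nonneg (γ₁ γ₂ : Z.Omega K) (i : ℤ) :
    0 ≤ ∫ t in (i : ℝ)..(i + 1), dist (γ₁.1 t) (γ₂.1 t) :=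
  intervalIntegral.integral_nonneg (by linarith) fun _ _ => dist_nonneg

theorem summable_weight : Summable fun i : ℤ => (1 : ℝ) / 2 ^ i.natAbs := by
  have h : Summable fun n : ℕ => (1 : ℝ) / 2 ^ n := by
    simpa [one_div, inv_pow] using summable_geometric_two
  exact Summable.of_nat_of_neg (by simpa using h) (by simpa using h)

theorem summable_rho (γ₁ γ₂ : Z.Omega K) :
    Summable fun i : ℤ =>
      1 / 2 ^ i.natAbs * ∫ t in (i : ℝ)..(i + 1), dist (γ₁.1 t) (γ₂.1 t) := by
  refine Summable.of_nonneg_of_le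
    (fun i => mul_nonneg (by positivity) (integral_dist_nonneg γ₁ γ₂ i)) (fun i => ?_)
    (summable_weight.mul_right (Metric.diam (K : Set ℂ)))
  refine mul_le_mul_of_nonneg_left ?_ (by positivity)
  have h : ∫ t in (i : ℝ)..(i + 1), dist (γ₁.1 t) (γ₂.1 t) ≤
      ∫ _ in (i : ℝ)..(i + 1), Metric.diam (K : Set ℂ) :=
    intervalIntegral.integral_mono (by linarith)
      ((continuous_dist_omega γ₁ γ₂).intervalIntegrable _ _) (by simp)
      fun t => Metric.dist_le_diam_of_mem K.isCompact.isBounded (γ₁.2.2 t) (γ₂.2.2 t)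
  simpa using h

theorem eq_of_rho_eq_zero {γ₁ γ₂ : Z.Omega K} (h : rho γ₁ γ₂ = 0) : γ₁ = γ₂ := by
  have hs := (summable_rho γ₁ γ₂).hasSum
  rw [show (∑' i : ℤ, 1 / 2 ^ i.natAbs * ∫ t in (i : ℝ)..(i + 1), dist (γ₁.1 t) (γ₂.1 t)) = 0
    from h] at hs
  have hnn : ∀ i : ℤ,
      0 ≤ 1 / 2 ^ i.natAbs * ∫ t in (i : ℝ)..(i + 1), dist (γ₁.1 t) (γ₂.1 t) :=
    fun i => mul_nonneg (by positivity) (integral_dist_nonneg γ₁ γ₂ i)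
  have hz := (hasSum_zero_iff_of_nonneg hnn).1 hs
  refine Subtype.ext (funext fun t => ?_)
  by_contra hne
  have hpos : 0 < ∫ u in ((⌊t⌋ : ℤ) : ℝ)..(⌊t⌋ + 1), dist (γ₁.1 u) (γ₂.1 u) :=
    intervalIntegral.integral_pos (by linarith) (continuous_dist_omega γ₁ γ₂).continuousOn
      (fun _ _ => dist_nonneg)
      ⟨t, ⟨Int.floor_le t, (Int.lt_floor_add_one t).le⟩, dist_pos.2 hne⟩
  have h0 := congrFun hz ⌊t⌋
  have : (0 : ℝ) < 1 / 2 ^ (⌊t⌋).natAbs := by positivity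
  exact (mul_pos this hpos).ne' h0

instance : MetricSpace (Z.Omega K) where
  dist := rho
  dist_self γ := by simp [rho]
  dist_comm γ₁ γ₂ := by simp [rho, dist_comm]
  dist_triangle γ₁ γ₂ γ₃ := by
    unfold rho
    rw [← (summable_rho γ₁ γ₂).tsum_add (summable_rho γ₂ γ₃)]
    refine (summable_rho γ₁ γ₃).tsum_le_tsum (fun i => ?_)
      ((summable_rho γ₁ γ₂).add (summable_rho γ₂ γ₃))
    rw [← mul_add, ← intervalIntegral.integral_add
      ((continuous_dist_omega γ₁ γ₂).intervalIntegrable _ _)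
      ((continuous_dist_omega γ₂ γ₃).intervalIntegrable _ _)]
    refine mul_le_mul_of_nonneg_left ?_ (by positivity)
    exact intervalIntegral.integral_mono (by linarith)
      ((continuous_dist_omega γ₁ γ₃).intervalIntegrable _ _)
      (((continuous_dist_omega γ₁ γ₂).add
        (continuous_dist_omega γ₂ γ₃)).intervalIntegrable _ _)
      fun t => dist_triangle _ _ _
  eq_of_dist_eq_zero := eq_of_rho_eq_zero

variable (Z K) in
/-- The topological entropy of `Z` on the compact set `K`: the topological entropy (in terms of
minimal `(n, ε)`-dense sets) of the time-one map on the metric space of trajectories. -/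
def entropy : EReal := Dynamics.coverEntropy (Z.timeOne K) univ

end NSVF

/-- The field `(1, c (1 - x))`; for `c = 1` it is `X = (1, 1 - x)`. -/
def rosetteX (c : ℝ) (z : ℂ) : ℂ := ⟨1, c * (1 - z.re)⟩

/-- The field `(-1, c (1 - x))`; for `c = 1` it is `Y = (-1, 1 - x)`. -/
def rosetteY (c : ℝ) (z : ℂ) : ℂ := ⟨-1, c * (1 - z.re)⟩

/-- The open sector `0 < arg z < π / α` (for `α ≥ 2`). -/
def upperSector (α : ℕ) : Set ℂ :=
  {z | 0 < z.im ∧ z.im * Real.cos (Real.pi / α) < z.re * Real.sin (Real.pi / α)}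

/-- The open sector `-π / α < arg z < 0` (for `α ≥ 2`). -/
def lowerSector (α : ℕ) : Set ℂ :=
  {z | z.im < 0 ∧ -z.im * Real.cos (Real.pi / α) < z.re * Real.sin (Real.pi / α)}

/-- Multiplication by this number is the rotation by the angle `2 π j / α`. -/
def rosetteRot (α : ℕ) (j : Fin α) : ℂ :=
  Complex.exp (((2 * Real.pi * (j : ℕ) / α : ℝ) : ℂ) * Complex.I)

/-- The rosette with `2 α` sectors: the sectors `(j, true)` and `(j, false)` are the upper and lower
sectors rotated by `2 π j / α`, carrying the correspondingly rotated copies of the fields `X` and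
`Y`. The factor `4` normalizes the duration of the closed arcs to `1`. -/
structure IsRosette (α : ℕ) (c : ℝ) (Z : NSVF (Fin α × Bool)) : Prop where
  region_upper : ∀ j, Z.region (j, true) = {z | (rosetteRot α j)⁻¹ * z ∈ upperSector α}
  region_lower : ∀ j, Z.region (j, false) = {z | (rosetteRot α j)⁻¹ * z ∈ lowerSector α}
  field_upper : ∀ j z,
    Z.field (j, true) z = 4 * (rosetteRot α j * rosetteX c ((rosetteRot α j)⁻¹ * z))
  field_lower : ∀ j z,
    Z.field (j, false) z = 4 * (rosetteRot α j * rosetteY c ((rosetteRot α j)⁻¹ * z))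

/-- The closed arc `j` through the origin, parametrized by `[0, 1]`: out along the parabola
`y = c (x - x² / 2)` from `0` to `(2, 0)`, back along `y = - c (x - x² / 2)`, rotated by
`2 π j / α`. -/
def rosetteArc (α : ℕ) (c : ℝ) (j : Fin α) (t : ℝ) : ℂ :=
  rosetteRot α j *
    (if t ≤ 1 / 2 then ⟨4 * t, c * (4 * t - (4 * t) ^ 2 / 2)⟩
      else ⟨4 - 4 * t, -(c * ((4 - 4 * t) - (4 - 4 * t) ^ 2 / 2))⟩)

end

/-! On each half sector the function `|y| - c (x - x² / 2)`, in the rotated coordinates of its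
sector, is constant along the field. The closed sectors are the cells on which the real part of the
rotated-back point is largest, so replacing `x` by that maximum and `|y|` by `√(‖z‖² - x²)` glues
these functions into one continuous first integral of the rosette.

On every switching line the two fields have the same normal component, by reflection and time
reversal, so nothing slides. The condition `c ≤ tan (π / α)`, in the form `c cos ≤ sin`, makes this
component nonzero on the rays between sectors. On the axes it vanishes only at the points
`rosetteRot α j`, which are the singular tangencies.

Every other trajectory has energy `c (b² / 2 - b)` with a unique `b > 1`, the abscissa at which its
level curve turns on the axis. Inside a sector it follows `profile c b` for a time `T`, and the
whole motion is a sequence of such cells (`IsWave`). For `b < 2` it is a loop around a tangency in a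
single sector. For `b > 2` it passes from each sector to the adjacent one in a fixed direction of
rotation. For `b = 2` each cell is a petal of duration `1` through the origin, where the next sector
is free. All symbolic freedom therefore sits on `b = 2`, which gives the full shift.

For the entropy upper bound, `exists_code` describes a trajectory up to `δ` on a window of length
about `n` by `b`, `T` and the phase `β` on a grid of mesh of order `1 / n`, since phase errors grow
only linearly in time, together with an itinerary. The grid costs a polynomial factor; the itinerary
costs `α ^ n` up to a constant for `b = 2` and `2 α` choices otherwise. Waves with very short period
stay near a tangency and are coded by it. The lower bound comes from the concatenations of arcs over
`α ^ n` words, which are uniformly separated in time `n`. -/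

noncomputable section

/-! ### Rotations and sectors as maximality cells -/

section Rotations

variable {α : ℕ}

theorem cos_pi_div_nonneg (hα : 2 ≤ α) : 0 ≤ Real.cos (Real.pi / α) := by
  have h2 : (2 : ℝ) ≤ α := by exact_mod_cast hα
  refine Real.cos_nonneg_of_mem_Icc ⟨?_, ?_⟩
  · have : 0 ≤ Real.pi / α := by positivity
    linarith [Real.pi_pos]
  · exact div_le_div_of_nonneg_left Real.pi_pos.le two_pos h2

theorem sin_pi_div_pos (hα : 2 ≤ α) : 0 < Real.sin (Real.pi / α) := by
  have h2 : (2 : ℝ) ≤ α := by exact_mod_cast hα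
  refine Real.sin_pos_of_pos_of_lt_pi (by positivity) ?_
  exact div_lt_self Real.pi_pos (by linarith)

theorem norm_rosetteRot (j : Fin α) : ‖rosetteRot α j‖ = 1 :=
  Complex.norm_exp_ofReal_mul_I _

theorem rosetteRot_ne_zero (j : Fin α) : rosetteRot α j ≠ 0 := Complex.exp_ne_zero _

theorem rosetteRot_eq_pow (j : Fin α) :
    rosetteRot α j = Complex.exp (2 * Real.pi * Complex.I / α) ^ (j : ℕ) := by
  rw [rosetteRot, ← Complex.exp_nat_mul]
  congr 1
  push_cast
  ring

theorem rosetteRot_injective : Function.Injective (rosetteRot α) := by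
  intro j k h
  rw [rosetteRot_eq_pow, rosetteRot_eq_pow] at h
  exact Fin.ext ((Complex.isPrimitiveRoot_exp α j.pos.ne').pow_inj j.2 k.2 h)

theorem rosetteRot_pow (j : Fin α) : rosetteRot α j ^ α = 1 := by
  rw [rosetteRot_eq_pow, ← pow_mul, mul_comm (j : ℕ), pow_mul,
    (Complex.isPrimitiveRoot_exp α j.pos.ne').pow_eq_one, one_pow]

theorem exists_rosetteRot_eq (hα : 2 ≤ α) {w : ℂ} (h : w ^ α = 1) : ∃ j, rosetteRot α j = w := by
  have : NeZero α := ⟨by lia⟩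
  obtain ⟨i, hi, rfl⟩ := (Complex.isPrimitiveRoot_exp α (by lia)).eq_pow_of_pow_eq_one h
  exact ⟨⟨i, hi⟩, rosetteRot_eq_pow _⟩

/-- The unit vector on the ray `arg z = π / α`. -/
def rayDir (α : ℕ) : ℂ := ⟨Real.cos (Real.pi / α), Real.sin (Real.pi / α)⟩

theorem rayDir_eq_exp : rayDir α = Complex.exp ((Real.pi / α : ℝ) * Complex.I) := by
  apply Complex.ext
  · rw [Complex.exp_ofReal_mul_I_re, rayDir]
  · rw [Complex.exp_ofReal_mul_I_im, rayDir]

theorem rayDir_ne_zero : rayDir α ≠ 0 := by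
  rw [rayDir_eq_exp]; exact Complex.exp_ne_zero _

theorem rayDir_inv : (rayDir α)⁻¹ = ⟨Real.cos (Real.pi / α), -Real.sin (Real.pi / α)⟩ := by
  refine (eq_inv_of_mul_eq_one_left ?_).symm
  have := Real.sin_sq_add_cos_sq (Real.pi / α)
  apply Complex.ext <;> simp [rayDir] <;> nlinarith

theorem rayDir_sq_pow (hα : 2 ≤ α) : (rayDir α ^ 2) ^ α = 1 := by
  rw [rayDir_eq_exp, ← Complex.exp_nat_mul, ← Complex.exp_nat_mul, Complex.exp_eq_one_iff]
  refine ⟨1, ?_⟩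
  have : (α : ℂ) ≠ 0 := by exact_mod_cast (by lia : α ≠ 0)
  push_cast
  field_simp

theorem exists_rosetteRot_mul_rayDir_sq (hα : 2 ≤ α) (j : Fin α) :
    ∃ k, rosetteRot α k = rosetteRot α j * rayDir α ^ 2 :=
  exists_rosetteRot_eq hα (by rw [mul_pow, rosetteRot_pow, rayDir_sq_pow hα, one_mul])

theorem exists_rosetteRot_mul_rayDir_sq' (hα : 2 ≤ α) (j : Fin α) :
    ∃ k, rosetteRot α j = rosetteRot α k * rayDir α ^ 2 := by
  obtain ⟨k, hk⟩ := exists_rosetteRot_eq hα (w := rosetteRot α j * (rayDir α ^ 2)⁻¹)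
    (by rw [mul_pow, rosetteRot_pow, inv_pow, rayDir_sq_pow hα, inv_one, one_mul])
  exact ⟨k, by rw [hk, inv_mul_cancel_right₀ (pow_ne_zero _ rayDir_ne_zero)]⟩

/-- The closed sector `|arg z| ≤ π / α`. -/
def closedSector (α : ℕ) : Set ℂ :=
  {z | |z.im| * Real.cos (Real.pi / α) ≤ z.re * Real.sin (Real.pi / α)}

/-- The open sector `|arg z| < π / α`. -/
def openSector (α : ℕ) : Set ℂ :=
  {z | |z.im| * Real.cos (Real.pi / α) < z.re * Real.sin (Real.pi / α)}

theorem openSector_subset_closedSector : openSector α ⊆ closedSector α := fun z (h : |z.im| * _ < z.re * _) => h.le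

theorem isOpen_openSector : IsOpen (openSector α) :=
  isOpen_lt (by fun_prop) (by fun_prop)

theorem isClosed_closedSector : IsClosed (closedSector α) :=
  isClosed_le (by fun_prop) (by fun_prop)

theorem re_nonneg_of_mem_closedSector (hα : 2 ≤ α) {z : ℂ} (hz : z ∈ closedSector α) :
    0 ≤ z.re :=
  nonneg_of_mul_nonneg_left
    ((mul_nonneg (abs_nonneg _) (cos_pi_div_nonneg hα)).trans hz) (sin_pi_div_pos hα)

/-- Half-angle formulas turn the change of the real part under a rotation by `2 φ` into `2 sin φ`
times a linear form. This reduces comparisons between sectors to the sign of that form. -/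
theorem rosetteRot_mul_re (m : Fin α) (z : ℂ) :
    z.re - (rosetteRot α m * z).re = 2 * Real.sin (m * (Real.pi / α)) *
      (z.re * Real.sin (m * (Real.pi / α)) + z.im * Real.cos (m * (Real.pi / α))) := by
  have h : 2 * Real.pi * (m : ℕ) / α = 2 * (m * (Real.pi / α)) := by ring
  rw [rosetteRot, Complex.mul_re, Complex.exp_ofReal_mul_I_re, Complex.exp_ofReal_mul_I_im, h,
    Real.cos_two_mul, Real.sin_two_mul]
  linear_combination (-2 * z.re) * Real.sin_sq_add_cos_sq (m * (Real.pi / α))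

/-- The angle `m π / α` lies between `π / α` and `π - π / α`; cosine is monotone there, and the
bound on the sine follows from `sin² + cos² = 1`. -/
theorem sin_mul_pi_div_le {m : ℕ} (hm : 1 ≤ m) (hmα : m < α) :
    Real.sin (Real.pi / α) ≤ Real.sin (m * (Real.pi / α)) ∧
      |Real.cos (m * (Real.pi / α))| ≤ Real.cos (Real.pi / α) := by
  have hα : 2 ≤ α := by lia
  have hα0 : (0 : ℝ) < α := by exact_mod_cast (by lia : 0 < α)
  have hθ : 0 < Real.pi / α := div_pos Real.pi_pos hα0
  have h1 : Real.pi / α ≤ m * (Real.pi / α) := by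
    have : (1 : ℝ) ≤ m := by exact_mod_cast hm
    nlinarith
  have h2 : m * (Real.pi / α) ≤ Real.pi - Real.pi / α := by
    have h3 : (m : ℝ) + 1 ≤ α := by exact_mod_cast hmα
    have h4 : α * (Real.pi / α) = Real.pi := by field_simp
    nlinarith
  have hc : |Real.cos (m * (Real.pi / α))| ≤ Real.cos (Real.pi / α) := by
    rw [abs_le, ← Real.cos_pi_sub]
    constructor
    · exact Real.cos_le_cos_of_nonneg_of_le_pi (by linarith) (by linarith) h2
    · exact Real.cos_le_cos_of_nonneg_of_le_pi hθ.le (by linarith) h1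
  refine ⟨?_, hc⟩
  have hs : 0 ≤ Real.sin (m * (Real.pi / α)) :=
    Real.sin_nonneg_of_nonneg_of_le_pi (by linarith) (by linarith)
  refine le_of_sq_le_sq ?_ hs
  have h5 := sq_le_sq' (by linarith [abs_nonneg (Real.cos (m * (Real.pi / α)))]) hc
  rw [sq_abs] at h5
  linarith [Real.sin_sq_add_cos_sq (m * (Real.pi / α)), Real.sin_sq_add_cos_sq (Real.pi / α)]

theorem sector_form_le {m : ℕ} (hm : 1 ≤ m) (hmα : m < α) {z : ℂ} (hz : 0 ≤ z.re) :
    z.re * Real.sin (Real.pi / α) - |z.im| * Real.cos (Real.pi / α) ≤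
      z.re * Real.sin (m * (Real.pi / α)) + z.im * Real.cos (m * (Real.pi / α)) := by
  obtain ⟨hs, hc⟩ := sin_mul_pi_div_le hm hmα
  have h1 := mul_le_mul_of_nonneg_left hs hz
  have h2 := mul_le_mul_of_nonneg_left hc (abs_nonneg z.im)
  rw [← abs_mul] at h2
  linarith [neg_abs_le (z.im * Real.cos (m * (Real.pi / α)))]

/-- With its converse below, this describes the closed sector as the set of points whose real part
is maximal in their orbit under the rotations, so no argument function is needed. -/
theorem re_mul_le_of_mem_closedSector (hα : 2 ≤ α) {w z : ℂ} (hw : w ^ α = 1)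
    (hz : z ∈ closedSector α) : (w * z).re ≤ z.re := by
  obtain ⟨m, rfl⟩ := exists_rosetteRot_eq hα hw
  rw [← sub_nonneg, rosetteRot_mul_re]
  rcases Nat.eq_zero_or_pos m with hm | hm
  · simp [hm]
  have h1 := sector_form_le hm m.2 (re_nonneg_of_mem_closedSector hα hz)
  have h2 := (sin_pi_div_pos hα).le.trans (sin_mul_pi_div_le hm m.2).1
  have h3 : |z.im| * Real.cos (Real.pi / α) ≤ z.re * Real.sin (Real.pi / α) := hz
  exact mul_nonneg (by linarith) (by linarith)

theorem re_mul_lt_of_mem_openSector (hα : 2 ≤ α) {w z : ℂ} (hw : w ^ α = 1) (hw1 : w ≠ 1)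
    (hz : z ∈ openSector α) : (w * z).re < z.re := by
  obtain ⟨m, rfl⟩ := exists_rosetteRot_eq hα hw
  rw [← sub_pos, rosetteRot_mul_re]
  have hm : 1 ≤ (m : ℕ) := by
    by_contra h
    exact hw1 (by simp [rosetteRot_eq_pow, show (m : ℕ) = 0 by lia])
  have h1 := sector_form_le hm m.2
    (re_nonneg_of_mem_closedSector hα (openSector_subset_closedSector hz))
  have h2 := (sin_pi_div_pos hα).trans_le (sin_mul_pi_div_le hm m.2).1
  have h3 : |z.im| * Real.cos (Real.pi / α) < z.re * Real.sin (Real.pi / α) := hz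
  exact mul_pos (by linarith) (by linarith)

/-- Only the two neighbouring rotations, by `± 2 π / α`, are needed: they give the two bounding
lines of the sector. -/
theorem mem_closedSector_of_re_mul_le (hα : 2 ≤ α) {z : ℂ}
    (h : ∀ w : ℂ, w ^ α = 1 → (w * z).re ≤ z.re) : z ∈ closedSector α := by
  have hs := sin_pi_div_pos hα
  have hsc := Real.sin_sq_add_cos_sq (Real.pi / α)
  have h1 := h _ (rayDir_sq_pow hα)
  have h2 := h ((rayDir α)⁻¹ ^ 2) (by rw [inv_pow, inv_pow, rayDir_sq_pow hα, inv_one])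
  rw [rayDir_inv] at h2
  simp only [rayDir, pow_two, Complex.mul_re, Complex.mul_im] at h1 h2
  set s := Real.sin (Real.pi / α)
  set k := Real.cos (Real.pi / α)
  have h1' : 0 ≤ 2 * s * (z.re * s + z.im * k) := by linear_combination h1 - z.re * hsc
  have h2' : 0 ≤ 2 * s * (z.re * s - z.im * k) := by linear_combination h2 - z.re * hsc
  have h1'' := nonneg_of_mul_nonneg_right h1' (by linarith)
  have h2'' := nonneg_of_mul_nonneg_right h2' (by linarith)
  change |z.im| * k ≤ z.re * s
  rcases abs_cases z.im with ⟨h, -⟩ | ⟨h, -⟩ <;> rw [h] <;> linarith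

theorem div_rosetteRot_pow (j k : Fin α) : ((rosetteRot α j)⁻¹ * rosetteRot α k) ^ α = 1 := by
  rw [mul_pow, inv_pow, rosetteRot_pow, rosetteRot_pow, inv_one, one_mul]

theorem inv_rosetteRot_mul (j k : Fin α) (z : ℂ) :
    (rosetteRot α j)⁻¹ * z =
      ((rosetteRot α j)⁻¹ * rosetteRot α k) * ((rosetteRot α k)⁻¹ * z) := by
  rw [mul_assoc, mul_inv_cancel_left₀ (rosetteRot_ne_zero k)]

theorem re_le_of_mem_closedSector (hα : 2 ≤ α) {j : Fin α} (k : Fin α) {z : ℂ}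
    (hz : (rosetteRot α j)⁻¹ * z ∈ closedSector α) :
    ((rosetteRot α k)⁻¹ * z).re ≤ ((rosetteRot α j)⁻¹ * z).re := by
  rw [inv_rosetteRot_mul k j]
  exact re_mul_le_of_mem_closedSector hα (div_rosetteRot_pow k j) hz

theorem eq_of_mem_openSector_of_mem_closedSector (hα : 2 ≤ α) {j k : Fin α} {z : ℂ}
    (hj : (rosetteRot α j)⁻¹ * z ∈ openSector α)
    (hk : (rosetteRot α k)⁻¹ * z ∈ closedSector α) : j = k := by
  by_contra hne
  have h1 := re_le_of_mem_closedSector hα j hk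
  rw [inv_rosetteRot_mul k j] at h1
  refine h1.not_gt (re_mul_lt_of_mem_openSector hα (div_rosetteRot_pow k j) (fun h => hne ?_) hj)
  exact rosetteRot_injective (by
    rw [inv_mul_eq_one₀ (rosetteRot_ne_zero k)] at h; exact h.symm)

theorem exists_mem_closedSector (hα : 2 ≤ α) (z : ℂ) :
    ∃ j, (rosetteRot α j)⁻¹ * z ∈ closedSector α := by
  have : Nonempty (Fin α) := ⟨⟨0, by lia⟩⟩
  obtain ⟨j, hj⟩ := Finite.exists_max fun j => ((rosetteRot α j)⁻¹ * z).re
  refine ⟨j, mem_closedSector_of_re_mul_le hα fun w hw => ?_⟩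
  obtain ⟨k, hk⟩ := exists_rosetteRot_eq hα (w := w⁻¹ * rosetteRot α j)
    (by rw [mul_pow, inv_pow, hw, rosetteRot_pow, inv_one, one_mul])
  have := hj k
  rwa [hk, mul_inv, inv_inv, mul_assoc] at this

end Rotations

/-! ### Half sectors, their closures and the fields on them -/

section Sectors

variable {α : ℕ}

/-- The sign of the imaginary part on the upper and on the lower half of a sector. -/
def halfSign (s : Bool) : ℝ := if s then 1 else -1

theorem halfSign_sq (s : Bool) : halfSign s * halfSign s = 1 := by
  cases s <;> simp [halfSign]

/-- The open upper half (for `true`) or lower half (for `false`) of the sector. -/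
def halfSector (α : ℕ) (s : Bool) : Set ℂ :=
  {z | 0 < halfSign s * z.im ∧
    halfSign s * z.im * Real.cos (Real.pi / α) < z.re * Real.sin (Real.pi / α)}

theorem halfSector_true : halfSector α true = upperSector α := by
  simp [halfSector, upperSector, halfSign]

theorem halfSector_false : halfSector α false = lowerSector α := by
  simp [halfSector, lowerSector, halfSign]

theorem isOpen_halfSector (s : Bool) : IsOpen (halfSector α s) :=
  (isOpen_lt continuous_const (by fun_prop : Continuous fun z : ℂ => halfSign s * z.im)).inter
    (isOpen_lt (by fun_prop : Continuous fun z : ℂ =>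
      halfSign s * z.im * Real.cos (Real.pi / α)) (by fun_prop))

theorem abs_im_of_nonneg {s : Bool} {z : ℂ} (h : 0 ≤ halfSign s * z.im) :
    |z.im| = halfSign s * z.im := by
  rw [← abs_of_nonneg h, abs_mul]
  cases s <;> simp [halfSign]

theorem mem_halfSector {s : Bool} {z : ℂ} :
    z ∈ halfSector α s ↔ 0 < halfSign s * z.im ∧ z ∈ openSector α := by
  constructor
  · intro h
    refine ⟨h.1, ?_⟩
    rw [openSector, mem_ofPred_eq, abs_im_of_nonneg h.1.le]
    exact h.2
  · rintro ⟨h1, h2⟩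
    rw [openSector, mem_ofPred_eq, abs_im_of_nonneg h1.le] at h2
    exact ⟨h1, h2⟩

theorem closure_halfSector (hα : 2 ≤ α) (s : Bool) :
    closure (halfSector α s) = {z | 0 ≤ halfSign s * z.im ∧ z ∈ closedSector α} := by
  have hs := sin_pi_div_pos hα
  have hc := cos_pi_div_nonneg hα
  have hcl : IsClosed {z : ℂ | 0 ≤ halfSign s * z.im ∧ z ∈ closedSector α} :=
    (isClosed_le continuous_const
      (by fun_prop : Continuous fun z : ℂ => halfSign s * z.im)).inter isClosed_closedSector
  refine Subset.antisymm (closure_minimal (fun z hz => ?_) hcl) ?_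
  · rw [mem_halfSector] at hz
    exact ⟨hz.1.le, openSector_subset_closedSector hz.2⟩
  · rintro z ⟨h1, h2⟩
    rw [closedSector, mem_ofPred_eq, abs_im_of_nonneg h1] at h2
    -- The direction `1 + exp (± i π / α)` bisects the half sector, so moving along it from any
    -- point of the closed half sector enters the interior; both strict inequalities gain `t sin (π
    -- / α)`.
    have hlim : Tendsto (fun t : ℝ => z + t * (⟨1 + Real.cos (Real.pi / α),
        halfSign s * Real.sin (Real.pi / α)⟩ : ℂ)) (𝓝[>] 0) (𝓝 z) := by
      have : Continuous (fun t : ℝ => z + t * (⟨1 + Real.cos (Real.pi / α),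
        halfSign s * Real.sin (Real.pi / α)⟩ : ℂ)) := by fun_prop
      simpa using (this.tendsto 0).mono_left nhdsWithin_le_nhds
    refine mem_closure_of_tendsto hlim ?_
    filter_upwards [self_mem_nhdsWithin] with t ht
    have ht : 0 < t := ht
    have hsg := halfSign_sq s
    have h3 := mul_pos ht hs
    constructor
    · simp only [Complex.add_im, Complex.im_ofReal_mul]
      linear_combination h1 + h3 - t * Real.sin (Real.pi / α) * hsg
    · simp only [Complex.add_im, Complex.add_re, Complex.re_ofReal_mul, Complex.im_ofReal_mul]
      linear_combination h2 + h3 + t * Real.sin (Real.pi / α) * Real.cos (Real.pi / α) * hsg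

/-- The regions of the rosette: the half sectors rotated by `2 π j / α`. -/
def rosetteRegion (α : ℕ) (i : Fin α × Bool) : Set ℂ :=
  {z | (rosetteRot α i.1)⁻¹ * z ∈ halfSector α i.2}

/-- The fields of the rosette: the rotated copies of `4 (± 1, c (1 - x))`. -/
def rosetteField (α : ℕ) (c : ℝ) (i : Fin α × Bool) (z : ℂ) : ℂ :=
  4 * (rosetteRot α i.1 * ⟨halfSign i.2, c * (1 - ((rosetteRot α i.1)⁻¹ * z).re)⟩)

theorem isOpen_rosetteRegion (i : Fin α × Bool) : IsOpen (rosetteRegion α i) :=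
  (isOpen_halfSector i.2).preimage (continuous_const_mul _)

theorem closure_rosetteRegion (hα : 2 ≤ α) (i : Fin α × Bool) :
    closure (rosetteRegion α i) = {z | 0 ≤ halfSign i.2 * ((rosetteRot α i.1)⁻¹ * z).im ∧
      (rosetteRot α i.1)⁻¹ * z ∈ closedSector α} := by
  have := (Homeomorph.mulLeft₀ _ (inv_ne_zero (rosetteRot_ne_zero i.1))).preimage_closure
    (halfSector α i.2)
  rw [closure_halfSector hα] at this
  exact this.symm

theorem disjoint_rosetteRegion (hα : 2 ≤ α) (i j : Fin α × Bool) (hij : i ≠ j) :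
    Disjoint (rosetteRegion α i) (rosetteRegion α j) := by
  rw [Set.disjoint_left]
  intro z hi hj
  obtain ⟨hi1, hi2⟩ := mem_halfSector.1 hi
  obtain ⟨hj1, hj2⟩ := mem_halfSector.1 hj
  have h := eq_of_mem_openSector_of_mem_closedSector hα hi2 (openSector_subset_closedSector hj2)
  obtain ⟨i, s⟩ := i
  obtain ⟨j, s'⟩ := j
  obtain rfl : i = j := h
  refine hij (Prod.ext rfl ?_)
  cases s <;> cases s' <;> simp [halfSign] at hi1 hj1 ⊢ <;> linarith

theorem zero_mem_closure_rosetteRegion (hα : 2 ≤ α) (i : Fin α × Bool) :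
    0 ∈ closure (rosetteRegion α i) := by
  rw [closure_rosetteRegion hα]
  simp [closedSector]

theorem contDiff_rosetteField (c : ℝ) (i : Fin α × Bool) :
    ContDiff ℝ ∞ (rosetteField α c i) := by
  have h : rosetteField α c i = fun z => 4 * (rosetteRot α i.1 * ((halfSign i.2 : ℂ) +
      ((c * (1 - Complex.reCLM ((rosetteRot α i.1)⁻¹ * z)) : ℝ) : ℂ) * Complex.I)) := by
    funext z
    rw [rosetteField, Complex.mk_eq_add_mul_I]
    rfl
  rw [h]
  have h2 : ContDiff ℝ ∞ fun z : ℂ =>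
      ((c * (1 - Complex.reCLM ((rosetteRot α i.1)⁻¹ * z)) : ℝ) : ℂ) :=
    Complex.ofRealCLM.contDiff.comp (contDiff_const.mul (contDiff_const.sub
      (Complex.reCLM.contDiff.comp (contDiff_const.mul contDiff_id))))
  exact contDiff_const.mul (contDiff_const.mul (contDiff_const.add (h2.mul contDiff_const)))

end Sectors

/-! ### Comparing arbitrary charts with linear charts -/

section Charts

variable {ι : Type} {R : ι → Set ℂ} {i j : ι} {f : ℂ → ℝ} {p : ℂ}

theorem IsSwitchChart.symm (h : IsSwitchChart R i j f p) :
    IsSwitchChart R j i (fun q => -f q) p where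
  ne := h.ne.symm
  smooth := h.smooth.neg
  zero := by simp [h.zero]
  regular := by
    rw [fderiv_fun_neg]
    exact neg_ne_zero.2 h.regular
  sides := h.sides.mono fun q hq => by simpa using hq.symm

theorem IsSwitchChart.hasFDerivAt (h : IsSwitchChart R i j f p) :
    HasFDerivAt f (fderiv ℝ f p) p :=
  (h.smooth.differentiable (by simp) p).hasFDerivAt

/-- Where an open set avoiding both sides comes near `p`, the function `f` vanishes on open sets,
hence so does its derivative; by continuity the derivative would vanish at `p`, against regularity.
So only the two charted regions accumulate at `p`. -/
theorem IsSwitchChart.notMem_closure (h : IsSwitchChart R i j f p) {O : Set ℂ} (hO : IsOpen O)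
    (hi : Disjoint O (R i)) (hj : Disjoint O (R j)) : p ∉ closure O := by
  intro hp
  have hcont : Continuous (fderiv ℝ f) := h.smooth.continuous_fderiv (by simp)
  obtain ⟨U, hU, hUo, hpU⟩ := mem_nhds_iff.1 h.sides
  have hzero : ∀ q ∈ U ∩ O, fderiv ℝ f q = 0 := by
    intro q hq
    have : f =ᶠ[𝓝 q] fun _ => 0 := by
      filter_upwards [(hUo.inter hO).mem_nhds hq] with x hx
      have h1 := hU hx.1
      have h2 := fun hh => disjoint_left.1 hi hx.2 (h1.1.2 hh)
      have h3 := fun hh => disjoint_left.1 hj hx.2 (h1.2.2 hh)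
      exact le_antisymm (not_lt.1 h2) (not_lt.1 h3)
    rw [this.fderiv_eq, fderiv_fun_const, Pi.zero_apply]
  have h4 : p ∈ closure (U ∩ O) := by
    rw [mem_closure_iff_nhds] at hp ⊢
    intro t ht
    have := hp (t ∩ U) (inter_mem ht (hUo.mem_nhds hpU))
    rwa [inter_assoc] at this
  exact h.regular (closure_minimal hzero (isClosed_singleton.preimage hcont) h4)

/-- The linear functional `q ↦ Im (w q)`. -/
def imMul (w : ℂ) : ℂ →L[ℝ] ℝ := Complex.imCLM.comp (ContinuousLinearMap.mul ℝ ℂ w)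

@[simp]
theorem imMul_apply (w q : ℂ) : imMul w q = (w * q).im := rfl

theorem imMul_ne_zero {w : ℂ} (hw : w ≠ 0) : imMul w ≠ 0 := by
  intro h
  have := congrArg (fun L : ℂ →L[ℝ] ℝ => L (w⁻¹ * Complex.I)) h
  simp [mul_inv_cancel_left₀ hw] at this

theorem isSwitchChart_imMul {w : ℂ} (hij : i ≠ j) (hw : w ≠ 0) (h0 : (w * p).im = 0)
    (hs : ∀ᶠ q in 𝓝 p, (q ∈ R i ↔ 0 < (w * q).im) ∧ (q ∈ R j ↔ (w * q).im < 0)) :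
    IsSwitchChart R i j (imMul w) p where
  ne := hij
  smooth := (imMul w).contDiff
  zero := h0
  regular := by rw [ContinuousLinearMap.fderiv]; exact imMul_ne_zero hw
  sides := hs

/-- A short step from `p` in the direction `v` enters `R i`, on which `f` is positive, so the
one-sided difference quotients are nonnegative. -/
theorem IsSwitchChart.fderiv_nonneg (h : IsSwitchChart R i j f p) {w : ℂ}
    (hw : IsSwitchChart R i j (imMul w) p) {v : ℂ} (hv : 0 < (w * v).im) :
    0 ≤ fderiv ℝ f p v := by
  have hd : HasDerivAt (fun t : ℝ => f (p + t • v)) (fderiv ℝ f p v) 0 := by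
    have h1 : HasDerivAt (fun t : ℝ => p + t • v) v 0 := by
      simpa using ((hasDerivAt_id (0 : ℝ)).smul_const v).const_add p
    have h2 : HasFDerivAt f (fderiv ℝ f p) (p + (0 : ℝ) • v) := by simpa using h.hasFDerivAt
    exact h2.comp_hasDerivAt (0 : ℝ) h1
  have ht := hd.tendsto_slope_zero_right
  have hlim : Tendsto (fun t : ℝ => p + t • v) (𝓝[>] 0) (𝓝 p) := by
    have : Continuous fun t : ℝ => p + t • v := by fun_prop
    simpa using (this.tendsto 0).mono_left nhdsWithin_le_nhds
  refine ge_of_tendsto ht ?_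
  filter_upwards [hlim.eventually h.sides, hlim.eventually hw.sides, self_mem_nhdsWithin]
    with t h1 h2 ht
  have ht : 0 < t := ht
  have hz := hw.zero
  have h3 : p + t • v ∈ R i := by
    refine h2.1.2 ?_
    rw [map_add, hz, zero_add, map_smul, smul_eq_mul]
    exact mul_pos ht hv
  have h4 := h1.1.1 h3
  simp only [zero_add, zero_smul, add_zero, h.zero, sub_zero, smul_eq_mul]
  positivity

/-- A linear functional that is nonnegative on an open half plane is a multiple of the functional
defining it. Hence Lie derivatives in any chart can be computed, up to one nonzero factor, in the
linear chart. -/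
theorem IsSwitchChart.fderiv_eq (h : IsSwitchChart R i j f p) {w : ℂ} (hw0 : w ≠ 0)
    (hw : IsSwitchChart R i j (imMul w) p) :
    ∃ r : ℝ, r ≠ 0 ∧ ∀ v, fderiv ℝ f p v = r * (w * v).im := by
  set v₀ := w⁻¹ * Complex.I
  have hv₀ : (w * v₀).im = 1 := by simp [v₀, mul_inv_cancel_left₀ hw0]
  have hker : ∀ u : ℂ, (w * u).im = 0 → fderiv ℝ f p u = 0 := by
    intro u hu
    have key : ∀ t : ℝ, 0 ≤ fderiv ℝ f p v₀ + t * fderiv ℝ f p u := by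
      intro t
      have : 0 < (w * (v₀ + t • u)).im := by
        rw [mul_add, Complex.add_im, hv₀, mul_smul_comm, Complex.smul_im, hu]
        simp
      have := h.fderiv_nonneg hw this
      rwa [map_add, map_smul, smul_eq_mul] at this
    by_contra hne
    -- This value of `t` makes the affine function in `key` equal to `-1`.
    have := key (-(fderiv ℝ f p v₀ + 1) / fderiv ℝ f p u)
    rw [div_mul_cancel₀ _ hne] at this
    linarith
  have heq : ∀ v, fderiv ℝ f p v = fderiv ℝ f p v₀ * (w * v).im := by
    intro v
    have : (w * (v - (w * v).im • v₀)).im = 0 := by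
      rw [mul_sub, Complex.sub_im, mul_smul_comm, Complex.smul_im, hv₀]
      simp
    have := hker _ this
    rw [map_sub, map_smul, smul_eq_mul] at this
    linarith
  refine ⟨_, fun h0 => h.regular ?_, heq⟩
  exact ContinuousLinearMap.ext fun v => by rw [heq, h0, zero_mul, zero_apply]

end Charts

/-! ### Switching lines: absence of sliding, and the singular tangencies -/

section Boundary

variable {α : ℕ} {c : ℝ}

/-- `w` defines a linear chart at `p` for which both fields are on the same side. -/
structure IsLinearBoundary (α : ℕ) (A B : Fin α × Bool) (w p : ℂ) : Prop where
  ne_zero : w ≠ 0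
  chart : IsSwitchChart (rosetteRegion α) A B (imMul w) p
  field_eq : ∀ c, (w * rosetteField α c A p).im = (w * rosetteField α c B p).im
  -- On a ray this holds vacuously, because the normal component does not vanish there; on an axis
  -- it singles out the point at distance `1`.
  eq_rot : ∀ c, 0 < c → c * Real.cos (Real.pi / α) ≤ Real.sin (Real.pi / α) →
    (w * rosetteField α c A p).im = 0 → ∃ j, p = rosetteRot α j

theorem rayDir_sq_mul_re (z : ℂ) : (rayDir α ^ 2 * z).re = (Real.cos (Real.pi / α) ^ 2 -
    Real.sin (Real.pi / α) ^ 2) * z.re - 2 * Real.sin (Real.pi / α) *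
      Real.cos (Real.pi / α) * z.im := by
  simp only [rayDir, pow_two, Complex.mul_re, Complex.mul_im]
  ring

theorem rayDir_sq_mul_im (z : ℂ) : (rayDir α ^ 2 * z).im = (Real.cos (Real.pi / α) ^ 2 -
    Real.sin (Real.pi / α) ^ 2) * z.im + 2 * Real.sin (Real.pi / α) *
      Real.cos (Real.pi / α) * z.re := by
  simp only [rayDir, pow_two, Complex.mul_re, Complex.mul_im]
  ring

theorem rayDir_inv_sq_mul_re (z : ℂ) : ((rayDir α)⁻¹ ^ 2 * z).re =
    (Real.cos (Real.pi / α) ^ 2 - Real.sin (Real.pi / α) ^ 2) * z.re +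
      2 * Real.sin (Real.pi / α) * Real.cos (Real.pi / α) * z.im := by
  simp only [rayDir_inv, pow_two, Complex.mul_re, Complex.mul_im]
  ring

theorem rayDir_inv_sq_mul_im (z : ℂ) : ((rayDir α)⁻¹ ^ 2 * z).im =
    (Real.cos (Real.pi / α) ^ 2 - Real.sin (Real.pi / α) ^ 2) * z.im -
      2 * Real.sin (Real.pi / α) * Real.cos (Real.pi / α) * z.re := by
  simp only [rayDir_inv, pow_two, Complex.mul_re, Complex.mul_im]
  ring

/-- The horizontal components `± 1` do not enter the normal component, which is `4 c (1 - x)` for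
both fields. -/
theorem isLinearBoundary_axis (hα : 2 ≤ α) (j : Fin α) {p : ℂ}
    (him : ((rosetteRot α j)⁻¹ * p).im = 0) (hre : 0 < ((rosetteRot α j)⁻¹ * p).re) :
    IsLinearBoundary α (j, true) (j, false) (rosetteRot α j)⁻¹ p := by
  have hr := rosetteRot_ne_zero j
  refine ⟨inv_ne_zero hr, isSwitchChart_imMul (by simp) (inv_ne_zero hr) him ?_, ?_, ?_⟩
  · have hopen : ∀ᶠ q in 𝓝 p, (rosetteRot α j)⁻¹ * q ∈ openSector α := by
      refine (isOpen_openSector.preimage (continuous_const_mul _)).mem_nhds ?_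
      change |((rosetteRot α j)⁻¹ * p).im| * _ < _
      rw [him]
      simpa using mul_pos hre (sin_pi_div_pos hα)
    filter_upwards [hopen] with q hq
    constructor
    · change _ ∈ halfSector _ _ ↔ _
      rw [mem_halfSector, and_iff_left hq]
      simp only [halfSign, if_true, one_mul]
    · change _ ∈ halfSector _ _ ↔ _
      rw [mem_halfSector, and_iff_left hq]
      simp only [halfSign, Bool.false_eq_true, if_false, neg_mul, one_mul, Left.neg_pos_iff]
  · intro c
    simp only [rosetteField]
    rw [mul_left_comm, inv_mul_cancel_left₀ hr, mul_left_comm, inv_mul_cancel_left₀ hr]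
    simp
  · intro c hc _ h
    simp only [rosetteField] at h
    rw [mul_left_comm, inv_mul_cancel_left₀ hr] at h
    refine ⟨j, ?_⟩
    have h1 : (rosetteRot α j)⁻¹ * p = 1 := by
      apply Complex.ext
      · simp only [Complex.mul_im, Complex.re_ofNat, Complex.im_ofNat, zero_mul, add_zero] at h
        have : c * (1 - ((rosetteRot α j)⁻¹ * p).re) = 0 := by linarith
        rw [Complex.one_re]
        linarith [(mul_eq_zero.1 this).resolve_left hc.ne']
      · rw [him, Complex.one_im]
    rw [← mul_inv_cancel_left₀ hr p, h1, mul_one]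

/-- Multiplication by `(rayDir α)⁻¹ * (rosetteRot α j)⁻¹` lays the ray on the positive real axis;
the minus sign makes sector `j` the positive side. Reflection in the ray gives both fields the
normal component `4 (sin - c cos (1 - x))`, which is positive by the slope condition, as `x > 0` or
`cos = 0`. -/
theorem isLinearBoundary_ray (hα : 2 ≤ α) {j k : Fin α}
    (hjk : rosetteRot α k = rosetteRot α j * rayDir α ^ 2) {p : ℂ}
    (him : 0 < ((rosetteRot α j)⁻¹ * p).im)
    (heq : ((rosetteRot α j)⁻¹ * p).im * Real.cos (Real.pi / α) =
      ((rosetteRot α j)⁻¹ * p).re * Real.sin (Real.pi / α)) :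
    IsLinearBoundary α (j, true) (k, false) (-((rayDir α)⁻¹ * (rosetteRot α j)⁻¹)) p := by
  have hr := rosetteRot_ne_zero j
  have hd := rayDir_ne_zero (α := α)
  have hs := sin_pi_div_pos hα
  have hsc := Real.sin_sq_add_cos_sq (Real.pi / α)
  have hw : -((rayDir α)⁻¹ * (rosetteRot α j)⁻¹) ≠ 0 :=
    neg_ne_zero.2 (mul_ne_zero (inv_ne_zero hd) (inv_ne_zero hr))
  have hL : ∀ q, (-((rayDir α)⁻¹ * (rosetteRot α j)⁻¹) * q).im =
      Real.sin (Real.pi / α) * ((rosetteRot α j)⁻¹ * q).re -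
        Real.cos (Real.pi / α) * ((rosetteRot α j)⁻¹ * q).im := by
    intro q
    rw [neg_mul, mul_assoc, rayDir_inv, Complex.neg_im, Complex.mul_im]
    ring
  have hk : ∀ q, (rosetteRot α k)⁻¹ * q = (rayDir α)⁻¹ ^ 2 * ((rosetteRot α j)⁻¹ * q) := by
    intro q
    rw [hjk, mul_inv, inv_pow]
    ring
  have hkre : ∀ q, ((rosetteRot α k)⁻¹ * q).re = (Real.cos (Real.pi / α) ^ 2 -
      Real.sin (Real.pi / α) ^ 2) * ((rosetteRot α j)⁻¹ * q).re + 2 * Real.sin (Real.pi / α) *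
        Real.cos (Real.pi / α) * ((rosetteRot α j)⁻¹ * q).im := by
    intro q
    rw [hk, rayDir_inv_sq_mul_re]
  have hkim : ∀ q, ((rosetteRot α k)⁻¹ * q).im = (Real.cos (Real.pi / α) ^ 2 -
      Real.sin (Real.pi / α) ^ 2) * ((rosetteRot α j)⁻¹ * q).im - 2 * Real.sin (Real.pi / α) *
        Real.cos (Real.pi / α) * ((rosetteRot α j)⁻¹ * q).re := by
    intro q
    rw [hk, rayDir_inv_sq_mul_im]
  have hpre : ((rosetteRot α k)⁻¹ * p).re = ((rosetteRot α j)⁻¹ * p).re := by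
    rw [hkre]
    linear_combination (2 * Real.sin (Real.pi / α)) * heq + ((rosetteRot α j)⁻¹ * p).re * hsc
  have hpim : ((rosetteRot α k)⁻¹ * p).im = -((rosetteRot α j)⁻¹ * p).im := by
    rw [hkim]
    linear_combination (2 * Real.cos (Real.pi / α)) * heq - ((rosetteRot α j)⁻¹ * p).im * hsc
  refine ⟨hw, isSwitchChart_imMul (by simp) hw ?_ ?_, ?_, ?_⟩
  · rw [hL]; linarith
  · have h1 : ∀ᶠ q in 𝓝 p, 0 < ((rosetteRot α j)⁻¹ * q).im :=
      (isOpen_lt continuous_const (by fun_prop : Continuous fun q : ℂ =>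
        ((rosetteRot α j)⁻¹ * q).im)).mem_nhds him
    have h2 : ∀ᶠ q in 𝓝 p, ((rosetteRot α k)⁻¹ * q).im < 0 :=
      (isOpen_lt (by fun_prop : Continuous fun q : ℂ =>
        ((rosetteRot α k)⁻¹ * q).im) continuous_const).mem_nhds
          (show ((rosetteRot α k)⁻¹ * p).im < 0 by rw [hpim]; linarith)
    filter_upwards [h1, h2] with q hq1 hq2
    rw [hL]
    constructor
    · change 0 < halfSign _ * ((rosetteRot α j)⁻¹ * q).im ∧
        halfSign _ * ((rosetteRot α j)⁻¹ * q).im * _ < ((rosetteRot α j)⁻¹ * q).re * _ ↔ _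
      simp only [halfSign, if_true, one_mul, hq1, true_and]
      constructor <;> intro h <;> linarith
    · change 0 < halfSign _ * ((rosetteRot α k)⁻¹ * q).im ∧
        halfSign _ * ((rosetteRot α k)⁻¹ * q).im * _ < ((rosetteRot α k)⁻¹ * q).re * _ ↔ _
      have h3 : ((rosetteRot α k)⁻¹ * q).re * Real.sin (Real.pi / α) +
          ((rosetteRot α k)⁻¹ * q).im * Real.cos (Real.pi / α) =
          Real.cos (Real.pi / α) * ((rosetteRot α j)⁻¹ * q).im -
          Real.sin (Real.pi / α) * ((rosetteRot α j)⁻¹ * q).re := by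
        rw [hkre, hkim]
        linear_combination (Real.cos (Real.pi / α) * ((rosetteRot α j)⁻¹ * q).im -
          Real.sin (Real.pi / α) * ((rosetteRot α j)⁻¹ * q).re) * hsc
      simp only [halfSign, Bool.false_eq_true, if_false, neg_mul, one_mul, Left.neg_pos_iff, hq2,
        true_and]
      constructor <;> intro h <;> linarith
  · intro c
    simp only [rosetteField, hpre]
    have e1 : -((rayDir α)⁻¹ * (rosetteRot α j)⁻¹) * (4 * (rosetteRot α j *
        ⟨halfSign true, c * (1 - ((rosetteRot α j)⁻¹ * p).re)⟩)) =
        -(4 * ((rayDir α)⁻¹ * ⟨halfSign true, c * (1 - ((rosetteRot α j)⁻¹ * p).re)⟩)) := by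
      field_simp
    have e2 : -((rayDir α)⁻¹ * (rosetteRot α j)⁻¹) * (4 * (rosetteRot α k *
        ⟨halfSign false, c * (1 - ((rosetteRot α j)⁻¹ * p).re)⟩)) =
        -(4 * (rayDir α * ⟨halfSign false, c * (1 - ((rosetteRot α j)⁻¹ * p).re)⟩)) := by
      rw [hjk]
      field_simp
    rw [e1, e2, rayDir_inv, rayDir]
    simp [halfSign]
  · intro c hc hcs h
    exfalso
    simp only [rosetteField] at h
    rw [hL, mul_left_comm, inv_mul_cancel_left₀ hr] at h
    simp only [Complex.mul_im, Complex.mul_re, Complex.re_ofNat, Complex.im_ofNat, zero_mul,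
      add_zero, sub_zero, halfSign, if_true] at h
    have hx : 0 ≤ ((rosetteRot α j)⁻¹ * p).re := by
      refine nonneg_of_mul_nonneg_left (heq ▸ ?_) hs
      exact mul_nonneg him.le (cos_pi_div_nonneg hα)
    simp only [Complex.mul_re] at h hx heq him
    set x := (rosetteRot α j)⁻¹.re * p.re - (rosetteRot α j)⁻¹.im * p.im
    rcases (cos_pi_div_nonneg hα).eq_or_lt with h0 | h0
    · rw [← h0] at h
      linarith
    · have hx' : 0 < x := by
        refine hx.lt_of_ne fun hx0 => ?_
        rw [← hx0, zero_mul] at heq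
        exact (mul_pos him h0).ne' heq
      have := mul_pos (mul_pos hc h0) hx'
      linarith

theorem exists_isLinearBoundary (hα : 2 ≤ α) {p : ℂ} (hp : ∀ i, p ∉ rosetteRegion α i)
    (hp0 : p ≠ 0) : ∃ A B w, IsLinearBoundary α A B w p := by
  obtain ⟨j, hj⟩ := exists_mem_closedSector hα p
  have hr := rosetteRot_ne_zero j
  have hs := sin_pi_div_pos hα
  have hsc := Real.sin_sq_add_cos_sq (Real.pi / α)
  have hx := re_nonneg_of_mem_closedSector hα hj
  have hle : |((rosetteRot α j)⁻¹ * p).im| * Real.cos (Real.pi / α) ≤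
    ((rosetteRot α j)⁻¹ * p).re * Real.sin (Real.pi / α) := hj
  have hreg : ∀ s, 0 < halfSign s * ((rosetteRot α j)⁻¹ * p).im →
      halfSign s * ((rosetteRot α j)⁻¹ * p).im * Real.cos (Real.pi / α) =
        ((rosetteRot α j)⁻¹ * p).re * Real.sin (Real.pi / α) := by
    intro s h1
    rw [abs_im_of_nonneg h1.le] at hle
    by_contra hne
    exact hp (j, s) ⟨h1, lt_of_le_of_ne hle hne⟩
  rcases lt_trichotomy ((rosetteRot α j)⁻¹ * p).im 0 with him | him | him
  -- The lower ray of sector `j` is the upper ray of its predecessor `k`, so the point is charted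
  -- from there.
  · obtain ⟨k, hk⟩ := exists_rosetteRot_mul_rayDir_sq' hα j
    have heq := hreg false (by simp only [halfSign, Bool.false_eq_true, if_false]; linarith)
    simp only [halfSign, Bool.false_eq_true, if_false] at heq
    have hkp : (rosetteRot α k)⁻¹ * p = rayDir α ^ 2 * ((rosetteRot α j)⁻¹ * p) := by
      rw [hk, mul_inv]
      field_simp [rayDir_ne_zero (α := α)]
    refine ⟨_, _, _, isLinearBoundary_ray hα hk ?_ ?_⟩
    · rw [hkp, rayDir_sq_mul_im]
      linear_combination him + (2 * Real.cos (Real.pi / α)) * heq +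
        ((rosetteRot α j)⁻¹ * p).im * hsc
    · rw [hkp, rayDir_sq_mul_im, rayDir_sq_mul_re]
      linear_combination -heq * (Real.sin (Real.pi / α) ^ 2 + Real.cos (Real.pi / α) ^ 2)
  · refine ⟨_, _, _, isLinearBoundary_axis hα j him (hx.lt_of_ne fun h0 => hp0 ?_)⟩
    have : (rosetteRot α j)⁻¹ * p = 0 := Complex.ext h0.symm him
    simpa [hr] using this
  · obtain ⟨k, hk⟩ := exists_rosetteRot_mul_rayDir_sq hα j
    have heq := hreg true (by simpa [halfSign] using him)
    simp only [halfSign, if_true, one_mul] at heq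
    exact ⟨_, _, _, isLinearBoundary_ray hα hk him heq⟩

/-- The rosette of `2 α` sectors. -/
def rosette (α : ℕ) (hα : 2 ≤ α) (c : ℝ) : NSVF (Fin α × Bool) where
  region := rosetteRegion α
  field := rosetteField α c
  isOpen_region := isOpen_rosetteRegion
  disjoint_region := disjoint_rosetteRegion hα
  finite_corners := by
    refine (finite_singleton (0 : ℂ)).subset ?_
    rintro p ⟨h1, h2⟩
    by_contra hp0
    obtain ⟨A, B, w, h⟩ := exists_isLinearBoundary hα h1 hp0
    exact h2 ⟨A, B, _, h.chart⟩
  smooth_field i := ⟨univ, isOpen_univ, subset_univ _, (contDiff_rosetteField c i).contDiffOn⟩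

theorem isRosette_rosette (hα : 2 ≤ α) : IsRosette α c (rosette α hα c) where
  region_upper j := by
    rw [← halfSector_true]
    rfl
  region_lower j := by
    rw [← halfSector_false]
    rfl
  field_upper j z := by simp [rosette, rosetteField, rosetteX, halfSign]
  field_lower j z := by simp [rosette, rosetteField, rosetteY, halfSign]

theorem exists_isLinearBoundary_of_isSwitchChart (hα : 2 ≤ α) {i j : Fin α × Bool} {f : ℂ → ℝ}
    {p : ℂ} (h : IsSwitchChart (rosetteRegion α) i j f p) :
    ∃ A B w, IsLinearBoundary α A B w p ∧
      ((A = i ∧ B = j) ∨ (A = j ∧ B = i)) := by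
  have hcl : ∀ k, k ≠ i → k ≠ j → p ∉ closure (rosetteRegion α k) := fun k hi hj =>
    h.notMem_closure (isOpen_rosetteRegion k) (disjoint_rosetteRegion hα _ _ hi)
      (disjoint_rosetteRegion hα _ _ hj)
  have hside := h.sides.self_of_nhds
  rw [h.zero] at hside
  have hp : ∀ k, p ∉ rosetteRegion α k := by
    intro k hk
    by_cases hi : k = i
    · subst hi; exact lt_irrefl _ (hside.1.1 hk)
    by_cases hj : k = j
    · subst hj; exact lt_irrefl _ (hside.2.1 hk)
    exact hcl k hi hj (subset_closure hk)
  have hp0 : p ≠ 0 := by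
    rintro rfl
    -- All `2 α ≥ 4` regions accumulate at the origin, and a chart allows only two.
    have hcard : ({i, j} : Finset (Fin α × Bool)).card < Fintype.card (Fin α × Bool) := by
      refine (Finset.card_le_two).trans_lt ?_
      simp only [Fintype.card_prod, Fintype.card_fin, Fintype.card_bool]
      lia
    obtain ⟨k, -, hk⟩ := Finset.exists_mem_notMem_of_card_lt_card hcard
    simp only [Finset.mem_insert, Finset.mem_singleton, not_or] at hk
    exact hcl k hk.1 hk.2 (zero_mem_closure_rosetteRegion hα k)
  obtain ⟨A, B, w, hb⟩ := exists_isLinearBoundary hα hp hp0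
  have hmem : ∀ k, p ∈ closure (rosetteRegion α k) → k = i ∨ k = j := by
    intro k hk
    by_contra! hne
    exact hcl k hne.1 hne.2 hk
  have hz : (w * p).im = 0 := hb.chart.zero
  have hlim : ∀ v : ℂ, Tendsto (fun t : ℝ => p + t • v) (𝓝[>] 0) (𝓝 p) := fun v => by
    have : Continuous fun t : ℝ => p + t • v := by fun_prop
    simpa using (this.tendsto 0).mono_left nhdsWithin_le_nhds
  have hA : p ∈ closure (rosetteRegion α A) := by
    refine mem_closure_of_tendsto (hlim (w⁻¹ * Complex.I)) ?_
    filter_upwards [(hlim (w⁻¹ * Complex.I)).eventually hb.chart.sides, self_mem_nhdsWithin]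
      with t h1 h2
    refine h1.1.2 ?_
    rw [imMul_apply, mul_add, Complex.add_im, hz, mul_smul_comm, mul_inv_cancel_left₀ hb.ne_zero]
    simpa using h2
  have hB : p ∈ closure (rosetteRegion α B) := by
    refine mem_closure_of_tendsto (hlim (w⁻¹ * -Complex.I)) ?_
    filter_upwards [(hlim (w⁻¹ * -Complex.I)).eventually hb.chart.sides, self_mem_nhdsWithin]
      with t h1 h2
    refine h1.2.2 ?_
    rw [imMul_apply, mul_add, Complex.add_im, hz, mul_smul_comm, mul_inv_cancel_left₀ hb.ne_zero]
    simpa using h2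
  refine ⟨A, B, w, hb, ?_⟩
  have hne := hb.chart.ne
  rcases hmem A hA with rfl | rfl <;> rcases hmem B hB with rfl | rfl <;> simp_all

/-- The two Lie derivatives are equal in every chart, so their product is a square and the sliding
condition never holds. -/
theorem exists_lieDer_eq (hα : 2 ≤ α) {i j : Fin α × Bool} {f : ℂ → ℝ} {p : ℂ}
    (h : IsSwitchChart (rosetteRegion α) i j f p) :
    ∃ A B w r, IsLinearBoundary α A B w p ∧ r ≠ 0 ∧
      lieDer (rosetteField α c i) f p = r * (w * rosetteField α c A p).im ∧
      lieDer (rosetteField α c j) f p = r * (w * rosetteField α c A p).im := by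
  obtain ⟨A, B, w, hb, ⟨rfl, rfl⟩ | ⟨rfl, rfl⟩⟩ := exists_isLinearBoundary_of_isSwitchChart hα h
  · obtain ⟨r, hr, hf⟩ := h.fderiv_eq hb.ne_zero hb.chart
    exact ⟨A, B, w, r, hb, hr, hf _, by rw [hb.field_eq]; exact hf _⟩
  · obtain ⟨r, hr, hf⟩ := h.symm.fderiv_eq hb.ne_zero hb.chart
    have hf' : ∀ v, fderiv ℝ f p v = -r * (w * v).im := by
      intro v
      have := hf v
      rw [fderiv_fun_neg, neg_apply] at this
      linarith
    exact ⟨A, B, w, -r, hb, neg_ne_zero.2 hr, by rw [hb.field_eq]; exact hf' _, hf' _⟩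

theorem slidingGraph_rosette (hα : 2 ≤ α) : (rosette α hα c).slidingGraph = ∅ := by
  rw [eq_empty_iff_forall_notMem]
  rintro ⟨p, v⟩ ⟨i, j, f, h, hlt, -⟩
  obtain ⟨A, B, w, r, -, -, h1, h2⟩ := exists_lieDer_eq (c := c) hα h
  change lieDer (rosetteField α c i) f p * lieDer (rosetteField α c j) f p < 0 at hlt
  rw [h1, h2] at hlt
  exact hlt.not_ge (mul_self_nonneg _)

theorem not_isSlidingArc_rosette (hα : 2 ≤ α) {γ : ℝ → ℂ} {a b : ℝ} (hab : a < b) :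
    ¬ (rosette α hα c).IsSlidingArc γ a b := by
  intro h
  obtain ⟨v, hv, -⟩ := h ((a + b) / 2) ⟨by linarith, by linarith⟩
  rw [slidingGraph_rosette, closure_empty] at hv
  exact hv

theorem isSingularTangency_rosette_iff (hα : 2 ≤ α) (hc : 0 < c)
    (hcs : c * Real.cos (Real.pi / α) ≤ Real.sin (Real.pi / α)) {p : ℂ} :
    (rosette α hα c).IsSingularTangency p ↔ ∃ j, p = rosetteRot α j := by
  constructor
  · rintro ⟨i, j, f, h, h0, -⟩
    obtain ⟨A, B, w, r, hb, hr, h1, -⟩ := exists_lieDer_eq (c := c) hα h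
    change lieDer (rosetteField α c i) f p = 0 at h0
    rw [h1] at h0
    exact hb.eq_rot c hc hcs ((mul_eq_zero.1 h0).resolve_left hr)
  · rintro ⟨j, rfl⟩
    have hr := rosetteRot_ne_zero j
    have hb := isLinearBoundary_axis hα j (p := rosetteRot α j)
      (by rw [inv_mul_cancel₀ hr, Complex.one_im]) (by rw [inv_mul_cancel₀ hr]; simp)
    have hlie : ∀ s, lieDer (rosetteField α c (j, s)) (imMul (rosetteRot α j)⁻¹) =
        fun q => 4 * (c * (1 - ((rosetteRot α j)⁻¹ * q).re)) := by
      intro s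
      funext q
      rw [lieDer, ContinuousLinearMap.fderiv, imMul_apply, rosetteField, mul_left_comm,
        inv_mul_cancel_left₀ hr, Complex.mul_im]
      simp
    have hder : ∀ q : ℂ, HasFDerivAt (fun q => 4 * (c * (1 - ((rosetteRot α j)⁻¹ * q).re)))
        (-(4 * c) • Complex.reCLM.comp (ContinuousLinearMap.mul ℝ ℂ (rosetteRot α j)⁻¹)) q := by
      intro q
      have h := (Complex.reCLM.comp
        (ContinuousLinearMap.mul ℝ ℂ (rosetteRot α j)⁻¹)).hasFDerivAt (x := q)
      refine (((h.const_sub 1).const_mul c).const_mul 4).congr_fderiv ?_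
      rw [smul_neg, smul_neg, smul_smul]
      exact (neg_smul _ _).symm
    have hlie2 : ∀ s, lieDer (rosetteField α c (j, s))
        (lieDer (rosetteField α c (j, s)) (imMul (rosetteRot α j)⁻¹)) (rosetteRot α j) =
        -(16 * c) * halfSign s := by
      intro s
      rw [hlie, lieDer, (hder _).fderiv]
      simp only [smul_apply, ContinuousLinearMap.comp_apply,
        ContinuousLinearMap.mul_apply', Complex.reCLM_apply, smul_eq_mul, rosetteField]
      rw [mul_left_comm _ (4 : ℂ), inv_mul_cancel_left₀ hr, Complex.mul_re]
      simp
      ring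
    refine ⟨(j, true), (j, false), _, hb.chart, ?_, ?_, ?_, ?_⟩
    · change lieDer (rosetteField α c (j, true)) _ _ = 0
      rw [hlie]
      simp [inv_mul_cancel₀ hr]
    · change lieDer (rosetteField α c (j, true)) (lieDer (rosetteField α c (j, true)) _) _ < 0
      rw [hlie2]
      simp only [halfSign, if_true]
      linarith
    · change lieDer (rosetteField α c (j, false)) _ _ = 0
      rw [hlie]
      simp [inv_mul_cancel₀ hr]
    · change 0 < lieDer (rosetteField α c (j, false)) (lieDer (rosetteField α c (j, false)) _) _
      rw [hlie2]
      simp only [halfSign, Bool.false_eq_true, if_false]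
      linarith

end Boundary

/-- The conditions on the parameters under which the rosette has no sliding. -/
structure RosetteParams (α : ℕ) (c : ℝ) : Prop where
  two_le : 2 ≤ α
  pos : 0 < c
  slope : c * Real.cos (Real.pi / α) ≤ Real.sin (Real.pi / α)

/-! ### The first integral and its level curves -/

section Energy

variable {α : ℕ} {c : ℝ}

/-- The first coordinate after folding the rosette to the sector `|arg z| ≤ π / α`. -/
def foldRe (α : ℕ) (z : ℂ) : ℝ := ⨆ j : Fin α, ((rosetteRot α j)⁻¹ * z).re

theorem foldRe_eq (hα : 2 ≤ α) {j : Fin α} {z : ℂ}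
    (hz : (rosetteRot α j)⁻¹ * z ∈ closedSector α) :
    foldRe α z = ((rosetteRot α j)⁻¹ * z).re := by
  have : Nonempty (Fin α) := ⟨j⟩
  exact le_antisymm (ciSup_le fun k => re_le_of_mem_closedSector hα k hz)
    (le_ciSup (f := fun k => ((rosetteRot α k)⁻¹ * z).re) (Set.finite_range _).bddAbove j)

theorem continuous_foldRe (hα : 2 ≤ α) : Continuous (foldRe α) := by
  have : Nonempty (Fin α) := ⟨⟨0, by lia⟩⟩
  have h : foldRe α = fun z => Finset.univ.sup' Finset.univ_nonempty
      fun j : Fin α => ((rosetteRot α j)⁻¹ * z).re := by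
    funext z
    rw [Finset.sup'_univ_eq_ciSup]
    rfl
  rw [h]
  exact Continuous.finset_sup'_apply _ fun j _ => by fun_prop

/-- A global first integral of the rosette. -/
def rosetteEnergy (α : ℕ) (c : ℝ) (z : ℂ) : ℝ :=
  √(‖z‖ ^ 2 - foldRe α z ^ 2) - c * (foldRe α z - foldRe α z ^ 2 / 2)

/-- The formula through `‖z‖` and `foldRe` involves no choice of sector, so there is nothing to glue
along the switching lines. -/
theorem continuous_rosetteEnergy (hα : 2 ≤ α) : Continuous (rosetteEnergy α c) := by
  have := continuous_foldRe hα
  unfold rosetteEnergy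
  fun_prop

theorem rosetteEnergy_eq (hα : 2 ≤ α) {j : Fin α} {z : ℂ}
    (hz : (rosetteRot α j)⁻¹ * z ∈ closedSector α) :
    rosetteEnergy α c z = |((rosetteRot α j)⁻¹ * z).im| -
      c * (((rosetteRot α j)⁻¹ * z).re - ((rosetteRot α j)⁻¹ * z).re ^ 2 / 2) := by
  have hn : ‖z‖ = ‖(rosetteRot α j)⁻¹ * z‖ := by simp [norm_rosetteRot]
  rw [rosetteEnergy, foldRe_eq hα hz, hn, Complex.sq_norm, Complex.normSq_apply]
  congr 1
  rw [← Real.sqrt_sq_eq_abs]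
  congr 1
  ring

/-- The level curve of energy `c (b² / 2 - b)` in the sector, parametrized by the time. -/
def profile (c b u : ℝ) : ℂ := ⟨b - 4 * |u|, -4 * c * u * (b - 1 - 2 * |u|)⟩

theorem continuous_profile (c : ℝ) : Continuous fun q : ℝ × ℝ => profile c q.1 q.2 := by
  have h : (fun q : ℝ × ℝ => profile c q.1 q.2) = fun q => ((q.1 - 4 * |q.2| : ℝ) : ℂ) +
      ((-4 * c * q.2 * (q.1 - 1 - 2 * |q.2|) : ℝ) : ℂ) * Complex.I := by
    funext q
    rw [profile, Complex.mk_eq_add_mul_I]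
  rw [h]
  fun_prop

/-- Since `|w.im| ≥ 0`, completing the square in the energy gives `(w.re - 1)² ≤ (b - 1)²`. -/
theorem re_le_of_energy_eq (hc : 0 < c) {b : ℝ} (hb : 1 ≤ b) {w : ℂ}
    (hw : |w.im| - c * (w.re - w.re ^ 2 / 2) = c * (b ^ 2 / 2 - b)) :
    |w.re - 1| ≤ b - 1 := by
  have h1 : 0 ≤ c / 2 * ((b - 1) ^ 2 - (w.re - 1) ^ 2) := by
    have := abs_nonneg w.im
    linear_combination this + hw
  have h2 := nonneg_of_mul_nonneg_right h1 (by linarith)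
  exact abs_le_of_sq_le_sq (by linarith) (by linarith)

/-- The energy determines `|w.im|` from `w.re`, and `s` fixes the sign. The time is `(b - w.re) / 4`
in absolute value because the horizontal speed is `4`, and negative on the upper half, which is run
through before the turning point. -/
theorem eq_profile (hc : 0 < c) {b : ℝ} (hb : 1 ≤ b) {w : ℂ} {s : Bool}
    (hs : 0 ≤ halfSign s * w.im)
    (hw : |w.im| - c * (w.re - w.re ^ 2 / 2) = c * (b ^ 2 / 2 - b)) :
    w = profile c b (-(halfSign s * (b - w.re) / 4)) := by
  have hre := (abs_le.1 (re_le_of_energy_eq hc hb hw)).2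
  have habs : |-(halfSign s * (b - w.re) / 4)| = (b - w.re) / 4 := by
    have : |(b - w.re) / 4| = (b - w.re) / 4 := abs_of_nonneg (by linarith)
    have hs1 : |halfSign s| = 1 := by cases s <;> simp [halfSign]
    rw [abs_neg, mul_div_assoc, abs_mul, hs1, one_mul, this]
  rw [abs_im_of_nonneg hs] at hw
  have hsq := halfSign_sq s
  apply Complex.ext
  · simp only [profile, habs]
    ring
  · simp only [profile, habs]
    linear_combination halfSign s * hw - w.im * hsq

theorem abs_profile_im {b u : ℝ} (hc : 0 < c) (h : 0 ≤ b - 1 - 2 * |u|) :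
    |(profile c b u).im| = 4 * c * |u| * (b - 1 - 2 * |u|) := by
  simp only [profile]
  rw [abs_mul, abs_of_nonneg h, abs_mul, abs_mul, abs_of_pos hc]
  norm_num

/-- `T` is the time that a solution of energy `c (b² / 2 - b)` spends in one sector. -/
structure IsPeriod (α : ℕ) (c b T : ℝ) : Prop where
  one_lt : 1 < b
  pos : 0 < T
  le_half : T ≤ b / 2
  le_sub_one : T ≤ b - 1
  -- The period can be short only for small loops around a tangency, where `T = b - 1`.
  half_le : 1 / 2 ≤ T ∨ T = b - 1
  mem_openSector : ∀ u, |u| < T / 2 → profile c b u ∈ openSector α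
  le_re : ∀ w ∈ closedSector α, |w.im| - c * (w.re - w.re ^ 2 / 2) = c * (b ^ 2 / 2 - b) →
    b - 2 * T ≤ w.re
  eq_of_lt : b < 2 → T = b - 1
  eq_of_eq : b = 2 → T = 1
  of_gt : 2 < b → ∃ r : ℝ, 0 < r ∧ profile c b (T / 2) = r * (rayDir α)⁻¹ ∧
    profile c b (-(T / 2)) = r * rayDir α

theorem profile_re {b u : ℝ} : (profile c b u).re = b - 4 * |u| := rfl

/-- Here `a` is the abscissa at which the level curve leaves the sector or closes up. With `x = b -
4 |u|`, the slack in the sector inequality is its value at `a`, nonnegative by `hg`, plus `(x - a)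
(k / 2 (x + a) + s - k)`, which is positive for `x > a` by the slope condition. -/
theorem profile_mem_openSector_of (h : RosetteParams α c) {a b : ℝ} (ha : 0 ≤ a) (hab : 2 ≤ a + b)
    (hg : 0 ≤ a * Real.sin (Real.pi / α) - c * Real.cos (Real.pi / α) *
      (b * (b - 2) - a * (a - 2)) / 2) {u : ℝ} (hu : |u| < (b - a) / 4) :
    profile c b u ∈ openSector α := by
  have hu0 := abs_nonneg u
  change |(profile c b u).im| * _ < (profile c b u).re * _
  rw [abs_profile_im h.pos (by linarith), profile_re]
  have hs := sin_pi_div_pos h.two_le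
  have hk := mul_nonneg h.pos.le (cos_pi_div_nonneg h.two_le)
  have hsl := h.slope
  set s := Real.sin (Real.pi / α)
  set k := c * Real.cos (Real.pi / α) with hkdef
  have hpos : 0 < k / 2 * (b - 4 * |u| + a) + (s - k) := by
    rcases hk.eq_or_lt with h0 | h0
    · rw [← h0]; linarith
    · have : 0 < k * (b - 4 * |u| + a) := mul_pos h0 (by linarith)
      linarith
  have := mul_pos (show 0 < b - 4 * |u| - a by linarith) hpos
  rw [← sub_pos]
  have e : (b - 4 * |u|) * s - 4 * c * |u| * (b - 1 - 2 * |u|) * Real.cos (Real.pi / α) =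
      (b - 4 * |u| - a) * (k / 2 * (b - 4 * |u| + a) + (s - k)) +
        (a * s - k * (b * (b - 2) - a * (a - 2)) / 2) := by
    rw [hkdef]; ring
  rw [e]
  linarith

/-- In all cases `T = (b - a) / 2`, where `a` is the smallest abscissa on the level curve within the
sector: `2 - b` if `b < 2`, `0` if `b = 2`, and the abscissa of the intersection with the bounding
rays if `b > 2`. -/
theorem exists_isPeriod (h : RosetteParams α c) {b : ℝ} (hb : 1 < b) :
    ∃ T, IsPeriod α c b T := by
  have hs := sin_pi_div_pos h.two_le
  have hct := cos_pi_div_nonneg h.two_le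
  have hk := mul_nonneg h.pos.le hct
  rcases lt_trichotomy b 2 with h2 | h2 | h2
  · refine ⟨b - 1, hb, by linarith, by linarith, le_rfl, Or.inr rfl, fun u hu => ?_,
      fun w _ hw => ?_, fun _ => rfl, fun h2' => by linarith, fun h2' => by linarith⟩
    · refine profile_mem_openSector_of h (a := 2 - b) (by linarith) (by linarith) ?_
        (by linarith)
      have := mul_nonneg (show 0 ≤ 2 - b by linarith) hs.le
      have e : b * (b - 2) - (2 - b) * (2 - b - 2) = 0 := by ring
      rw [e]
      linarith
    · linarith [(abs_le.1 (re_le_of_energy_eq h.pos hb.le hw)).1]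
  · subst h2
    refine ⟨1, by norm_num, by norm_num, by norm_num, by norm_num, Or.inl (by norm_num),
      fun u hu => ?_, fun w hw _ => ?_, fun h2' => by linarith, fun _ => rfl,
      fun h2' => by linarith⟩
    · exact profile_mem_openSector_of h (a := 0) le_rfl (by norm_num) (by norm_num)
        (by linarith)
    · linarith [re_nonneg_of_mem_closedSector h.two_le hw]
  · set s := Real.sin (Real.pi / α) with hsdef
    set k := c * Real.cos (Real.pi / α) with hkdef
    have hsl : k ≤ s := h.slope
    set g : ℝ → ℝ := fun x => x * s - k * (b * (b - 2) - x * (x - 2)) / 2 with hg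
    have hg0 : g 0 ≤ 0 := by
      have := mul_nonneg hk (mul_nonneg (show 0 ≤ b by linarith) (show 0 ≤ b - 2 by linarith))
      simp only [hg]
      linarith
    have hg1 : 0 ≤ g (b - 1) := by
      have := mul_nonneg (sub_nonneg.2 hsl) (show 0 ≤ b - 1 by linarith)
      simp only [hg]
      linear_combination this + hk / 2
    -- A root of `g` is where the level curve meets the rays. Searching only up to `b - 1` yields `T
    -- ≥ 1 / 2` at once.
    obtain ⟨a, ⟨ha0, ha1⟩, hga⟩ : ∃ a ∈ Icc 0 (b - 1), g a = 0 :=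
      intermediate_value_Icc (by linarith) (by fun_prop : Continuous g).continuousOn ⟨hg0, hg1⟩
    have hga' : a * s - k * (b * (b - 2) - a * (a - 2)) / 2 = 0 := hga
    refine ⟨(b - a) / 2, hb, by linarith, by linarith, by linarith, Or.inl (by linarith),
      fun u hu => ?_, fun w hw he => ?_, fun h2' => by linarith, fun h2' => by linarith,
      fun _ => ?_⟩
    · exact profile_mem_openSector_of h ha0 (by linarith) hga'.ge (by linarith)
    · by_contra! hlt
      have hre := re_nonneg_of_mem_closedSector h.two_le hw
      have hwm : |w.im| * Real.cos (Real.pi / α) ≤ w.re * s := hw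
      have hpos : 0 < k / 2 * (w.re + a) + (s - k) := by
        rcases hk.eq_or_lt with h0 | h0
        · rw [← h0]; linarith
        · have : 0 < k * (w.re + a) := mul_pos h0 (by linarith)
          linarith
      have := mul_pos (show 0 < a - w.re by linarith) hpos
      have e : |w.im| * Real.cos (Real.pi / α) = k * (b * (b - 2) - w.re * (w.re - 2)) / 2 := by
        rw [hkdef]
        linear_combination Real.cos (Real.pi / α) * he
      linarith
    -- This product is the absolute value of the imaginary part at the end of the cell; divided by
    -- the sine it is the distance from the origin along the ray.
    · have hr : 0 < c * (b - a) * ((a + b) / 2 - 1) :=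
        mul_pos (mul_pos h.pos (by linarith)) (by linarith)
      have habs : |(b - a) / 2 / 2| = (b - a) / 4 := by rw [abs_of_pos (by linarith)]; ring
      have hre : c * (b - a) * ((a + b) / 2 - 1) * Real.cos (Real.pi / α) = a * s := by
        rw [hkdef] at hga'
        linear_combination -hga'
      refine ⟨c * (b - a) * ((a + b) / 2 - 1) / s, div_pos hr hs, ?_, ?_⟩
      · rw [rayDir_inv]
        apply Complex.ext
        · rw [profile, Complex.re_ofReal_mul, habs]
          change _ = _ / s * Real.cos _
          rw [div_mul_eq_mul_div, hre]
          field_simp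
          ring
        · rw [profile, Complex.im_ofReal_mul, habs]
          change _ = _ / s * -s
          field_simp
          ring
      · rw [rayDir]
        apply Complex.ext
        · rw [profile, Complex.re_ofReal_mul, abs_neg, habs]
          change _ = _ / s * Real.cos _
          rw [div_mul_eq_mul_div, hre]
          field_simp
          ring
        · rw [profile, Complex.im_ofReal_mul, abs_neg, habs]
          change _ = _ / s * s
          field_simp
          ring

variable {b T : ℝ}

theorem IsPeriod.profile_inj (hT : IsPeriod α c b T) (hc : 0 < c) {u v : ℝ} (hu : |u| < T / 2)
    (h : profile c b u = profile c b v) : u = v := by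
  have h1 : b - 4 * |u| = b - 4 * |v| := congrArg Complex.re h
  have h2 : -4 * c * u * (b - 1 - 2 * |u|) = -4 * c * v * (b - 1 - 2 * |v|) :=
    congrArg Complex.im h
  have h3 : |v| = |u| := by linarith
  rw [h3] at h2
  have h4 : 0 < c * (b - 1 - 2 * |u|) := mul_pos hc (by linarith [hT.le_sub_one])
  have h5 : (u - v) * (c * (b - 1 - 2 * |u|)) = 0 := by linarith
  linarith [(mul_eq_zero.1 h5).resolve_right h4.ne']

theorem IsPeriod.mem_closedSector (hT : IsPeriod α c b T) {u : ℝ} (hu : |u| ≤ T / 2) :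
    profile c b u ∈ closedSector α := by
  have hcont : Continuous (profile c b) :=
    (continuous_profile c).comp (continuous_const.prodMk continuous_id)
  have hpos := hT.pos
  have hsub : Icc (-(T / 2)) (T / 2) ⊆ profile c b ⁻¹' closedSector α := by
    rw [← closure_Ioo (by linarith)]
    refine closure_minimal (fun v hv => ?_) (isClosed_closedSector.preimage hcont)
    exact openSector_subset_closedSector (hT.mem_openSector v (abs_lt.2 hv))
  exact hsub (abs_le.1 hu)

theorem IsPeriod.foldRe_eq (hT : IsPeriod α c b T) (hα : 2 ≤ α) (j : Fin α) {u : ℝ}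
    (hu : |u| ≤ T / 2) : foldRe α (rosetteRot α j * profile c b u) = b - 4 * |u| := by
  have h := inv_mul_cancel_left₀ (rosetteRot_ne_zero j) (profile c b u)
  rw [_root_.foldRe_eq (j := j) hα (by rw [h]; exact hT.mem_closedSector hu), h]
  rfl

end Energy

/-! ### Every trajectory is a sequence of cells on one level curve -/

section Motion

variable {α : ℕ} {c : ℝ}

theorem eq_add_mul_of_hasDerivAt {f : ℝ → ℝ} {a b k : ℝ} (hf : ContinuousOn f (Icc a b))
    (hd : ∀ t ∈ Ioo a b, HasDerivAt f k t) {t : ℝ} (ht : t ∈ Icc a b) :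
    f t = f a + k * (t - a) := by
  rcases ht.1.eq_or_lt with rfl | hat
  · simp
  obtain ⟨x, -, hx⟩ := exists_hasDerivAt_eq_slope f (fun _ => k) hat
    (hf.mono (Icc_subset_Icc_right ht.2)) fun x hx => hd x ⟨hx.1, hx.2.trans_le ht.2⟩
  rw [hx, div_mul_cancel₀ _ (by linarith)]
  ring

theorem NSVF.IsRegionArc.mono {ι : Type} {Z : NSVF ι} {i : ι} {γ : ℝ → ℂ} {a b a' b' : ℝ}
    (h : Z.IsRegionArc i γ a b) (ha : a ≤ a') (hb : b' ≤ b) : Z.IsRegionArc i γ a' b' :=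
  ⟨fun t ht => h.1 t ⟨ha.trans ht.1, ht.2.trans hb⟩,
    fun t ht => h.2 t ⟨ha.trans_lt ht.1, ht.2.trans_le hb⟩⟩

section Arc

variable {hα : 2 ≤ α} {i : Fin α × Bool} {γ : ℝ → ℂ} {t₁ t₂ : ℝ}

theorem mem_closure_of_isRegionArc (h : (rosette α hα c).IsRegionArc i γ t₁ t₂) {t : ℝ}
    (ht : t ∈ Icc t₁ t₂) : 0 ≤ halfSign i.2 * ((rosetteRot α i.1)⁻¹ * γ t).im ∧
      (rosetteRot α i.1)⁻¹ * γ t ∈ closedSector α := by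
  have := h.1 t ht
  change γ t ∈ closure (rosetteRegion α i) at this
  rwa [closure_rosetteRegion hα] at this

theorem hasDerivAt_of_isRegionArc (h : (rosette α hα c).IsRegionArc i γ t₁ t₂) {t : ℝ}
    (ht : t ∈ Ioo t₁ t₂) :
    HasDerivAt (fun t => ((rosetteRot α i.1)⁻¹ * γ t).re) (4 * halfSign i.2) t ∧
    HasDerivAt (fun t => ((rosetteRot α i.1)⁻¹ * γ t).im)
      (4 * (c * (1 - ((rosetteRot α i.1)⁻¹ * γ t).re))) t := by
  have hd := (h.2 t ht).const_mul (rosetteRot α i.1)⁻¹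
  change HasDerivAt _ ((rosetteRot α i.1)⁻¹ * rosetteField α c i (γ t)) t at hd
  rw [rosetteField, mul_left_comm, inv_mul_cancel_left₀ (rosetteRot_ne_zero _)] at hd
  have hre := Complex.reCLM.hasFDerivAt.comp_hasDerivAt t hd
  have him := Complex.imCLM.hasFDerivAt.comp_hasDerivAt t hd
  constructor
  · refine hre.congr_deriv ?_
    rw [Complex.reCLM_apply, Complex.mul_re]
    simp
  · refine him.congr_deriv ?_
    rw [Complex.imCLM_apply, Complex.mul_im]
    simp

theorem rosetteEnergy_const_of_isRegionArc (hγ : Continuous γ)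
    (h : (rosette α hα c).IsRegionArc i γ t₁ t₂) {t : ℝ} (ht : t ∈ Icc t₁ t₂) :
    rosetteEnergy α c (γ t) = rosetteEnergy α c (γ t₁) := by
  have h12 : t₁ ≤ t₂ := ht.1.trans ht.2
  have key : ∀ t ∈ Icc t₁ t₂, rosetteEnergy α c (γ t) =
      halfSign i.2 * ((rosetteRot α i.1)⁻¹ * γ t).im -
        c * (((rosetteRot α i.1)⁻¹ * γ t).re - ((rosetteRot α i.1)⁻¹ * γ t).re ^ 2 / 2) := by
    intro t ht
    obtain ⟨h1, h2⟩ := mem_closure_of_isRegionArc h ht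
    rw [rosetteEnergy_eq hα h2, abs_im_of_nonneg h1]
  rw [key t ht, key t₁ ⟨le_rfl, h12⟩]
  have := eq_add_mul_of_hasDerivAt (k := 0) (f := fun t =>
    halfSign i.2 * ((rosetteRot α i.1)⁻¹ * γ t).im -
      c * (((rosetteRot α i.1)⁻¹ * γ t).re - ((rosetteRot α i.1)⁻¹ * γ t).re ^ 2 / 2))
    (a := t₁) (b := t₂) (by fun_prop) (fun t ht => ?_) ht
  · simpa using this
  · obtain ⟨hre, him⟩ := hasDerivAt_of_isRegionArc h ht
    refine ((him.const_mul (halfSign i.2)).sub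
      ((hre.sub ((hre.pow 2).div_const 2)).const_mul c)).congr_deriv ?_
    push_cast
    ring

/-- The abscissa moves with constant velocity `± 4` and so serves as a clock; `β` is the time at
which it would reach the turning value `b`. The bound `T / 2` is the lower bound `le_re` for the
abscissa in the sector. -/
theorem exists_eq_profile_of_isRegionArc {b T : ℝ} (hc : 0 < c) (hT : IsPeriod α c b T)
    (hγ : Continuous γ) (hE : ∀ t, rosetteEnergy α c (γ t) = c * (b ^ 2 / 2 - b))
    (h : (rosette α hα c).IsRegionArc i γ t₁ t₂) :
    ∃ β, ∀ t ∈ Icc t₁ t₂, |t - β| ≤ T / 2 ∧ γ t = rosetteRot α i.1 * profile c b (t - β) := by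
  refine ⟨t₁ + halfSign i.2 * (b - ((rosetteRot α i.1)⁻¹ * γ t₁).re) / 4, fun t ht => ?_⟩
  obtain ⟨h1, h2⟩ := mem_closure_of_isRegionArc h ht
  have he := hE t
  rw [rosetteEnergy_eq hα h2] at he
  have hre := eq_add_mul_of_hasDerivAt (f := fun t => ((rosetteRot α i.1)⁻¹ * γ t).re)
    (by fun_prop) (fun t ht => (hasDerivAt_of_isRegionArc h ht).1) ht
  have hu : t - (t₁ + halfSign i.2 * (b - ((rosetteRot α i.1)⁻¹ * γ t₁).re) / 4) =
      -(halfSign i.2 * (b - ((rosetteRot α i.1)⁻¹ * γ t).re) / 4) := by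
    rw [hre]
    linear_combination -(t - t₁) * halfSign_sq i.2
  have hp := eq_profile hc hT.one_lt.le h1 he
  rw [← hu] at hp
  constructor
  · have h3 := hT.le_re _ h2 he
    rw [hp, profile_re] at h3
    linarith
  · rw [← hp, mul_inv_cancel_left₀ (rosetteRot_ne_zero _)]

end Arc

/-- Near each time, `γ` follows region arcs on both sides, and its energy is `c (b² / 2 - b)`. -/
structure IsLevelMotion (α : ℕ) (hα : 2 ≤ α) (c b : ℝ) (γ : ℝ → ℂ) : Prop where
  continuous : Continuous γ
  energy : ∀ t, rosetteEnergy α c (γ t) = c * (b ^ 2 / 2 - b)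
  right : ∀ t, ∃ δ > 0, ∃ i, (rosette α hα c).IsRegionArc i γ t (t + δ)
  left : ∀ t, ∃ δ > 0, ∃ i, (rosette α hα c).IsRegionArc i γ (t - δ) t

/-- On the interval of length `T` centred at `β`, `γ` runs through the level curve in sector
`j`. -/
def IsCell (α : ℕ) (c b T : ℝ) (γ : ℝ → ℂ) (j : Fin α) (β : ℝ) : Prop :=
  ∀ t, |t - β| ≤ T / 2 → γ t = rosetteRot α j * profile c b (t - β)

namespace IsLevelMotion

variable {hα : 2 ≤ α} {b T : ℝ} {γ : ℝ → ℂ}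

/-- Open-closed argument on the interior of the cell. The set of times at which the formula holds is
closed. At such an interior time the point lies in the open sector, so the arcs on both sides stay
in that sector, and injectivity of the profile forces their phases to be `β`. -/
theorem isCell (hγ : IsLevelMotion α hα c b γ) (hc : 0 < c) (hT : IsPeriod α c b T)
    {j : Fin α} {β t₀ : ℝ} (ht₀ : |t₀ - β| < T / 2)
    (h₀ : γ t₀ = rosetteRot α j * profile c b (t₀ - β)) : IsCell α c b T γ j β := by
  set A : Set ℝ := {t | γ t = rosetteRot α j * profile c b (t - β)} with hA
  have hcont : Continuous fun t => profile c b (t - β) :=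
    (continuous_profile c).comp (continuous_const.prodMk (continuous_id.sub continuous_const))
  have hAc : IsClosed A := isClosed_eq hγ.continuous (continuous_const.mul hcont)
  have hopen : ∀ t ∈ A, |t - β| < T / 2 → A ∈ 𝓝 t := by
    intro t ht htβ
    have hint : (rosetteRot α j)⁻¹ * γ t ∈ openSector α := by
      rw [show γ t = _ from ht, inv_mul_cancel_left₀ (rosetteRot_ne_zero j)]
      exact hT.mem_openSector _ htβ
    have harc : ∀ i t₁ t₂, (rosette α hα c).IsRegionArc i γ t₁ t₂ → t ∈ Icc t₁ t₂ →
        Icc t₁ t₂ ⊆ A := by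
      intro i t₁ t₂ h htI
      obtain ⟨β', hβ'⟩ := exists_eq_profile_of_isRegionArc hc hT hγ.continuous hγ.energy h
      obtain ⟨i, s⟩ := i
      obtain rfl : j = i := eq_of_mem_openSector_of_mem_closedSector hα hint
        (mem_closure_of_isRegionArc h htI).2
      have h1 := (hβ' t htI).2
      rw [show γ t = _ from ht] at h1
      have h2 := hT.profile_inj hc htβ (mul_left_cancel₀ (rosetteRot_ne_zero j) h1)
      obtain rfl : β = β' := by linarith
      exact fun x hx => (hβ' x hx).2
    obtain ⟨δ, hδ, i, hi⟩ := hγ.right t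
    obtain ⟨δ', hδ', i', hi'⟩ := hγ.left t
    refine mem_of_superset (Icc_mem_nhds (a := t - δ') (b := t + δ) (by linarith) (by linarith)) ?_
    rw [← Icc_union_Icc_eq_Icc (b := t) (by linarith) (by linarith)]
    exact union_subset (harc _ _ _ hi' ⟨by linarith, le_rfl⟩)
      (harc _ _ _ hi ⟨le_rfl, by linarith⟩)
  have hIoo : Ioo (β - T / 2) (β + T / 2) ⊆ interior A := by
    have hmem : ∀ t ∈ Ioo (β - T / 2) (β + T / 2), t ∈ A → t ∈ interior A := fun t ht htA =>
      mem_interior_iff_mem_nhds.2 (hopen t htA (abs_lt.2 ⟨by linarith [ht.1], by linarith [ht.2]⟩))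
    obtain ⟨h1, h2⟩ := abs_lt.1 ht₀
    have ht₀' : t₀ ∈ Ioo (β - T / 2) (β + T / 2) := ⟨by linarith, by linarith⟩
    refine isPreconnected_Ioo.subset_of_closure_inter_subset isOpen_interior
      ⟨t₀, ht₀', hmem _ ht₀' h₀⟩ ?_
    rintro t ⟨ht1, ht2⟩
    exact hmem t ht2 (closure_minimal interior_subset hAc ht1)
  intro t ht
  obtain ⟨h1, h2⟩ := abs_le.1 ht
  have hpos := hT.pos
  have : t ∈ closure (Ioo (β - T / 2) (β + T / 2)) := by
    rw [closure_Ioo (by linarith)]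
    exact ⟨by linarith, by linarith⟩
  exact closure_minimal (hIoo.trans interior_subset) hAc this

theorem exists_isCell_of_arc (hγ : IsLevelMotion α hα c b γ) (hc : 0 < c)
    (hT : IsPeriod α c b T) {i : Fin α × Bool} {t₁ t₂ : ℝ} (h12 : t₁ < t₂)
    (h : (rosette α hα c).IsRegionArc i γ t₁ t₂) :
    ∃ j β, β - T / 2 ≤ t₁ ∧ t₂ ≤ β + T / 2 ∧ IsCell α c b T γ j β := by
  obtain ⟨β, hβ⟩ := exists_eq_profile_of_isRegionArc hc hT hγ.continuous hγ.energy h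
  have h1 := abs_le.1 (hβ t₁ ⟨le_rfl, h12.le⟩).1
  have h2 := abs_le.1 (hβ t₂ ⟨h12.le, le_rfl⟩).1
  -- The ends of the arc may be ends of the cell; the midpoint is strictly inside.
  refine ⟨i.1, β, by linarith, by linarith, hγ.isCell hc hT (t₀ := (t₁ + t₂) / 2) ?_ ?_⟩
  · exact abs_lt.2 ⟨by linarith, by linarith⟩
  · exact (hβ _ ⟨by linarith, by linarith⟩).2

theorem exists_isCell (hγ : IsLevelMotion α hα c b γ) (hc : 0 < c) (hT : IsPeriod α c b T)
    (t : ℝ) : ∃ j β, |t - β| ≤ T / 2 ∧ IsCell α c b T γ j β := by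
  obtain ⟨δ, hδ, i, hi⟩ := hγ.right t
  obtain ⟨j, β, h1, h2, h3⟩ := hγ.exists_isCell_of_arc hc hT (by linarith) hi
  exact ⟨j, β, abs_le.2 ⟨by linarith, by linarith⟩, h3⟩

/-- The folded abscissa is `b - 4 |t - β|` in whichever sector the point is described, so it reads
off the distance to the centre of the cell. -/
theorem abs_sub_eq (hT : IsPeriod α c b T) (hα : 2 ≤ α) {j k : Fin α} {β β' t : ℝ}
    (h : IsCell α c b T γ j β) (h' : IsCell α c b T γ k β')
    (ht : |t - β| ≤ T / 2) (ht' : |t - β'| ≤ T / 2) : |t - β| = |t - β'| := by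
  have h1 := hT.foldRe_eq hα j ht
  have h2 := hT.foldRe_eq hα k ht'
  rw [← h t ht] at h1
  rw [← h' t ht'] at h2
  linarith

theorem exists_isCell_add (hγ : IsLevelMotion α hα c b γ) (hc : 0 < c) (hT : IsPeriod α c b T)
    {j : Fin α} {β : ℝ} (h : IsCell α c b T γ j β) : ∃ k, IsCell α c b T γ k (β + T) := by
  have hpos := hT.pos
  obtain ⟨δ, hδ, i, hi⟩ := hγ.right (β + T / 2)
  obtain ⟨k, β', h1, h2, h3⟩ := hγ.exists_isCell_of_arc hc hT (by linarith) hi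
  have h4 := abs_sub_eq hT hα h h3 (t := β + T / 2) (by rw [abs_le]; constructor <;> linarith)
    (by rw [abs_le]; constructor <;> linarith)
  rw [show β + T / 2 - β = T / 2 by ring, abs_of_pos (by linarith)] at h4
  -- The new centre is `β` or `β + T`; the first is impossible because the cell of the departing arc
  -- extends beyond `β + T / 2`.
  rcases eq_or_eq_neg_of_abs_eq h4.symm with h5 | h5
  · linarith
  · obtain rfl : β' = β + T := by linarith
    exact ⟨k, h3⟩

theorem exists_isCell_sub (hγ : IsLevelMotion α hα c b γ) (hc : 0 < c) (hT : IsPeriod α c b T)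
    {j : Fin α} {β : ℝ} (h : IsCell α c b T γ j β) : ∃ k, IsCell α c b T γ k (β - T) := by
  have hpos := hT.pos
  obtain ⟨δ, hδ, i, hi⟩ := hγ.left (β - T / 2)
  obtain ⟨k, β', h1, h2, h3⟩ := hγ.exists_isCell_of_arc hc hT (by linarith) hi
  have h4 := abs_sub_eq hT hα h h3 (t := β - T / 2) (by rw [abs_le]; constructor <;> linarith)
    (by rw [abs_le]; constructor <;> linarith)
  rw [show β - T / 2 - β = -(T / 2) by ring, abs_neg, abs_of_pos (by linarith)] at h4
  rcases eq_or_eq_neg_of_abs_eq h4.symm with h5 | h5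
  · obtain rfl : β' = β - T := by linarith
    exact ⟨k, h3⟩
  · linarith

end IsLevelMotion

/-- `γ` runs periodically through the level curve of energy `c (b² / 2 - b)`, in sector `j k`
during the time interval of length `T` centred at `β + k T`. -/
structure IsWave (α : ℕ) (c : ℝ) (γ : ℝ → ℂ) (b T β : ℝ) (j : ℤ → Fin α) : Prop where
  period : IsPeriod α c b T
  abs_le : |β| ≤ T / 2
  cell : ∀ k, IsCell α c b T γ (j k) (β + k * T)

theorem IsLevelMotion.exists_isWave {hα : 2 ≤ α} {b : ℝ} {γ : ℝ → ℂ}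
    (hγ : IsLevelMotion α hα c b γ) (h : RosetteParams α c) (hb : 1 < b) :
    ∃ T β j, IsWave α c γ b T β j := by
  obtain ⟨T, hT⟩ := exists_isPeriod h hb
  obtain ⟨j₀, β, hβ, hcell⟩ := hγ.exists_isCell h.pos hT 0
  have key : ∀ k : ℤ, ∃ j, IsCell α c b T γ j (β + k * T) := by
    intro k
    induction k using Int.induction_on with
    | zero => exact ⟨j₀, by simpa using hcell⟩
    | succ n ih =>
      obtain ⟨j, hj⟩ := ih
      obtain ⟨k, hk⟩ := hγ.exists_isCell_add h.pos hT hj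
      refine ⟨k, ?_⟩
      convert hk using 1
      push_cast
      ring
    | pred n ih =>
      obtain ⟨j, hj⟩ := ih
      obtain ⟨k, hk⟩ := hγ.exists_isCell_sub h.pos hT hj
      refine ⟨k, ?_⟩
      convert hk using 1
      push_cast
      ring
  choose j hj using key
  exact ⟨T, β, j, hT, by rwa [zero_sub, abs_neg] at hβ, hj⟩

theorem exists_int_le_lt {s : ℤ → ℝ} (h1 : Tendsto s atTop atTop) (h2 : Tendsto s atBot atBot)
    (t : ℝ) : ∃ k, s k ≤ t ∧ t < s (k + 1) := by
  obtain ⟨B, hB⟩ := (h1.eventually_gt_atTop t).exists_forall_of_atTop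
  obtain ⟨k, hk, hmax⟩ := Int.exists_greatest_of_bdd (P := fun k => s k ≤ t)
    ⟨B, fun z hz => not_lt.1 fun h => (hB z h.le).not_ge hz⟩ (h2.eventually_le_atBot t).exists
  exact ⟨k, hk, not_le.1 fun h => by have := hmax _ h; lia⟩

theorem exists_int_lt_le {s : ℤ → ℝ} (h1 : Tendsto s atTop atTop) (h2 : Tendsto s atBot atBot)
    (t : ℝ) : ∃ k, s k < t ∧ t ≤ s (k + 1) := by
  obtain ⟨B, hB⟩ := (h1.eventually_ge_atTop t).exists_forall_of_atTop
  obtain ⟨k, hk, hmax⟩ := Int.exists_greatest_of_bdd (P := fun k => s k < t)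
    ⟨B, fun z hz => not_lt.1 fun h => (hB z h.le).not_gt hz⟩ (h2.eventually_lt_atBot t).exists
  exact ⟨k, hk, not_lt.1 fun h => by have := hmax _ h; lia⟩

/-- In terms of `(b - 1)²` the equation reads `(b - 1)² = 2 |w.im| / c + (w.re - 1)²`, and the right
side vanishes only at a tangency. -/
theorem exists_energy_eq (h : RosetteParams α c) {z : ℂ} (hz : ∀ j, z ≠ rosetteRot α j) :
    ∃ b, 1 < b ∧ rosetteEnergy α c z = c * (b ^ 2 / 2 - b) := by
  obtain ⟨j, hj⟩ := exists_mem_closedSector h.two_le z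
  have hr := rosetteRot_ne_zero j
  have hc := h.pos
  rw [rosetteEnergy_eq h.two_le hj]
  set w := (rosetteRot α j)⁻¹ * z with hw
  have hpos : 0 < 2 * |w.im| / c + (w.re - 1) ^ 2 := by
    by_contra! hle
    have h1 : 0 ≤ 2 * |w.im| / c := by positivity
    have h2 := sq_nonneg (w.re - 1)
    have h3 : w.re - 1 = 0 := pow_eq_zero_iff (two_ne_zero) |>.1 (by linarith)
    have h4 : 2 * |w.im| / c = 0 := by linarith
    have h5 : w.im = 0 := by
      have := (div_eq_zero_iff.1 h4).resolve_right hc.ne'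
      exact abs_eq_zero.1 (by linarith)
    have h6 : w = 1 := Complex.ext (by rw [Complex.one_re]; linarith) (by rw [h5, Complex.one_im])
    refine hz j ?_
    rw [← mul_inv_cancel_left₀ hr z, ← hw, h6, mul_one]
  refine ⟨1 + √(2 * |w.im| / c + (w.re - 1) ^ 2), by linarith [Real.sqrt_pos.2 hpos], ?_⟩
  have hsq := Real.sq_sqrt hpos.le
  have e : c * (2 * |w.im| / c) = 2 * |w.im| := by field_simp
  linear_combination -(c / 2) * hsq - e / 2

/-- Without sliding all pieces are region arcs, so the energy passes unchanged through every
switching time, including visits to the origin. -/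
theorem NSVF.IsTrajectory.isLevelMotion (h : RosetteParams α c) {γ : ℝ → ℂ}
    (hγ : (rosette α h.two_le c).IsTrajectory γ) :
    (∃ j, ∀ t, γ t = rosetteRot α j) ∨ ∃ b, 1 < b ∧ IsLevelMotion α h.two_le c b γ := by
  rcases hγ with ⟨p, hp, hγ⟩ | ⟨hcont, hst, s, hs, h1, h2, harc⟩
  · obtain ⟨j, rfl⟩ := (isSingularTangency_rosette_iff h.two_le h.pos h.slope).1 hp
    exact Or.inl ⟨j, hγ⟩
  right
  have hst' : ∀ j, γ (s 0) ≠ rosetteRot α j := fun j hj =>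
    hst (s 0) ((isSingularTangency_rosette_iff h.two_le h.pos h.slope).2 ⟨j, hj⟩)
  have hreg : ∀ k, ∃ i, (rosette α h.two_le c).IsRegionArc i γ (s k) (s (k + 1)) := fun k =>
    (harc k).resolve_right (not_isSlidingArc_rosette h.two_le (hs (by lia)))
  obtain ⟨b, hb, hE⟩ := exists_energy_eq h hst'
  have hEk : ∀ k, rosetteEnergy α c (γ (s k)) = rosetteEnergy α c (γ (s 0)) := by
    intro k
    have hstep : ∀ k, rosetteEnergy α c (γ (s (k + 1))) = rosetteEnergy α c (γ (s k)) := by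
      intro k
      obtain ⟨i, hi⟩ := hreg k
      exact rosetteEnergy_const_of_isRegionArc hcont hi ⟨(hs (by lia)).le, le_rfl⟩
    induction k using Int.induction_on with
    | zero => rfl
    | succ n ih => rw [hstep, ih]
    | pred n ih => rw [← ih, ← hstep (-n - 1), sub_add_cancel]
  refine ⟨b, hb, hcont, fun t => ?_, fun t => ?_, fun t => ?_⟩
  · obtain ⟨k, hk1, hk2⟩ := exists_int_le_lt h1 h2 t
    obtain ⟨i, hi⟩ := hreg k
    rw [rosetteEnergy_const_of_isRegionArc hcont hi ⟨hk1, hk2.le⟩, hEk, hE]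
  · obtain ⟨k, hk1, hk2⟩ := exists_int_le_lt h1 h2 t
    obtain ⟨i, hi⟩ := hreg k
    exact ⟨s (k + 1) - t, by linarith, i, hi.mono hk1 (by linarith)⟩
  · obtain ⟨k, hk1, hk2⟩ := exists_int_lt_le h1 h2 t
    obtain ⟨i, hi⟩ := hreg k
    exact ⟨t - s k, by linarith, i, hi.mono (by linarith) hk2⟩

theorem NSVF.IsTrajectory.exists_isWave (h : RosetteParams α c) {γ : ℝ → ℂ}
    (hγ : (rosette α h.two_le c).IsTrajectory γ) :
    (∃ j, ∀ t, γ t = rosetteRot α j) ∨ ∃ b T β j, IsWave α c γ b T β j := by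
  rcases hγ.isLevelMotion h with hj | ⟨b, hb, hm⟩
  · exact Or.inl hj
  · exact Or.inr ⟨b, hm.exists_isWave h hb⟩

/-- The energy is a first integral. -/
theorem NSVF.IsTrajectory.rosetteEnergy_eq (h : RosetteParams α c) {γ : ℝ → ℂ}
    (hγ : (rosette α h.two_le c).IsTrajectory γ) (t t' : ℝ) :
    rosetteEnergy α c (γ t) = rosetteEnergy α c (γ t') := by
  rcases hγ.isLevelMotion h with ⟨j, hj⟩ | ⟨b, hb, hm⟩
  · rw [hj, hj]
  · rw [hm.energy, hm.energy]

end Motion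

/-! ### Itineraries below, on and above the level of the petals -/

section Waves

variable {α : ℕ} {c b T β : ℝ} {γ : ℝ → ℂ} {j : ℤ → Fin α}

theorem IsPeriod.rosetteEnergy_eq (hT : IsPeriod α c b T) (hα : 2 ≤ α) (hc : 0 < c) (j : Fin α)
    {u : ℝ} (hu : |u| ≤ T / 2) :
    rosetteEnergy α c (rosetteRot α j * profile c b u) = c * (b ^ 2 / 2 - b) := by
  have h := inv_mul_cancel_left₀ (rosetteRot_ne_zero j) (profile c b u)
  rw [_root_.rosetteEnergy_eq (j := j) hα (by rw [h]; exact hT.mem_closedSector hu), h,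
    abs_profile_im hc (by linarith [hT.le_sub_one]), profile_re]
  ring

theorem rosetteEnergy_rosetteRot (hα : 2 ≤ α) (j : Fin α) :
    rosetteEnergy α c (rosetteRot α j) = -(c / 2) := by
  have h := inv_mul_cancel₀ (rosetteRot_ne_zero j)
  have hs : (1 : ℂ) ∈ closedSector α := by
    change |(1 : ℂ).im| * _ ≤ (1 : ℂ).re * _
    simpa using (sin_pi_div_pos hα).le
  rw [rosetteEnergy_eq (j := j) hα (by rwa [h]), h, Complex.one_im, Complex.one_re]
  norm_num
  ring

namespace IsWave

theorem exists_abs_le (hw : IsWave α c γ b T β j) (t : ℝ) :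
    ∃ k : ℤ, |t - (β + k * T)| ≤ T / 2 := by
  have hpos := hw.period.pos
  refine ⟨round ((t - β) / T), ?_⟩
  have h := abs_sub_round ((t - β) / T)
  have e : t - (β + round ((t - β) / T) * T) = ((t - β) / T - round ((t - β) / T)) * T := by
    field_simp
    ring
  rw [e, abs_mul, abs_of_pos hpos]
  nlinarith

theorem rosetteEnergy_eq (hw : IsWave α c γ b T β j) (hα : 2 ≤ α) (hc : 0 < c) (t : ℝ) :
    rosetteEnergy α c (γ t) = c * (b ^ 2 / 2 - b) := by
  obtain ⟨k, hk⟩ := hw.exists_abs_le t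
  rw [hw.cell k t hk, hw.period.rosetteEnergy_eq hα hc _ hk]

theorem rot_mul_profile (hw : IsWave α c γ b T β j) (k : ℤ) :
    rosetteRot α (j k) * profile c b (T / 2) =
      rosetteRot α (j (k + 1)) * profile c b (-(T / 2)) := by
  have hpos := hw.period.pos
  have h1 := hw.cell k (β + k * T + T / 2) (by rw [add_sub_cancel_left, abs_of_pos (by linarith)])
  have e : β + k * T + T / 2 - (β + (k + 1 : ℤ) * T) = -(T / 2) := by
    push_cast
    ring
  have h2 := hw.cell (k + 1) (β + k * T + T / 2) (by rw [e, abs_neg, abs_of_pos (by linarith)])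
  rw [e] at h2
  rw [add_sub_cancel_left] at h1
  rw [← h1, ← h2]

/-- Consecutive cells meet at the nonzero point `2 - b` of the axis, which determines the sector.
For `b = 2` this point is the origin and the constraint disappears. -/
theorem succ_of_lt (hw : IsWave α c γ b T β j) (hb : b < 2) (k : ℤ) : j (k + 1) = j k := by
  have h := hw.rot_mul_profile k
  have hpos := hw.period.pos
  have e : profile c b (T / 2) = ((2 - b : ℝ) : ℂ) := by
    rw [profile, hw.period.eq_of_lt hb, abs_of_pos (by linarith [hw.period.one_lt])]
    apply Complex.ext
    · rw [Complex.ofReal_re]; ring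
    · rw [Complex.ofReal_im]; ring
  have e' : profile c b (-(T / 2)) = ((2 - b : ℝ) : ℂ) := by
    rw [profile, hw.period.eq_of_lt hb, abs_neg, abs_of_pos (by linarith [hw.period.one_lt])]
    apply Complex.ext
    · rw [Complex.ofReal_re]; ring
    · rw [Complex.ofReal_im]; ring
  rw [e, e'] at h
  have hne : ((2 - b : ℝ) : ℂ) ≠ 0 := Complex.ofReal_ne_zero.2 (by linarith)
  exact (rosetteRot_injective (mul_right_cancel₀ hne h)).symm

/-- A cell ends on the lower ray of its sector and the next one starts on its own upper ray; the
common point is not the origin, so the next sector is the clockwise neighbour. -/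
theorem succ_of_gt (hw : IsWave α c γ b T β j) (hb : 2 < b) (k : ℤ) :
    rosetteRot α (j k) = rosetteRot α (j (k + 1)) * rayDir α ^ 2 := by
  have h := hw.rot_mul_profile k
  obtain ⟨r, hr, e, e'⟩ := hw.period.of_gt hb
  have hr' : (r : ℂ) ≠ 0 := Complex.ofReal_ne_zero.2 hr.ne'
  have hd := rayDir_ne_zero (α := α)
  rw [e, e', mul_left_comm, mul_left_comm _ (r : ℂ)] at h
  have h' := mul_left_cancel₀ hr' h
  rw [pow_two, ← mul_assoc, ← h', inv_mul_cancel_right₀ hd]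

/-- Off the level of the closed arcs through the origin, the itinerary is determined by its initial
term and the side of the level. -/
theorem itinerary_eq {b' T' β' : ℝ} {γ' : ℝ → ℂ} {j' : ℤ → Fin α} (hw : IsWave α c γ b T β j)
    (hw' : IsWave α c γ' b' T' β' j') (h0 : j 0 = j' 0)
    (hb : (b < 2 ∧ b' < 2) ∨ (2 < b ∧ 2 < b')) : j = j' := by
  have key : ∀ k, j k = j' k ↔ j (k + 1) = j' (k + 1) := by
    intro k
    rcases hb with ⟨h1, h2⟩ | ⟨h1, h2⟩
    · rw [hw.succ_of_lt h1, hw'.succ_of_lt h2]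
    · rw [← rosetteRot_injective.eq_iff, hw.succ_of_gt h1, hw'.succ_of_gt h2,
        mul_left_inj' (pow_ne_zero _ rayDir_ne_zero), rosetteRot_injective.eq_iff]
  funext k
  induction k using Int.induction_on with
  | zero => exact h0
  | succ n ih => exact (key _).1 ih
  | pred n ih => exact (key _).2 (by rwa [sub_add_cancel])

end IsWave

/-- The upper half corresponds to `u < 0`, before the turning point, and the lower half to `u > 0`;
the condition on `u` keeps away from the kink of `|u|`. -/
theorem IsPeriod.hasDerivAt_profile {s : Bool} {u : ℝ} (hu : halfSign s * u < 0) :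
    HasDerivAt (profile c b) (4 * ⟨halfSign s, c * (1 - (profile c b u).re)⟩) u := by
  have hs := halfSign_sq s
  have habs : ∀ v, halfSign s * v < 0 → |v| = -(halfSign s * v) := by
    intro v hv
    rw [← abs_of_neg hv, abs_mul]
    cases s <;> simp [halfSign]
  have h1 : HasDerivAt (fun v : ℝ => b + 4 * (halfSign s * v)) (4 * halfSign s) u := by
    simpa using (((hasDerivAt_id u).const_mul (halfSign s)).const_mul 4).const_add b
  have h2 : HasDerivAt (fun v : ℝ => -4 * c * v * (b - 1 + 2 * (halfSign s * v)))
      (4 * (c * (1 - (b + 4 * (halfSign s * u))))) u := by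
    refine (((hasDerivAt_id u).const_mul (-4 * c)).mul
      ((((hasDerivAt_id u).const_mul (halfSign s)).const_mul 2).const_add (b - 1))).congr_deriv ?_
    simp only [id]
    ring
  have h3 := (h1.ofReal_comp).add ((h2.ofReal_comp).mul_const Complex.I)
  have heq : profile c b =ᶠ[𝓝 u] fun v => ((b + 4 * (halfSign s * v) : ℝ) : ℂ) +
      ((-4 * c * v * (b - 1 + 2 * (halfSign s * v)) : ℝ) : ℂ) * Complex.I := by
    have hlt : ∀ᶠ v in 𝓝 u, halfSign s * v < 0 :=
      (continuous_const_mul _).continuousAt.eventually_lt continuousAt_const hu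
    filter_upwards [hlt] with v hv
    rw [profile, habs v hv, Complex.mk_eq_add_mul_I]
    congr 3
    · ring
    · ring
  refine (h3.congr_of_eventuallyEq heq).congr_deriv ?_
  rw [profile_re, habs u hu, Complex.mk_eq_add_mul_I]
  push_cast
  ring

theorem IsCell.isRegionArc {hα : 2 ≤ α} (hT : IsPeriod α c b T) (hc : 0 < c) {j : Fin α}
    (h : IsCell α c b T γ j β) (s : Bool) {t₁ t₂ : ℝ}
    (h12 : ∀ t ∈ Icc t₁ t₂, |t - β| ≤ T / 2 ∧ halfSign s * (t - β) ≤ 0)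
    (h12' : ∀ t ∈ Ioo t₁ t₂, |t - β| < T / 2 ∧ halfSign s * (t - β) < 0) :
    (rosette α hα c).IsRegionArc (j, s) γ t₁ t₂ := by
  have hr := rosetteRot_ne_zero j
  constructor
  · intro t ht
    obtain ⟨h1, h2⟩ := h12 t ht
    change _ ∈ closure (rosetteRegion α (j, s))
    rw [closure_rosetteRegion hα, mem_ofPred_eq, h t h1, inv_mul_cancel_left₀ hr]
    refine ⟨?_, hT.mem_closedSector h1⟩
    have h3 : 0 ≤ b - 1 - 2 * |t - β| := by linarith [hT.le_sub_one]
    have h4 := mul_nonneg (mul_nonneg (mul_nonneg (by norm_num : (0 : ℝ) ≤ 4) hc.le)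
      (neg_nonneg.2 h2)) h3
    simp only [profile]
    linear_combination h4
  · intro t ht
    obtain ⟨h1, h2⟩ := h12' t ht
    have hd := ((IsPeriod.hasDerivAt_profile (c := c) (b := b) h2).comp_sub_const t β).const_mul
      (rosetteRot α j)
    have heq : γ =ᶠ[𝓝 t] fun t => rosetteRot α j * profile c b (t - β) := by
      have : ∀ᶠ x in 𝓝 t, |x - β| < T / 2 :=
        (by fun_prop : Continuous fun x : ℝ => |x - β|).continuousAt.eventually_lt
          continuousAt_const h1
      filter_upwards [this] with x hx using h x hx.le
    refine (hd.congr_of_eventuallyEq heq).congr_deriv ?_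
    change _ = rosetteField α c (j, s) (γ t)
    rw [rosetteField, h t h1.le, inv_mul_cancel_left₀ hr, mul_left_comm]

end Waves

/-! ### The petals and the concatenations of their arcs -/

section Arcs

variable {α : ℕ} {c : ℝ}

theorem rosetteArc_eq (j : Fin α) (t : ℝ) :
    rosetteArc α c j t = rosetteRot α j * profile c 2 (t - 1 / 2) := by
  rw [rosetteArc, profile]
  congr 1
  split_ifs with h
  · rw [abs_of_nonpos (by linarith)]
    apply Complex.ext
    · change 4 * t = _
      ring
    · change c * (4 * t - (4 * t) ^ 2 / 2) = _
      ring
  · rw [abs_of_pos (by linarith)]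
    apply Complex.ext
    · change 4 - 4 * t = _
      ring
    · change -(c * ((4 - 4 * t) - (4 - 4 * t) ^ 2 / 2)) = _
      ring

theorem continuous_rosetteArc (j : Fin α) : Continuous (rosetteArc α c j) := by
  have h : rosetteArc α c j = fun t => rosetteRot α j * profile c 2 (t - 1 / 2) :=
    funext (rosetteArc_eq j)
  rw [h]
  exact continuous_const.mul ((continuous_profile c).comp
    (continuous_const.prodMk (continuous_id.sub continuous_const)))

theorem rosetteArc_zero (j : Fin α) : rosetteArc α c j 0 = 0 := by
  rw [rosetteArc, if_pos (by norm_num)]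
  refine mul_eq_zero_of_right _ (Complex.ext ?_ ?_) <;> simp

theorem rosetteArc_one (j : Fin α) : rosetteArc α c j 1 = 0 := by
  rw [rosetteArc, if_neg (by norm_num)]
  refine mul_eq_zero_of_right _ (Complex.ext ?_ ?_) <;> simp

/-- The union of the closed arcs through the origin. -/
def petals (α : ℕ) (c : ℝ) : TopologicalSpace.Compacts ℂ where
  carrier := ⋃ j : Fin α, rosetteArc α c j '' Icc 0 1
  isCompact' := isCompact_iUnion fun j => isCompact_Icc.image (continuous_rosetteArc j)

theorem rosetteArc_mem_petals (j : Fin α) {t : ℝ} (ht : t ∈ Icc (0 : ℝ) 1) :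
    rosetteArc α c j t ∈ petals α c :=
  mem_iUnion.2 ⟨j, t, ht, rfl⟩

theorem isPeriod_two (h : RosetteParams α c) : IsPeriod α c 2 1 := by
  obtain ⟨T, hT⟩ := exists_isPeriod h one_lt_two
  rwa [hT.eq_of_eq rfl] at hT

theorem rosetteEnergy_of_mem_petals (h : RosetteParams α c) {z : ℂ} (hz : z ∈ petals α c) :
    rosetteEnergy α c z = 0 := by
  obtain ⟨j, t, ht, rfl⟩ := mem_iUnion.1 hz
  rw [rosetteArc_eq, (isPeriod_two h).rosetteEnergy_eq h.two_le h.pos]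
  · norm_num
  · exact abs_le.2 ⟨by linarith [ht.1], by linarith [ht.2]⟩

theorem rosetteRot_notMem_petals (h : RosetteParams α c) (j : Fin α) :
    rosetteRot α j ∉ petals α c := by
  intro hj
  have := rosetteEnergy_of_mem_petals h hj
  rw [rosetteEnergy_rosetteRot h.two_le] at this
  linarith [h.pos]

/-- A trajectory that meets the closed arcs through the origin is a concatenation of them. -/
theorem NSVF.IsTrajectory.exists_isWave_two (h : RosetteParams α c) {γ : ℝ → ℂ}
    (hγ : (rosette α h.two_le c).IsTrajectory γ) {t : ℝ} (ht : γ t ∈ petals α c) :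
    ∃ β j, IsWave α c γ 2 1 β j := by
  rcases hγ.exists_isWave h with ⟨j, hj⟩ | ⟨b, T, β, j, hw⟩
  · rw [hj] at ht
    exact absurd ht (rosetteRot_notMem_petals h j)
  · have h1 := hw.rosetteEnergy_eq h.two_le h.pos t
    rw [rosetteEnergy_of_mem_petals h ht] at h1
    have hb := hw.period.one_lt
    have h2 : b / 2 * (b - 2) = 0 := by
      have := (mul_eq_zero.1 h1.symm).resolve_left h.pos.ne'
      linarith
    have h3 : b = 2 := by linarith [(mul_eq_zero.1 h2).resolve_left (by linarith)]
    have h4 := hw.period.eq_of_eq h3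
    rw [h3, h4] at hw
    exact ⟨β, j, hw⟩

theorem IsWave.mem_petals {γ : ℝ → ℂ} {β : ℝ} {j : ℤ → Fin α} (hw : IsWave α c γ 2 1 β j)
    (t : ℝ) : γ t ∈ petals α c := by
  obtain ⟨k, hk⟩ := hw.exists_abs_le t
  have e : t - (β + k * 1) = (t - (β + k * 1) + 1 / 2) - 1 / 2 := by ring
  rw [hw.cell k t hk, e, ← rosetteArc_eq]
  obtain ⟨h1, h2⟩ := _root_.abs_le.1 hk
  exact rosetteArc_mem_petals _ ⟨by linarith, by linarith⟩

theorem isInvariant_petals (h : RosetteParams α c) :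
    (rosette α h.two_le c).IsInvariant (petals α c) := by
  rintro γ hγ ⟨t, ht⟩ t'
  obtain ⟨β, j, hw⟩ := hγ.exists_isWave_two h ht
  exact hw.mem_petals t'

theorem profile_two_half : profile c 2 (1 / 2) = 0 := by
  rw [profile, abs_of_pos (by norm_num)]
  apply Complex.ext <;> norm_num

theorem exists_eq_zero_of_mem_Ico (h : RosetteParams α c)
    (γ : (rosette α h.two_le c).Omega (petals α c)) : ∃ τ ∈ Ico (0 : ℝ) 1, γ.1 τ = 0 := by
  obtain ⟨β, j, hw⟩ := γ.2.1.exists_isWave_two h (γ.2.2 0)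
  -- The origin is reached at the ends `β + k + 1 / 2` of the cells, one of which lies in `[0, 1)`.
  refine ⟨Int.fract (β + 1 / 2), ⟨Int.fract_nonneg _, Int.fract_lt_one _⟩, ?_⟩
  have e : Int.fract (β + 1 / 2) - (β + (-⌊β + 1 / 2⌋ : ℤ) * 1) = 1 / 2 := by
    rw [Int.fract]
    push_cast
    ring
  rw [hw.cell (-⌊β + 1 / 2⌋) _ (by rw [e, abs_of_pos (by norm_num)]), e, profile_two_half, mul_zero]

/-- The concatenation of the closed arcs through the origin along an itinerary. -/
def arcConcat (α : ℕ) (c : ℝ) (s : ℤ → Fin α) (t : ℝ) : ℂ :=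
  rosetteArc α c (s ⌊t⌋) (Int.fract t)

theorem arcConcat_add (s : ℤ → Fin α) (n : ℤ) {u : ℝ} (hu : u ∈ Icc (0 : ℝ) 1) :
    arcConcat α c s (n + u) = rosetteArc α c (s n) u := by
  rw [arcConcat, Int.floor_intCast_add, Int.fract_intCast_add]
  rcases hu.2.eq_or_lt with rfl | h1
  -- At `u = 1` the floor already points to the next symbol, but both arcs are at the origin.
  · rw [Int.fract_one, rosetteArc_zero, rosetteArc_one]
  · rw [Int.floor_eq_zero_iff.2 ⟨hu.1, h1⟩, Int.fract_eq_self.2 ⟨hu.1, h1⟩, add_zero]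

theorem arcConcat_eq (s : ℤ → Fin α) (n : ℤ) {t : ℝ} (ht : t ∈ Icc (n : ℝ) (n + 1)) :
    arcConcat α c s t = rosetteArc α c (s n) (t - n) := by
  have := arcConcat_add (c := c) s n (u := t - n) ⟨by linarith [ht.1], by linarith [ht.2]⟩
  rwa [add_sub_cancel] at this

theorem continuous_arcConcat (s : ℤ → Fin α) : Continuous (arcConcat α c s) := by
  have hlf : LocallyFinite fun n : ℤ => Icc (n : ℝ) (n + 1) :=
    locallyFinite_Icc_of_tendsto tendsto_intCast_atTop_atTop
      (tendsto_atBot_add_const_right _ 1 (tendsto_intCast_atBot_iff.2 tendsto_id))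
  refine hlf.continuous (eq_univ_of_forall fun t => ?_) (fun n => isClosed_Icc) fun n => ?_
  · exact mem_iUnion.2 ⟨⌊t⌋, Int.floor_le t, (Int.lt_floor_add_one t).le⟩
  · refine ContinuousOn.congr (f := fun t => rosetteArc α c (s n) (t - n)) ?_
      fun t ht => arcConcat_eq s n ht
    exact ((continuous_rosetteArc (s n)).comp (continuous_sub_right _)).continuousOn

theorem arcConcat_mem_petals (s : ℤ → Fin α) (t : ℝ) : arcConcat α c s t ∈ petals α c :=
  rosetteArc_mem_petals _ ⟨Int.fract_nonneg t, (Int.fract_lt_one t).le⟩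

theorem isCell_arcConcat (s : ℤ → Fin α) (n : ℤ) :
    IsCell α c 2 1 (arcConcat α c s) (s n) (n + 1 / 2) := by
  intro t ht
  obtain ⟨h1, h2⟩ := abs_le.1 ht
  rw [arcConcat_eq s n ⟨by linarith, by linarith⟩, rosetteArc_eq]
  congr 2
  ring

/-- The switching times are the half integers: an even index starts the upper half of an arc at the
origin, an odd one the lower half at the turning point. -/
theorem isTrajectory_arcConcat (h : RosetteParams α c) (s : ℤ → Fin α) :
    (rosette α h.two_le c).IsTrajectory (arcConcat α c s) := by
  have hT := isPeriod_two h
  refine Or.inr ⟨continuous_arcConcat s, fun t ht => ?_, fun k => (k : ℝ) / 2, ?_, ?_, ?_,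
    fun k => Or.inl ?_⟩
  · obtain ⟨j, hj⟩ := (isSingularTangency_rosette_iff h.two_le h.pos h.slope).1 ht
    exact rosetteRot_notMem_petals h j (hj ▸ arcConcat_mem_petals s t)
  · intro k l hkl
    have : (k : ℝ) < l := by exact_mod_cast hkl
    change (k : ℝ) / 2 < l / 2
    linarith
  · exact tendsto_intCast_atTop_atTop.atTop_div_const two_pos
  · exact (tendsto_intCast_atBot_iff.2 tendsto_id).atBot_div_const two_pos
  · rcases Int.even_or_odd' k with ⟨n, rfl | rfl⟩
    · refine ⟨(s n, true), (isCell_arcConcat s n).isRegionArc hT h.pos true ?_ ?_⟩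
      · rintro t ⟨h1, h2⟩
        push_cast at h1 h2
        simp only [halfSign, if_true]
        exact ⟨abs_le.2 ⟨by linarith, by linarith⟩, by linarith⟩
      · rintro t ⟨h1, h2⟩
        push_cast at h1 h2
        simp only [halfSign, if_true]
        exact ⟨abs_lt.2 ⟨by linarith, by linarith⟩, by linarith⟩
    · refine ⟨(s n, false), (isCell_arcConcat s n).isRegionArc hT h.pos false ?_ ?_⟩
      · rintro t ⟨h1, h2⟩
        push_cast at h1 h2
        simp only [halfSign, Bool.false_eq_true, if_false]
        exact ⟨abs_le.2 ⟨by linarith, by linarith⟩, by linarith⟩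
      · rintro t ⟨h1, h2⟩
        push_cast at h1 h2
        simp only [halfSign, Bool.false_eq_true, if_false]
        exact ⟨abs_lt.2 ⟨by linarith, by linarith⟩, by linarith⟩

theorem arcConcat_zero (s : ℤ → Fin α) : arcConcat α c s 0 = 0 := by
  rw [arcConcat, Int.fract_zero, rosetteArc_zero]

theorem arcConcat_half (s : ℤ → Fin α) (n : ℤ) :
    arcConcat α c s (n + 1 / 2) = rosetteRot α (s n) * 2 := by
  rw [isCell_arcConcat s n _ (by rw [sub_self]; norm_num), sub_self, profile]
  congr 1
  apply Complex.ext <;> simp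

theorem arcConcat_injective : Function.Injective (arcConcat α c) := by
  intro s s' h
  funext n
  have := congrFun h (n + 1 / 2)
  rw [arcConcat_half, arcConcat_half] at this
  exact rosetteRot_injective (mul_right_cancel₀ two_ne_zero this)

theorem exists_arcConcat_eq (h : RosetteParams α c) {γ : ℝ → ℂ}
    (hγ : (rosette α h.two_le c).IsTrajectory γ) (h0 : γ 0 = 0) :
    ∃ s, arcConcat α c s = γ := by
  have hmem : γ 0 ∈ petals α c := by
    rw [h0, ← rosetteArc_zero (c := c) (⟨0, by linarith [h.two_le]⟩ : Fin α)]
    exact rosetteArc_mem_petals _ ⟨le_rfl, zero_le_one⟩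
  obtain ⟨β, j, hw⟩ := hγ.exists_isWave_two h hmem
  have hβ : |β| = 1 / 2 := by
    have h1 := hw.cell 0 0 (by simpa using hw.abs_le)
    rw [h0, eq_comm, mul_eq_zero, or_iff_right (rosetteRot_ne_zero _)] at h1
    have h2 := congrArg Complex.re h1
    rw [profile_re, Complex.zero_re] at h2
    simp only [Int.cast_zero, zero_mul, add_zero, zero_sub, abs_neg] at h2
    linarith
  have key : ∀ s : ℤ → Fin α, (∀ n : ℤ, IsCell α c 2 1 γ (s n) (n + 1 / 2)) →
      arcConcat α c s = γ := by
    intro s hs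
    funext t
    have ht : |t - (⌊t⌋ + 1 / 2)| ≤ 1 / 2 :=
      abs_le.2 ⟨by linarith [Int.floor_le t], by linarith [Int.lt_floor_add_one t]⟩
    rw [isCell_arcConcat s ⌊t⌋ t ht, hs ⌊t⌋ t ht]
  -- Time `0` is either the start of cell `0` or its end; in the second case the itinerary is
  -- shifted by one.
  rcases eq_or_eq_neg_of_abs_eq hβ with rfl | rfl
  · refine ⟨j, key j fun n => ?_⟩
    have := hw.cell n
    rwa [mul_one, add_comm] at this
  · refine ⟨fun n => j (n + 1), key _ fun n => ?_⟩
    convert hw.cell (n + 1) using 1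
    push_cast
    ring

end Arcs

/-! ### Uniform closeness on a window controls the distance of trajectories -/

section Metric

variable {ι : Type} {Z : NSVF ι} {K : TopologicalSpace.Compacts ℂ}

/-- Finitely many weights carry almost the whole sum. On those terms closeness on the window gives
at most `W δ < ε / 2`; the remaining terms are bounded by the diameter of `K` times the small tail
of the weights. -/
theorem exists_dist_omega_lt {ε : ℝ} (hε : 0 < ε) : ∃ N : ℕ, ∃ δ > 0, ∀ γ₁ γ₂ : Z.Omega K,
    (∀ t ∈ Icc (-N : ℝ) (N + 1), dist (γ₁.1 t) (γ₂.1 t) ≤ δ) → dist γ₁ γ₂ < ε := by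
  set w : ℤ → ℝ := fun i => 1 / 2 ^ i.natAbs with hwdef
  have hw0 : ∀ i, 0 ≤ w i := fun i => by positivity
  have hws : Summable w := NSVF.summable_weight
  set D := Metric.diam (K : Set ℂ)
  have hD : 0 ≤ D := Metric.diam_nonneg
  set W := ∑' i, w i
  have hW : 0 ≤ W := tsum_nonneg hw0
  obtain ⟨S, hS⟩ : ∃ S : Finset ℤ, W - ε / (2 * (D + 1)) < ∑ i ∈ S, w i :=
    (hws.hasSum.eventually_const_lt (sub_lt_self _ (by positivity))).exists
  obtain ⟨N, hN⟩ : ∃ N : ℕ, ∀ i ∈ S, i.natAbs ≤ N :=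
    ⟨S.sup Int.natAbs, fun i hi => Finset.le_sup (f := Int.natAbs) hi⟩
  refine ⟨N, ε / (2 * (W + 1)), by positivity, fun γ₁ γ₂ h => ?_⟩
  set δ := ε / (2 * (W + 1)) with hδ
  have hδ0 : 0 < δ := by positivity
  have hind : Summable ((S : Set ℤ).indicator w) := hws.indicator _
  have hsum : Summable fun i => w i * δ + D * (w i - (S : Set ℤ).indicator w i) :=
    (hws.mul_right δ).add ((hws.sub hind).mul_left D)
  have hterm : ∀ i : ℤ, w i * ∫ t in (i : ℝ)..(i + 1), dist (γ₁.1 t) (γ₂.1 t) ≤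
      w i * δ + D * (w i - (S : Set ℤ).indicator w i) := by
    intro i
    by_cases hi : i ∈ S
    · rw [indicator_of_mem (by exact_mod_cast hi), sub_self, mul_zero, add_zero]
      refine mul_le_mul_of_nonneg_left ?_ (hw0 i)
      have hiN := hN i hi
      have h1 : (-N : ℝ) ≤ i := by exact_mod_cast (by lia : (-N : ℤ) ≤ i)
      have h2 : (i : ℝ) ≤ N := by exact_mod_cast (by lia : i ≤ (N : ℤ))
      have : ∫ t in (i : ℝ)..(i + 1), dist (γ₁.1 t) (γ₂.1 t) ≤ ∫ _ in (i : ℝ)..(i + 1), δ :=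
        intervalIntegral.integral_mono_on (by linarith)
          ((NSVF.continuous_dist_omega γ₁ γ₂).intervalIntegrable _ _) (by simp)
          fun t ht => h t ⟨by linarith [ht.1], by linarith [ht.2]⟩
      simpa using this
    · rw [indicator_of_notMem (by exact_mod_cast hi), sub_zero, mul_comm D]
      have h1 : ∫ t in (i : ℝ)..(i + 1), dist (γ₁.1 t) (γ₂.1 t) ≤ ∫ _ in (i : ℝ)..(i + 1), D :=
        intervalIntegral.integral_mono (by linarith)
          ((NSVF.continuous_dist_omega γ₁ γ₂).intervalIntegrable _ _) (by simp)
          fun t => Metric.dist_le_diam_of_mem K.isCompact.isBounded (γ₁.2.2 t) (γ₂.2.2 t)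
      have h2 := mul_le_mul_of_nonneg_left h1 (hw0 i)
      have h3 : ∫ _ in (i : ℝ)..(i + 1), D = D := by simp
      rw [h3] at h2
      linarith [mul_nonneg (hw0 i) hδ0.le]
  have hle : dist γ₁ γ₂ ≤ ∑' i, (w i * δ + D * (w i - (S : Set ℤ).indicator w i)) :=
    (NSVF.summable_rho γ₁ γ₂).tsum_le_tsum hterm hsum
  rw [(hws.mul_right δ).tsum_add ((hws.sub hind).mul_left D), tsum_mul_right, tsum_mul_left,
    hws.tsum_sub hind] at hle
  have hfin : ∑' i, (S : Set ℤ).indicator w i = ∑ i ∈ S, w i := by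
    rw [← tsum_subtype, Finset.tsum_subtype']
  have h1 : W * δ < ε / 2 := by
    rw [hδ, mul_div_assoc', div_lt_div_iff₀ (by positivity) two_pos]
    nlinarith
  have h2 : D * (W - ∑ i ∈ S, w i) ≤ ε / 2 := by
    have h3 : D * (W - ∑ i ∈ S, w i) ≤ D * (ε / (2 * (D + 1))) :=
      mul_le_mul_of_nonneg_left (by linarith) hD
    have h4 : D * (ε / (2 * (D + 1))) ≤ ε / 2 := by
      rw [mul_div_assoc', div_le_div_iff₀ (by positivity) two_pos]
      nlinarith
    linarith
  rw [hfin] at hle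
  linarith

end Metric

/-! ### Conjugacy with the full shift -/

section Coding

variable {α : ℕ} {c : ℝ}

/-- The concatenation of arcs as a trajectory in an invariant set through the origin. -/
def arcOmega (h : RosetteParams α c) (K : TopologicalSpace.Compacts ℂ)
    (hK : (rosette α h.two_le c).IsInvariant K) (h0 : (0 : ℂ) ∈ K) (s : ℤ → Fin α) :
    (rosette α h.two_le c).Omega K :=
  ⟨arcConcat α c s, isTrajectory_arcConcat h s, hK _ (isTrajectory_arcConcat h s)
    ⟨0, by rwa [arcConcat_zero]⟩⟩

theorem zero_mem_petals (hα : 2 ≤ α) : (0 : ℂ) ∈ petals α c := by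
  rw [← rosetteArc_zero (c := c) (⟨0, by lia⟩ : Fin α)]
  exact rosetteArc_mem_petals _ ⟨le_rfl, zero_le_one⟩

theorem continuous_arcOmega (h : RosetteParams α c) (K : TopologicalSpace.Compacts ℂ)
    (hK : (rosette α h.two_le c).IsInvariant K) (h0 : (0 : ℂ) ∈ K) :
    Continuous (arcOmega h K hK h0) := by
  rw [continuous_iff_continuousAt]
  intro s
  rw [ContinuousAt, Metric.tendsto_nhds]
  intro ε hε
  obtain ⟨N, δ, hδ, hclose⟩ := exists_dist_omega_lt (Z := rosette α h.two_le c) (K := K) hε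
  -- On the window only these symbols are read; `N + 1` itself occurs as the floor of the right end.
  have hev : ∀ᶠ s' in 𝓝 s, ∀ n ∈ Finset.Icc (-N : ℤ) (N + 1), s' n = s n := by
    rw [Finset.eventually_all]
    intro n _
    have := (continuous_apply (A := fun _ : ℤ => Fin α) n).continuousAt (x := s)
    exact this.eventually (show ∀ᶠ x in 𝓝 (s n), x = s n by simp)
  filter_upwards [hev] with s' hs'
  refine hclose _ _ fun t ht => ?_
  have h1 : -(N : ℤ) ≤ ⌊t⌋ := Int.le_floor.2 (by exact_mod_cast ht.1)
  have h2 : ⌊t⌋ ≤ N + 1 := by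
    have : (⌊t⌋ : ℝ) ≤ N + 1 := (Int.floor_le t).trans ht.2
    exact_mod_cast this
  have : arcConcat α c s' t = arcConcat α c s t := by
    rw [arcConcat, arcConcat, hs' _ (Finset.mem_Icc.2 ⟨h1, h2⟩)]
  change dist (arcConcat α c s' t) (arcConcat α c s t) ≤ δ
  rw [this, dist_self]
  exact hδ.le

/-- The bijection between itineraries and trajectories in the petals that start at the origin. -/
def codingEquiv (h : RosetteParams α c) :
    (ℤ → Fin α) ≃ {γ : (rosette α h.two_le c).Omega (petals α c) // γ.1 0 = 0} :=
  Equiv.ofBijective (fun s => ⟨arcOmega h _ (isInvariant_petals h) (zero_mem_petals h.two_le) s,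
    arcConcat_zero s⟩) <| by
    constructor
    · intro s s' hs
      exact arcConcat_injective (congrArg (fun γ => γ.1.1) hs)
    · rintro ⟨⟨γ, hγ, hγ'⟩, h0⟩
      obtain ⟨s, hs⟩ := exists_arcConcat_eq h hγ h0
      exact ⟨s, Subtype.ext (Subtype.ext hs)⟩

theorem continuous_codingEquiv (h : RosetteParams α c) : Continuous (codingEquiv h) :=
  (continuous_arcOmega h _ (isInvariant_petals h) (zero_mem_petals h.two_le)).subtype_mk _

/-- Continuity of the inverse is automatic, since the shift space is compact and the space of
trajectories is Hausdorff. -/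
theorem exists_coding (h : RosetteParams α c) :
    ∃ Φ : (ℤ → Fin α) ≃ₜ {γ : (rosette α h.two_le c).Omega (petals α c) // γ.1 0 = 0},
      (∀ (s : ℤ → Fin α) (n : ℤ), ∀ u ∈ Set.Icc (0 : ℝ) 1,
        (Φ s).1.1 (n + u) = rosetteArc α c (s n) u) ∧
      ∀ s : ℤ → Fin α, (Φ fun n => s (n + 1)).1 =
        (rosette α h.two_le c).timeOne (petals α c) (Φ s).1 := by
  refine ⟨(continuous_codingEquiv h).homeoOfEquivCompactToT2,
    fun s n u hu => arcConcat_add s n hu, fun s => Subtype.ext (funext fun t => ?_)⟩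
  change arcConcat α c (fun n => s (n + 1)) t = arcConcat α c s (t + 1)
  rw [arcConcat, arcConcat, Int.floor_add_one, Int.fract_add_one]

end Coding

/-! ### Compact invariant sets as sublevel sets of the energy -/

section Compacts

variable {α : ℕ} {c : ℝ}

/-- In a sector the energy is `|y| + (c / 2) ((x - 1)² - 1)`, which bounds both coordinates. -/
theorem isBounded_energy_le (h : RosetteParams α c) (M : ℝ) :
    Bornology.IsBounded {z | rosetteEnergy α c z ≤ M} := by
  rw [isBounded_iff_forall_norm_le]
  refine ⟨3 + 2 * |M| / c + |M| + c / 2, fun z hz => ?_⟩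
  obtain ⟨j, hj⟩ := exists_mem_closedSector h.two_le z
  have hc := h.pos
  have hz' : rosetteEnergy α c z ≤ M := hz
  rw [rosetteEnergy_eq h.two_le hj] at hz'
  have hn : ‖z‖ = ‖(rosetteRot α j)⁻¹ * z‖ := by simp [norm_rosetteRot]
  rw [hn]
  set w := (rosetteRot α j)⁻¹ * z
  have hre := re_nonneg_of_mem_closedSector h.two_le hj
  have him := abs_nonneg w.im
  have hM := le_abs_self M
  have h1 : (w.re - 1) ^ 2 ≤ 2 * |M| / c + 1 := by
    have e : c * (2 * |M| / c) = 2 * |M| := by field_simp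
    have : c * (w.re - 1) ^ 2 ≤ c * (2 * |M| / c + 1) := by linarith
    exact le_of_mul_le_mul_left this hc
  have h2 : w.re ≤ 3 + 2 * |M| / c := by nlinarith [sq_nonneg (w.re - 2)]
  have h3 : |w.im| ≤ |M| + c / 2 := by nlinarith [mul_nonneg hc.le (sq_nonneg (w.re - 1))]
  have h4 := Complex.norm_le_abs_re_add_abs_im w
  rw [abs_of_nonneg hre] at h4
  linarith

theorem exists_isInvariant_superset (h : RosetteParams α c) (R : ℝ) :
    ∃ K : TopologicalSpace.Compacts ℂ,
      Metric.closedBall (0 : ℂ) R ⊆ K ∧ (rosette α h.two_le c).IsInvariant K := by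
  have hcont := continuous_rosetteEnergy (c := c) h.two_le
  obtain ⟨M, hM⟩ := ((isCompact_closedBall (0 : ℂ) R).image hcont).bddAbove
  refine ⟨⟨{z | rosetteEnergy α c z ≤ M}, Metric.isCompact_of_isClosed_isBounded
    (isClosed_le hcont continuous_const) (isBounded_energy_le h M)⟩, fun z hz => ?_, ?_⟩
  · exact hM (mem_image_of_mem _ hz)
  · rintro γ hγ ⟨t, ht⟩ t'
    have ht : rosetteEnergy α c (γ t) ≤ M := ht
    change rosetteEnergy α c (γ t') ≤ M
    rwa [hγ.rosetteEnergy_eq h t' t]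

end Compacts

/-! ### Entropy bounds from codes -/

section Entropy

variable {ι : Type} {Z : NSVF ι} {K : TopologicalSpace.Compacts ℂ}

/-- One representative of each fibre of the code suffices as a cover; values that are not attained
only add harmless points. -/
theorem coverMincard_le_card_of_code {X Y : Type*} [Nonempty X] [Fintype Y] {T : X → X}
    {U : SetRel X X} {n : ℕ} (f : X → Y)
    (hf : ∀ x y, f x = f y → ∀ k < n, (T^[k] x, T^[k] y) ∈ U) :
    Dynamics.coverMincard T univ U n ≤ Fintype.card Y := by
  classical
  have hcov : Dynamics.IsDynCoverOf T univ U n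
      ((Finset.univ.image (Function.invFun f) : Finset X) : Set X) := by
    intro x _
    refine ⟨Function.invFun f (f x), by simp, ?_⟩
    rw [Dynamics.mem_dynEntourage]
    exact hf _ _ (Function.invFun_eq ⟨x, rfl⟩).symm
  refine hcov.coverMincard_le_card.trans ?_
  exact_mod_cast Finset.card_image_le

theorem ennreal_log_natCast {a : ℕ} (ha : 0 < a) :
    ENNReal.log (a : ENNReal) = ((Real.log a : ℝ) : EReal) := by
  rw [← ENNReal.ofReal_natCast, ENNReal.log_ofReal_of_pos (by exact_mod_cast ha)]

/-- For every `r > a` the polynomial factor is eventually absorbed by `(r / a) ^ n`. The exponent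
`3` accounts for the three real parameters of a wave. -/
theorem expGrowthSup_le_log {u : ℕ → ENNReal} {a C : ℕ} (ha : 0 < a)
    (hu : ∀ n, u n ≤ ((C * (n + 1) ^ 3 * a ^ n : ℕ) : ENNReal)) :
    ExpGrowth.expGrowthSup u ≤ ((Real.log a : ℝ) : EReal) := by
  have ha' : (0 : ℝ) < a := by exact_mod_cast ha
  refine EReal.le_of_forall_lt_iff_le.1 fun x hx => ?_
  have hx' : Real.log a < x := by exact_mod_cast hx
  set r := Real.exp x with hr
  have hr0 : 0 < r := Real.exp_pos x
  have har : a < r := (Real.log_lt_iff_lt_exp ha').1 hx'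
  have hlim : Tendsto (fun n : ℕ => C * ((n + 1 : ℝ) ^ 3 * (a / r) ^ n)) atTop (𝓝 0) := by
    have h1 := tendsto_pow_const_mul_const_pow_of_lt_one 3 (by positivity : 0 ≤ a / r)
      ((div_lt_one hr0).2 har)
    have h2 := (h1.comp (tendsto_add_atTop_nat 1)).const_mul (C * (a / r)⁻¹)
    rw [mul_zero] at h2
    refine h2.congr fun n => ?_
    have : (a / r : ℝ) ≠ 0 := by positivity
    simp only [Function.comp, pow_succ (a / r : ℝ) n]
    push_cast
    field_simp
  have hev : ∀ᶠ n in atTop, u n ≤ ENNReal.ofReal r ^ n := by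
    filter_upwards [hlim.eventually_lt_const one_pos] with n hn
    refine (hu n).trans ?_
    rw [← ENNReal.ofReal_natCast, ← ENNReal.ofReal_pow hr0.le]
    refine ENNReal.ofReal_le_ofReal ?_
    push_cast
    rw [div_pow] at hn
    have hrn : 0 < r ^ n := by positivity
    have e : C * ((n + 1 : ℝ) ^ 3 * (a ^ n / r ^ n)) = C * (n + 1 : ℝ) ^ 3 * a ^ n / r ^ n := by
      ring
    rw [e, div_lt_one hrn] at hn
    exact hn.le
  refine (ExpGrowth.expGrowthSup_eventually_monotone hev).trans ?_
  rw [ExpGrowth.expGrowthSup_pow, ENNReal.log_ofReal_of_pos hr0, hr, Real.log_exp]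

theorem iterate_timeOne (k : ℕ) (γ : Z.Omega K) (t : ℝ) :
    ((Z.timeOne K)^[k] γ).1 t = γ.1 (t + k) := by
  induction k generalizing γ with
  | zero => simp
  | succ k ih =>
    rw [Function.iterate_succ_apply, ih]
    change γ.1 (t + k + 1) = _
    push_cast
    rw [add_assoc]

theorem abs_sub_le_of_floor_eq {x y η : ℝ} (hη : 0 < η) (hx : 0 ≤ x) (hy : 0 ≤ y)
    (h : ⌊x / η⌋₊ = ⌊y / η⌋₊) : |x - y| ≤ η := by
  have h1 := Nat.floor_le (div_nonneg hx hη.le)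
  have h2 := Nat.floor_le (div_nonneg hy hη.le)
  have h3 := Nat.lt_floor_add_one (x / η)
  have h4 := Nat.lt_floor_add_one (y / η)
  rw [h] at h1 h3
  have e1 : x / η * η = x := div_mul_cancel₀ _ hη.ne'
  have e2 : y / η * η = y := div_mul_cancel₀ _ hη.ne'
  rw [abs_le]
  constructor <;> nlinarith

end Entropy

/-! ### Dependence of waves on energy, period and phase -/

section WaveDistance

variable {α : ℕ} {c b T β : ℝ} {γ : ℝ → ℂ} {j : ℤ → Fin α}

theorem dist_rosetteRot_mul (j : Fin α) (z w : ℂ) :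
    dist (rosetteRot α j * z) (rosetteRot α j * w) = dist z w := by
  rw [dist_eq_norm, dist_eq_norm, ← mul_sub, norm_mul, norm_rosetteRot, one_mul]

namespace IsWave

theorem eq_zero_of_lt (hw : IsWave α c γ b T β j) (hb : b < 2) (k : ℤ) : j k = j 0 := by
  induction k using Int.induction_on with
  | zero => rfl
  | succ n ih => rw [hw.succ_of_lt hb, ih]
  | pred n ih => rw [← ih, ← hw.succ_of_lt hb (-n - 1), sub_add_cancel]

/-- Slightly outside of a cell, the wave is near the end point of the cell. -/
theorem exists_dist_le (hw : IsWave α c γ b T β j) {κ d t : ℝ} {k : ℤ} (hκ : 0 ≤ κ) (hκT : κ ≤ T)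
    (ht : |t - (β + k * T)| ≤ T / 2 + κ)
    (hd : ∀ u v : ℝ, |u| ≤ T / 2 → |v| ≤ T / 2 → |u - v| ≤ κ →
      dist (profile c b u) (profile c b v) ≤ d) :
    ∃ v, |v| ≤ T / 2 ∧ |t - (β + k * T) - v| ≤ κ ∧
      dist (γ t) (rosetteRot α (j k) * profile c b v) ≤ d := by
  have hpos := hw.period.pos
  obtain ⟨h1, h2⟩ := _root_.abs_le.1 ht
  rcases le_or_gt |t - (β + k * T)| (T / 2) with h3 | h3
  · refine ⟨t - (β + k * T), h3, by rwa [sub_self, abs_zero], ?_⟩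
    rw [hw.cell k t h3, dist_rosetteRot_mul]
    exact hd _ _ h3 h3 (by rwa [sub_self, abs_zero])
  rcases lt_abs.1 h3 with h4 | h4
  · refine ⟨T / 2, by rw [abs_of_pos (by linarith)], _root_.abs_le.2 ⟨by linarith, by linarith⟩, ?_⟩
    have e : t - (β + (k + 1 : ℤ) * T) = t - (β + k * T) - T := by push_cast; ring
    have h5 : |t - (β + (k + 1 : ℤ) * T)| ≤ T / 2 := by
      rw [e]
      exact _root_.abs_le.2 ⟨by linarith, by linarith⟩
    rw [hw.rot_mul_profile, hw.cell (k + 1) t h5, dist_rosetteRot_mul]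
    refine hd _ _ h5 (by rw [abs_neg, abs_of_pos (by linarith)]) ?_
    rw [e]
    exact _root_.abs_le.2 ⟨by linarith, by linarith⟩
  · refine ⟨-(T / 2), by rw [abs_neg, abs_of_pos (by linarith)],
      _root_.abs_le.2 ⟨by linarith, by linarith⟩, ?_⟩
    have e : t - (β + (k - 1 : ℤ) * T) = t - (β + k * T) + T := by push_cast; ring
    have h5 : |t - (β + (k - 1 : ℤ) * T)| ≤ T / 2 := by
      rw [e]
      exact _root_.abs_le.2 ⟨by linarith, by linarith⟩
    have h6 := hw.rot_mul_profile (k - 1)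
    rw [sub_add_cancel] at h6
    rw [← h6, hw.cell (k - 1) t h5, dist_rosetteRot_mul]
    refine hd _ _ h5 (by rw [abs_of_pos (by linarith)]) ?_
    rw [e]
    exact _root_.abs_le.2 ⟨by linarith, by linarith⟩

/-- In cell `k` the centres differ by at most `(1 + |k|) η` and the half periods by `η / 2`, so `t`
is within `κ` of cell `k` of the second wave. Both points are then compared with a common profile
point at time `v`, which avoids assuming that the neighbouring symbols agree. -/
theorem dist_le {b' T' β' : ℝ} {γ' : ℝ → ℂ} {j' : ℤ → Fin α} (hw : IsWave α c γ b T β j)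
    (hw' : IsWave α c γ' b' T' β' j') {S : Set (ℝ × ℝ)} {η κ δ d t : ℝ} {k : ℤ}
    (hS : ∀ p ∈ S, ∀ q ∈ S, dist p q < δ → dist (profile c p.1 p.2) (profile c q.1 q.2) ≤ d)
    (hbS : ∀ u, |u| ≤ T / 2 → (b, u) ∈ S) (hbS' : ∀ u, |u| ≤ T' / 2 → (b', u) ∈ S)
    (hη : 0 ≤ η) (hb : |b - b'| ≤ η) (hT : |T - T'| ≤ η) (hβ : |β - β'| ≤ η)
    (hk : |t - (β + k * T)| ≤ T / 2) (hj : j k = j' k) (hκ : (2 + |(k : ℝ)|) * η ≤ κ)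
    (hκT : κ ≤ T') (hκδ : 2 * κ < δ) : dist (γ t) (γ' t) ≤ 2 * d := by
  have hkη : 0 ≤ |(k : ℝ)| * η := by positivity
  have hκ0 : 0 ≤ κ := le_trans (by positivity) hκ
  have hkT : |k * (T - T')| ≤ |(k : ℝ)| * η := by
    rw [abs_mul]
    exact mul_le_mul_of_nonneg_left hT (abs_nonneg _)
  obtain ⟨a1, a2⟩ := _root_.abs_le.1 hkT
  obtain ⟨b1, b2⟩ := _root_.abs_le.1 hT
  obtain ⟨c1, c2⟩ := _root_.abs_le.1 hβ
  obtain ⟨d1, d2⟩ := _root_.abs_le.1 hk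
  obtain ⟨v, hv, hv1, hv2⟩ := hw'.exists_dist_le (κ := κ) (d := d) (t := t) (k := k) hκ0 hκT
    (_root_.abs_le.2 ⟨by linarith, by linarith⟩) fun u v hu hv huv => by
      refine hS (b', u) (hbS' u hu) (b', v) (hbS' v hv) ?_
      rw [Prod.dist_eq, dist_self, Real.dist_eq]
      exact max_lt (by linarith) (by linarith)
  obtain ⟨e1, e2⟩ := _root_.abs_le.1 hv1
  have h1 : dist (γ t) (rosetteRot α (j' k) * profile c b' v) ≤ d := by
    rw [hw.cell k t hk, hj, dist_rosetteRot_mul]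
    refine hS (b, _) (hbS _ hk) (b', v) (hbS' v hv) ?_
    rw [Prod.dist_eq, Real.dist_eq, Real.dist_eq]
    refine max_lt (by linarith) (abs_lt.2 ⟨?_, ?_⟩)
    · change -δ < t - (β + k * T) - v
      linarith
    · change t - (β + k * T) - v < δ
      linarith
  have := dist_triangle_right (γ t) (γ' t) (rosetteRot α (j' k) * profile c b' v)
  linarith

theorem le_of_norm_le (hw : IsWave α c γ b T β j) {R : ℝ} (hR : ∀ t, ‖γ t‖ ≤ R) : b ≤ R := by
  have h := hw.cell 0 β (by simpa using (half_pos hw.period.pos).le)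
  have h1 := hR β
  rw [h, norm_mul, norm_rosetteRot, one_mul] at h1
  have h2 := (Complex.abs_re_le_norm _).trans h1
  rw [profile_re] at h2
  simpa using (le_abs_self _).trans h2

end IsWave

end WaveDistance

/-! ### Counting codes and computing the entropy -/

section Coding

variable {α : ℕ} {c : ℝ}

/-- The code is a tangency, or the grid cells of `b`, `T`, `β` with an itinerary. The itinerary is a
full word on the level `b = 2`; off it, the side of the level and the initial sector suffice by
`itinerary_eq`. -/
theorem exists_code (h : RosetteParams α c) (K : TopologicalSpace.Compacts ℂ) {δ : ℝ}
    (hδ : 0 < δ) (N : ℕ) : ∃ A : ℕ, ∀ n : ℕ, ∃ f : (rosette α h.two_le c).Omega K →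
      Fin α ⊕ ((Fin (A * (n + 1)) × Fin (A * (n + 1)) × Fin (A * (n + 1))) ×
        ((Fin (n + 2 * N + 3) → Fin α) ⊕ (Bool × Fin α))),
      ∀ γ γ', f γ = f γ' → ∀ t ∈ Icc (-N : ℝ) (n + N), dist (γ.1 t) (γ'.1 t) ≤ δ := by
  obtain ⟨R₀, hR₀⟩ := K.isCompact.isBounded.subset_closedBall 0
  set R := max R₀ 1
  have hR1 : 1 ≤ R := le_max_right _ _
  have hKR : ∀ z ∈ K, ‖z‖ ≤ R := fun z hz =>
    (mem_closedBall_zero_iff.1 (hR₀ hz)).trans (le_max_left _ _)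
  set S : Set (ℝ × ℝ) := Icc 0 R ×ˢ Icc (-R) R
  have huc := (isCompact_Icc.prod isCompact_Icc : IsCompact S).uniformContinuousOn_of_continuous
    (continuous_profile c).continuousOn
  obtain ⟨δ₁, hδ₁, hS⟩ := Metric.uniformContinuousOn_iff.1 huc (δ / 2) (half_pos hδ)
  have hwave : ∀ γ : (rosette α h.two_le c).Omega K, ∀ {b T β j}, IsWave α c γ.1 b T β j →
      b ≤ R ∧ T ≤ R ∧ ∀ u, |u| ≤ T / 2 → (b, u) ∈ S := by
    intro γ b T β j hw
    have h1 := hw.le_of_norm_le fun t => hKR _ (γ.2.2 t)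
    have h2 := hw.period.le_half
    have h3 := hw.period.one_lt
    refine ⟨h1, by linarith, fun u hu => ⟨⟨by linarith, h1⟩, ?_⟩⟩
    obtain ⟨h4, h5⟩ := abs_le.1 hu
    exact ⟨by linarith, by linarith⟩
  set T₀ := min (1 / 2) δ₁ with hT₀
  have hT₀0 : 0 < T₀ := lt_min (by norm_num) hδ₁
  set κ := min T₀ (δ₁ / 4) with hκ
  have hκ0 : 0 < κ := lt_min hT₀0 (by linarith)
  have hκδ : 2 * κ < δ₁ := by linarith [min_le_right T₀ (δ₁ / 4)]
  -- every trajectory stays near a tangency or is a wave with period at least `T₀`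
  have hclass : ∀ γ : (rosette α h.two_le c).Omega K,
      (∃ j, ∀ t, dist (γ.1 t) (rosetteRot α j) ≤ δ / 2) ∨
        ∃ b T β j, IsWave α c γ.1 b T β j ∧ T₀ ≤ T := by
    intro γ
    rcases γ.2.1.exists_isWave h with ⟨j, hj⟩ | ⟨b, T, β, j, hw⟩
    · exact Or.inl ⟨j, fun t => by rw [hj, dist_self]; linarith⟩
    by_cases hT : T₀ ≤ T
    · exact Or.inr ⟨b, T, β, j, hw, hT⟩
    left
    -- A period below `T₀ ≤ 1 / 2` forces a small loop: `b` is within `δ₁` of `1`, so the orbit is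
    -- uniformly close to the tangency.
    have hTb : T = b - 1 := hw.period.half_le.resolve_left fun h' =>
      hT ((min_le_left _ _).trans h')
    have hlt : b - 1 < 1 / 2 ∧ b - 1 < δ₁ := by
      rw [← hTb]
      exact lt_min_iff.1 (not_le.1 hT)
    refine ⟨j 0, fun t => ?_⟩
    obtain ⟨k, hk⟩ := hw.exists_abs_le t
    have h1 : profile c 1 0 = 1 := by
      rw [profile]
      apply Complex.ext <;> simp
    have hb := hw.period.one_lt
    have h2 := hS (b, t - (β + k * T)) ((hwave γ hw).2.2 _ hk) (1, 0)
      ⟨⟨zero_le_one, hR1⟩, ⟨by linarith, by linarith⟩⟩ (by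
        rw [Prod.dist_eq, Real.dist_eq, Real.dist_eq]
        refine max_lt (abs_lt.2 ⟨?_, hlt.2⟩) ?_
        · change -δ₁ < b - 1
          linarith
        · change |t - (β + k * T) - 0| < δ₁
          rw [sub_zero]
          linarith)
    rw [hw.cell k t hk, hw.eq_zero_of_lt (by linarith) k]
    nth_rewrite 2 [← mul_one (rosetteRot α (j 0))]
    rw [dist_rosetteRot_mul, ← h1]
    exact h2.le
  set B := 2 * R * (3 + (N + 1) / T₀) / κ
  refine ⟨⌈B⌉₊ + 1, fun n => ?_⟩
  -- On the window the cell index satisfies `|k| ≤ (n + N) / T₀ + 1`, so this mesh gives `(2 + |k|)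
  -- η ≤ κ`. It decays like `1 / n`, hence linearly many grid cells per parameter.
  set η := κ / (3 + (n + N) / T₀) with hη
  have hη0 : 0 < η := by positivity
  have hgrid : ∀ x, x ≤ 2 * R → ⌊x / η⌋₊ < (⌈B⌉₊ + 1) * (n + 1) := by
    intro x hx
    refine Nat.floor_lt' (by positivity) |>.2 ?_
    have h1 : x / η ≤ 2 * R / η := div_le_div_of_nonneg_right hx hη0.le
    have h2 : 2 * R / η = 2 * R * (3 + (n + N) / T₀) / κ := by
      rw [hη]
      field_simp
    have h3 : (3 + (n + N) / T₀) ≤ (3 + (N + 1) / T₀) * (n + 1 : ℝ) := by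
      have h4 : (0 : ℝ) ≤ n * N / T₀ := by positivity
      have h5 : (0 : ℝ) ≤ 3 * n := by positivity
      have h6 : (0 : ℝ) ≤ 1 / T₀ := by positivity
      have e : (3 + (N + 1) / T₀) * (n + 1 : ℝ) =
          3 + (n + N) / T₀ + n * N / T₀ + 3 * n + 1 / T₀ := by field_simp; ring
      linarith
    have h4 : 2 * R * (3 + (n + N) / T₀) / κ ≤ B * (n + 1) := by
      have : B * (n + 1) = 2 * R * ((3 + (N + 1) / T₀) * (n + 1 : ℝ)) / κ := by
        simp only [B]
        ring
      rw [this]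
      gcongr
    have h5 := Nat.le_ceil B
    have h6 : B * (n + 1) < (⌈B⌉₊ + 1) * (n + 1 : ℝ) := by
      have : (0 : ℝ) < n + 1 := by positivity
      nlinarith
    push_cast
    linarith
  -- The parameters of a wave are not canonical, so the code is specified by a relation and then
  -- chosen. The phase is shifted by `R` to make it nonnegative.
  let Q : (rosette α h.two_le c).Omega K → (Fin α ⊕ ((Fin ((⌈B⌉₊ + 1) * (n + 1)) ×
      Fin ((⌈B⌉₊ + 1) * (n + 1)) × Fin ((⌈B⌉₊ + 1) * (n + 1))) ×
        ((Fin (n + 2 * N + 3) → Fin α) ⊕ (Bool × Fin α)))) → Prop := fun γ y =>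
    match y with
    | Sum.inl j => ∀ t, dist (γ.1 t) (rosetteRot α j) ≤ δ / 2
    | Sum.inr ((p, q, r), it) => ∃ b T β j, IsWave α c γ.1 b T β j ∧ T₀ ≤ T ∧ ⌊b / η⌋₊ = p ∧
        ⌊T / η⌋₊ = q ∧ ⌊(β + R) / η⌋₊ = r ∧
        match it with
        | Sum.inl f => b = 2 ∧ ∀ i : Fin (n + 2 * N + 3), j (((i : ℕ) : ℤ) - (N + 1)) = f i
        | Sum.inr (s, j₀) => ((s = true ∧ 2 < b) ∨ (s = false ∧ b < 2)) ∧ j 0 = j₀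
  have hQ : ∀ γ, ∃ y, Q γ y := by
    intro γ
    rcases hclass γ with ⟨j, hj⟩ | ⟨b, T, β, j, hw, hT⟩
    · exact ⟨Sum.inl j, hj⟩
    obtain ⟨hbR, hTR, -⟩ := hwave γ hw
    have hβ := (abs_le.1 hw.abs_le).2
    have hpos := hw.period.pos
    obtain ⟨it, hit⟩ : ∃ it : (Fin (n + 2 * N + 3) → Fin α) ⊕ (Bool × Fin α),
        match it with
        | Sum.inl f => b = 2 ∧ ∀ i : Fin (n + 2 * N + 3), j (((i : ℕ) : ℤ) - (N + 1)) = f i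
        | Sum.inr (s, j₀) => ((s = true ∧ 2 < b) ∨ (s = false ∧ b < 2)) ∧ j 0 = j₀ := by
      rcases lt_trichotomy b 2 with hb | hb | hb
      · exact ⟨Sum.inr (false, j 0), Or.inr ⟨rfl, hb⟩, rfl⟩
      · exact ⟨Sum.inl fun i => j (((i : ℕ) : ℤ) - (N + 1)), hb, fun i => rfl⟩
      · exact ⟨Sum.inr (true, j 0), Or.inl ⟨rfl, hb⟩, rfl⟩
    exact ⟨Sum.inr ((⟨_, hgrid b (by linarith)⟩, ⟨_, hgrid T (by linarith)⟩,
      ⟨_, hgrid (β + R) (by linarith)⟩), it), b, T, β, j, hw, hT, rfl, rfl, rfl, hit⟩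
  choose f hf using hQ
  refine ⟨f, fun γ γ' hγ t ht => ?_⟩
  have h1 := hf γ
  have h2 := hf γ'
  rw [← hγ] at h2
  generalize f γ = y at h1 h2
  rcases y with j | ⟨⟨p, q, r⟩, it⟩
  · have h3 := h1 t
    have h4 := h2 t
    linarith [dist_triangle_right (γ.1 t) (γ'.1 t) (rosetteRot α j)]
  obtain ⟨b, T, β, j, hw, hT, hp, hq, hr, hit⟩ := h1
  obtain ⟨b', T', β', j', hw', hT', hp', hq', hr', hit'⟩ := h2
  obtain ⟨-, hTR, hbS⟩ := hwave γ hw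
  obtain ⟨-, hTR', hbS'⟩ := hwave γ' hw'
  have hpos := hw.period.pos
  have hpos' := hw'.period.pos
  have hb1 := hw.period.one_lt
  have hb1' := hw'.period.one_lt
  obtain ⟨hβ1, hβ2⟩ := abs_le.1 hw.abs_le
  obtain ⟨hβ1', hβ2'⟩ := abs_le.1 hw'.abs_le
  have hb := abs_sub_le_of_floor_eq hη0 (by linarith) (by linarith) (hp.trans hp'.symm)
  have hTT := abs_sub_le_of_floor_eq hη0 hpos.le hpos'.le (hq.trans hq'.symm)
  have hββ := abs_sub_le_of_floor_eq hη0 (by linarith) (by linarith) (hr.trans hr'.symm)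
  rw [add_sub_add_right_eq_sub] at hββ
  obtain ⟨k, hk⟩ := hw.exists_abs_le t
  obtain ⟨hk1, hk2⟩ := abs_le.1 hk
  have htn : |t| ≤ n + N := abs_le.2 ⟨by linarith [ht.1, (Nat.cast_nonneg n : (0 : ℝ) ≤ n)], ht.2⟩
  have hkT : |(k : ℝ)| * T ≤ n + N + T := by
    rw [← abs_of_pos hpos, ← abs_mul, abs_of_pos hpos]
    obtain ⟨h3, h4⟩ := abs_le.1 htn
    exact abs_le.2 ⟨by linarith, by linarith⟩
  have hkbound : |(k : ℝ)| ≤ (n + N) / T₀ + 1 := by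
    have h3 : |(k : ℝ)| ≤ (n + N) / T + 1 := by
      rw [← div_self hpos.ne', ← add_div, le_div_iff₀ hpos]
      exact hkT
    have h4 : ((n : ℝ) + N) / T ≤ (n + N) / T₀ :=
      div_le_div_of_nonneg_left (by positivity) hT₀0 hT
    linarith
  have hj : j k = j' k := by
    rcases it with g | ⟨s, j₀⟩
    · obtain ⟨hb2, hg⟩ := hit
      obtain ⟨hb2', hg'⟩ := hit'
      have hT1 := hw.period.eq_of_eq hb2
      rw [hT1] at hk1 hk2 hβ1 hβ2
      -- For `T = 1` the cells meeting the window have indices from `-N - 1` to `n + N + 1`, which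
      -- are `n + 2 N + 3` symbols.
      have h3 : (-N - 1 : ℝ) ≤ k := by linarith [ht.1]
      have h4 : (k : ℝ) ≤ n + N + 1 := by linarith [ht.2]
      have h3' : (-N - 1 : ℤ) ≤ k := by exact_mod_cast h3
      have h4' : k ≤ n + N + 1 := by exact_mod_cast h4
      have h5 : (k + (N + 1)).toNat < n + 2 * N + 3 := by lia
      have h6 := (hg ⟨_, h5⟩).trans (hg' ⟨_, h5⟩).symm
      have e : (((k + (N + 1)).toNat : ℕ) : ℤ) - (N + 1) = k := by lia
      simpa only [e] using h6
    · obtain ⟨hs, hj0⟩ := hit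
      obtain ⟨hs', hj0'⟩ := hit'
      have hcase : (b < 2 ∧ b' < 2) ∨ (2 < b ∧ 2 < b') := by
        rcases hs with ⟨rfl, h3⟩ | ⟨rfl, h3⟩ <;> rcases hs' with ⟨h4, h5⟩ | ⟨h4, h5⟩
        · exact Or.inr ⟨h3, h5⟩
        · simp at h4
        · simp at h4
        · exact Or.inl ⟨h3, h5⟩
      exact congrFun (hw.itinerary_eq hw' (hj0.trans hj0'.symm) hcase) k
  have hκη : (2 + |(k : ℝ)|) * η ≤ κ := by
    have h3 : (2 + |(k : ℝ)|) * η ≤ (3 + (n + N) / T₀) * η :=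
      mul_le_mul_of_nonneg_right (by linarith) hη0.le
    have h4 : (3 + (n + N) / T₀) * η = κ := by
      rw [hη, mul_div_cancel₀]
      positivity
    linarith
  have hfin := hw.dist_le hw' (fun p hp q hq hpq => (hS p hp q hq hpq).le) hbS hbS' hη0.le hb hTT
    hββ hk hj hκη ((min_le_left _ _).trans hT') hκδ
  linarith

theorem exists_coverMincard_le (h : RosetteParams α c) (K : TopologicalSpace.Compacts ℂ)
    [Nonempty ((rosette α h.two_le c).Omega K)] {ε : ℝ} (hε : 0 < ε) : ∃ C : ℕ, ∀ n : ℕ,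
      Dynamics.coverMincard ((rosette α h.two_le c).timeOne K) univ {p | dist p.1 p.2 < ε} n ≤
        ((C * (n + 1) ^ 3 * α ^ n : ℕ) : ℕ∞) := by
  obtain ⟨N, δ, hδ, hclose⟩ := exists_dist_omega_lt (Z := rosette α h.two_le c) (K := K) hε
  obtain ⟨A, hA⟩ := exists_code h K hδ N
  refine ⟨α + A ^ 3 * (α ^ (2 * N + 3) + 2 * α), fun n => ?_⟩
  obtain ⟨f, hf⟩ := hA n
  refine (coverMincard_le_card_of_code f fun γ γ' hγ k hk => ?_).trans ?_
  · refine hclose _ _ fun t ht => ?_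
    rw [iterate_timeOne, iterate_timeOne]
    have hk0 : (0 : ℝ) ≤ k := Nat.cast_nonneg k
    have hkn : (k : ℝ) + 1 ≤ n := by exact_mod_cast hk
    exact hf _ _ hγ _ ⟨by linarith [ht.1], by linarith [ht.2]⟩
  · simp only [Fintype.card_sum, Fintype.card_prod, Fintype.card_fin, Fintype.card_fun,
      Fintype.card_bool]
    rw [Nat.cast_le]
    have hα : 0 < α := by linarith [h.two_le]
    have h1 : 1 ≤ (n + 1) ^ 3 * α ^ n := Nat.one_le_iff_ne_zero.2 (by positivity)
    have h2 : 1 ≤ α ^ n := Nat.one_le_iff_ne_zero.2 (by positivity)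
    calc α + A * (n + 1) * (A * (n + 1) * (A * (n + 1))) * (α ^ (n + 2 * N + 3) + 2 * α)
        = α * 1 + A ^ 3 * (n + 1) ^ 3 * (α ^ (2 * N + 3) * α ^ n + 2 * α * 1) := by
          rw [show n + 2 * N + 3 = (2 * N + 3) + n by ring, pow_add]
          ring
      _ ≤ α * ((n + 1) ^ 3 * α ^ n) +
            A ^ 3 * (n + 1) ^ 3 * (α ^ (2 * N + 3) * α ^ n + 2 * α * α ^ n) := by
          gcongr
      _ = (α + A ^ 3 * (α ^ (2 * N + 3) + 2 * α)) * (n + 1) ^ 3 * α ^ n := by ring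

theorem entropy_le (h : RosetteParams α c) (K : TopologicalSpace.Compacts ℂ)
    [Nonempty ((rosette α h.two_le c).Omega K)] :
    (rosette α h.two_le c).entropy K ≤ ((Real.log α : ℝ) : EReal) := by
  rw [NSVF.entropy, Dynamics.coverEntropy_eq_iSup_basis Metric.uniformity_basis_dist]
  refine iSup₂_le fun ε hε => ?_
  obtain ⟨C, hC⟩ := exists_coverMincard_le h K hε
  refine expGrowthSup_le_log (a := α) (C := C) (by linarith [h.two_le]) fun n => ?_
  exact_mod_cast ENat.toENNReal_mono (hC n)

/-- At time `1 / 2` the arcs are at the distinct points `2 * rosetteRot α j`, and there are finitely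
many pairs. -/
theorem exists_separation (h : RosetteParams α c) : ∃ ε > 0, ∀ j k : Fin α, j ≠ k →
    ε ≤ ∫ t in (0 : ℝ)..1, dist (rosetteArc α c j t) (rosetteArc α c k t) := by
  have hα := h.two_le
  have : Nonempty {p : Fin α × Fin α // p.1 ≠ p.2} :=
    ⟨⟨(⟨0, by lia⟩, ⟨1, by lia⟩), by simp⟩⟩
  obtain ⟨p, hp⟩ := Finite.exists_min fun p : {p : Fin α × Fin α // p.1 ≠ p.2} =>
    ∫ t in (0 : ℝ)..1, dist (rosetteArc α c p.1.1 t) (rosetteArc α c p.1.2 t)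
  refine ⟨_, ?_, fun j k hjk => hp ⟨(j, k), hjk⟩⟩
  refine intervalIntegral.integral_pos one_pos
    ((continuous_rosetteArc _).dist (continuous_rosetteArc _)).continuousOn
    (fun _ _ => dist_nonneg) ⟨1 / 2, ⟨by norm_num, by norm_num⟩, dist_pos.2 fun heq => ?_⟩
  have h2 : profile c 2 (1 / 2 - 1 / 2) = 2 := by
    rw [sub_self, profile]
    apply Complex.ext <;> simp
  rw [rosetteArc_eq, rosetteArc_eq, h2] at heq
  exact p.2 (rosetteRot_injective (mul_right_cancel₀ two_ne_zero heq))

theorem integral_le_dist_omega {ι : Type} {Z : NSVF ι} {K : TopologicalSpace.Compacts ℂ}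
    (γ γ' : Z.Omega K) : ∫ t in (0 : ℝ)..1, dist (γ.1 t) (γ'.1 t) ≤ dist γ γ' := by
  have h := (NSVF.summable_rho γ γ').le_tsum 0 fun i _ =>
    mul_nonneg (by positivity) (NSVF.integral_dist_nonneg γ γ' i)
  change _ ≤ NSVF.rho γ γ'
  rw [NSVF.rho]
  simpa using h

/-- If two words differ at place `i`, then after `i` time units the trajectories run through
different arcs during `[0, 1]`, and the term of index `0`, of weight `1`, already separates them by
`ε`. Thus their dynamical balls of radius `ε / 2` are disjoint. -/
theorem le_entropy (h : RosetteParams α c) (K : TopologicalSpace.Compacts ℂ)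
    (hK : (rosette α h.two_le c).IsInvariant K) (h0 : (0 : ℂ) ∈ K) :
    ((Real.log α : ℝ) : EReal) ≤ (rosette α h.two_le c).entropy K := by
  classical
  obtain ⟨ε, hε, hsep⟩ := exists_separation h
  have hα : 0 < α := by linarith [h.two_le]
  set U : SetRel ((rosette α h.two_le c).Omega K) ((rosette α h.two_le c).Omega K) :=
    {p | dist p.1 p.2 < ε / 2}
  refine le_trans ?_ (Dynamics.netEntropyEntourage_le_coverEntropy
    ((rosette α h.two_le c).timeOne K) univ
    (Metric.dist_mem_uniformity (half_pos hε) : U ∈ uniformity _))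
  rw [← ennreal_log_natCast hα, ← ExpGrowth.expGrowthSup_pow]
  refine ExpGrowth.expGrowthSup_monotone fun n => ?_
  let e : (Fin n → Fin α) → (rosette α h.two_le c).Omega K := fun w =>
    -- Symbols outside the places `0, …, n - 1` are arbitrary padding; negative places repeat the
    -- first letter through `toNat`.
    arcOmega h K hK h0 fun i => if hi : i.toNat < n then w ⟨i.toNat, hi⟩ else ⟨0, hα⟩
  have hdist : ∀ w w' : Fin n → Fin α, ∀ i, w i ≠ w' i →
      ε ≤ dist (((rosette α h.two_le c).timeOne K)^[(i : ℕ)] (e w))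
        (((rosette α h.two_le c).timeOne K)^[(i : ℕ)] (e w')) := by
    intro w w' i hi
    refine (hsep _ _ hi).trans (le_trans (le_of_eq ?_) (integral_le_dist_omega _ _))
    refine intervalIntegral.integral_congr fun t ht => ?_
    rw [uIcc_of_le zero_le_one] at ht
    have key : ∀ w : Fin n → Fin α, (((rosette α h.two_le c).timeOne K)^[(i : ℕ)] (e w)).1 t =
        rosetteArc α c (w i) t := by
      intro w
      rw [iterate_timeOne, add_comm]
      have := arcConcat_add (c := c)
        (fun i : ℤ => if hi : i.toNat < n then w ⟨i.toNat, hi⟩ else ⟨0, hα⟩) (i : ℕ) ht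
      simp only [Int.toNat_natCast, i.2, dif_pos] at this
      exact_mod_cast this
    simp only [key]
  have hinj : Function.Injective e := by
    intro w w' hww
    funext i
    by_contra hi
    have := hdist w w' i hi
    rw [hww, dist_self] at this
    linarith
  have hnet : Dynamics.IsDynNetIn ((rosette α h.two_le c).timeOne K) univ U n
      ((Finset.univ.image e : Finset _) : Set _) := by
    refine ⟨subset_univ _, ?_⟩
    intro x hx y hy hxy
    simp only [Finset.coe_image, Finset.coe_univ, image_univ, mem_range] at hx hy
    obtain ⟨w, rfl⟩ := hx
    obtain ⟨w', rfl⟩ := hy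
    have hne : w ≠ w' := fun h' => hxy (by rw [h'])
    obtain ⟨i, hi⟩ := Function.ne_iff.1 hne
    rw [Function.onFun, Set.disjoint_left]
    intro z hz hz'
    have h1 : dist _ _ < ε / 2 := Dynamics.mem_dynEntourage.1 hz i i.2
    have h2 : dist _ _ < ε / 2 := Dynamics.mem_dynEntourage.1 hz' i i.2
    linarith [hdist w w' i hi, dist_triangle_right
      (((rosette α h.two_le c).timeOne K)^[(i : ℕ)] (e w))
      (((rosette α h.two_le c).timeOne K)^[(i : ℕ)] (e w'))
      (((rosette α h.two_le c).timeOne K)^[(i : ℕ)] z)]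
  have hcard := hnet.card_le_netMaxcard
  rw [Finset.card_image_of_injective _ hinj, Finset.card_univ, Fintype.card_fun, Fintype.card_fin,
    Fintype.card_fin] at hcard
  refine le_trans (le_of_eq ?_) (ENat.toENNReal_mono hcard)
  simp

theorem entropy_rosette (h : RosetteParams α c) (K : TopologicalSpace.Compacts ℂ)
    (hK : (rosette α h.two_le c).IsInvariant K) (h0 : (0 : ℂ) ∈ K) :
    (rosette α h.two_le c).entropy K = ((Real.log α : ℝ) : EReal) := by
  have : Nonempty ((rosette α h.two_le c).Omega K) :=
    ⟨arcOmega h K hK h0 fun _ => ⟨0, by linarith [h.two_le]⟩⟩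
  exact le_antisymm (entropy_le h K) (le_entropy h K hK h0)

/-- The value `c = 1` is allowed exactly when `π / α ≥ π / 4`. For larger `α` the extreme slope `tan
(π / α)` is taken, for which the petals are tangent to the bounding rays at the origin. -/
theorem exists_rosetteParams (hα : 2 ≤ α) : ∃ c, RosetteParams α c ∧ (α ≤ 4 → c = 1) := by
  have h2 : (2 : ℝ) ≤ α := by exact_mod_cast hα
  by_cases h4 : α ≤ 4
  · refine ⟨1, ⟨hα, one_pos, ?_⟩, fun _ => rfl⟩
    have h4' : (α : ℝ) ≤ 4 := by exact_mod_cast h4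
    have h5 : Real.pi / 4 ≤ Real.pi / α :=
      div_le_div_of_nonneg_left Real.pi_pos.le (by linarith) h4'
    have h6 : Real.pi / α ≤ Real.pi / 2 := div_le_div_of_nonneg_left Real.pi_pos.le two_pos h2
    have hpi := Real.pi_pos
    rw [one_mul, ← Real.sin_pi_div_two_sub]
    exact Real.sin_le_sin_of_le_of_le_pi_div_two (by linarith) h6 (by linarith)
  · have h3 : (4 : ℝ) < α := by exact_mod_cast not_le.1 h4
    have hpi := Real.pi_pos
    have hcos : 0 < Real.cos (Real.pi / α) := Real.cos_pos_of_mem_Ioo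
      ⟨by linarith [show 0 < Real.pi / α by positivity],
        div_lt_div_of_pos_left hpi two_pos (by linarith)⟩
    refine ⟨Real.tan (Real.pi / α), ⟨hα, ?_, ?_⟩, fun h => absurd h h4⟩
    · rw [Real.tan_eq_sin_div_cos]
      exact div_pos (sin_pi_div_pos hα) hcos
    · rw [Real.tan_mul_cos hcos.ne']

end Coding

end

theorem mainTheorem1 (α : ℕ) (hα : 2 ≤ α) :
    ∃ (c : ℝ) (Z : NSVF (Fin α × Bool)) (Λ : TopologicalSpace.Compacts ℂ),
      0 < c ∧ (α ≤ 4 → c = 1) ∧ IsRosette α c Z ∧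
      -- every compact invariant set through the origin carries entropy `log α`,
      -- and there are arbitrarily large compact invariant sets
      (∀ K : TopologicalSpace.Compacts ℂ, Z.IsInvariant K → (0 : ℂ) ∈ K →
        Z.entropy K = ((Real.log α : ℝ) : EReal)) ∧
      (∀ R : ℝ, ∃ K : TopologicalSpace.Compacts ℂ,
        Metric.closedBall (0 : ℂ) R ⊆ K ∧ Z.IsInvariant K) ∧
      -- the invariant set of `α` closed arcs through the origin
      (Λ : Set ℂ) = ⋃ j : Fin α, rosetteArc α c j '' Set.Icc 0 1 ∧
      Z.IsInvariant Λ ∧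
      (∀ γ : Z.Omega Λ, ∃ τ ∈ Set.Ico (0 : ℝ) 1, γ.1 τ = 0) ∧
      -- the trajectories starting at the origin are the arbitrary concatenations of these arcs,
      -- and the time-one map acts on them as the full shift
      ∃ Φ : (ℤ → Fin α) ≃ₜ {γ : Z.Omega Λ // γ.1 0 = 0},
        (∀ (s : ℤ → Fin α) (n : ℤ), ∀ u ∈ Set.Icc (0 : ℝ) 1,
          (Φ s).1.1 (n + u) = rosetteArc α c (s n) u) ∧
        ∀ s : ℤ → Fin α, (Φ fun n => s (n + 1)).1 = Z.timeOne Λ (Φ s).1 := by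
  obtain ⟨c, h, hc⟩ := exists_rosetteParams hα
  exact ⟨c, rosette α hα c, petals α c, h.pos, hc, isRosette_rosette hα,
    entropy_rosette h, exists_isInvariant_superset h, rfl, isInvariant_petals h,
    exists_eq_zero_of_mem_Ico h, exists_coding h⟩
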